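/- Let $G$ be a finite group with a Real structure, i.e. a subgroup of index $2$ of a finite group $\widehat G$, and put $G^\sharp=\widehat G\setminus G$. A Real representation of $G$ is a complex vector space on which $\widehat G$ acts, elements of $G$ acting linearly and elements of $G^\sharp$ antilinearly. For $\chi\in\mathrm{Irr}(G)$ let $\mathbb F_a(\chi)$ be the endomorphism algebra of the simple $\mathbb RG$-module $U$ that occurs in a complex $G$-module affording $\chi$ (regarded as an $\mathbb RG$-module), and let $\mathbb F_d(\chi)$ be the endomorphism algebra of the simple Real representation whose restriction to $G$ contains $\chi$. Dyson's types are given by $(\mathbb F_a,\mathbb F_d)$: I $(\mathbb R,\mathbb R)$, II $(\mathbb R,\mathbb H)$, III $(\mathbb R,\mathbb C)$, IV and VII $(\mathbb C,\mathbb C)$, V $(\mathbb C,\mathbb R)$, VI $(\mathbb C,\mathbb H)$, VIII $(\mathbb H,\mathbb H)$, IX $(\mathbb H,\mathbb R)$, X $(\mathbb H,\mathbb C)$. Types IV and VII are distinguished by the size, $2$ for IV and $4$ for VII, of the orbit $\{\chi,\overline\chi,\chi^x,\overline\chi^x\}$, where $x\in G^\sharp$ and $\chi^x(z)=\chi(xzx^{-1})$.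 Let $N_I,\dots,N_X$ be the numbers of $\chi\in\mathrm{Irr}(G)$ of each type. Put $$F(\chi)=\frac1{|G|}\sum_{g\in G}\chi(g^2),\qquad F^\sharp(\chi)=\frac1{|G|}\sum_{g\in G^\sharp}\chi(g^2),$$ and let $S_v$ and $S_w$ be the numbers of positive elements of the multisets $[F^\sharp(\chi)/\chi(1)\mid\chi\in\mathrm{Irr}(G)]$ and $[F(\chi)^2F^\sharp(\chi)/\chi(1)\mid\chi\in\mathrm{Irr}(G)]$. (1) The following two equations hold: $$N_I+N_V+N_{IX}=S_v,\qquad N_I+N_{IX}=S_w.$$ (2) The left-hand sides of these two equations, together with the eight linear forms $$N_{VII},\quad N_{III}+N_X,\quad N_{IV},\quad N_V+N_{VI},\quad N_I+N_{II}+N_{VIII}+N_{IX},$$ $$N_I+N_{II}+N_{III},\quad 4N_I+N_{III}+N_V,\quad N_{II}+N_{IX},$$ are ten linearly independent linear forms (over $\mathbb Q$) in the ten unknowns $N_I,\dots,N_X$. (3) The ten numbers are determined group-theoretically. Call a conjugacy class $K$ of $G$ of type $1$ or $4$ if $\{K,K^{-1},xKx^{-1},xK^{-1}x^{-1}\}$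 ($x\in G^\sharp$) has $1$ or $4$ elements. If it has $2$ elements, call $K$ of type $2a$, $2b$, $2c$ according to whether $K=K^{-1}$, $K=xKx^{-1}$, $K=xK^{-1}x^{-1}$. Then for every $N$ there is a $k$ such that whenever $G\subset\widehat G$ and $G'\subset\widehat{G'}$ are two Real structures on groups of order $N$ that agree in the following data, they have the same numbers $N_I,\dots,N_X$: * the numbers $C_1,C_{2a},C_{2b},C_{2c},C_4$ of classes of $G$ of each type; * the number of conjugacy classes of $\widehat G$, and the number of those with $K\ne K^{-1}$; * the numbers of solutions of $y_1^2\cdots y_m^2=1$ in $G$, and of $z_1^2\cdots z_m^2=1$ with all $z_i\in G^\sharp$, for $3\le m\le c+3$, where $c$ is the number of conjugacy classes of $G$; * the number of solutions of $y_1^2\cdots y_m^2=1$ in $\widehat G$, for $3\le m\le\hat c+3$, where $\hat c$ is the number of conjugacy classes of $\widehat G$; * the number of solutions of $y_1^2y_2^2z_1^2\,y_3^2y_4^2z_2^2\cdots y_{2n-1}^2y_{2n}^2z_n^2=1$ with all $y_i\in G$ and all $z_i\in G^\sharp$, for $1\le n\le k$. -/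

import Mathlib

open scoped Quaternion ComplexConjugate

universe u

noncomputable section

/-! ### Irreducible characters, and the real/complex/quaternionic type -/

/-- The set of irreducible complex characters of a (finite) group. -/
def irrChars (H : Type u) [Group H] : Set (H → ℂ) :=
  {χ | ∃ (V : Type u) (_ : AddCommGroup V) (_ : Module ℂ V) (_ : FiniteDimensional ℂ V)
      (ρ : Representation ℂ H V), ρ.IsIrreducible ∧ ρ.character = χ}

/-- `χ` is an irreducible character of `H`, and the endomorphism algebra of the corresponding simple
real `H`-module (the simple real `H`-module `U` that maps nontrivially to a complex `H`-module `V`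
with character `χ`, regarded as a real `H`-module) is isomorphic to `A`. -/
def HasRealEnd {H : Type u} [Group H] (χ : H → ℂ) (A : Type) [Semiring A] [Algebra ℝ A] : Prop :=
  ∃ (V : Type u) (_ : AddCommGroup V) (_ : Module ℂ V) (_ : FiniteDimensional ℂ V)
    (ρ : Representation ℂ H V) (U : Type u) (_ : AddCommGroup U) (_ : Module ℝ U)
    (σ : Representation ℝ H U),
    ρ.IsIrreducible ∧ ρ.character = χ ∧ σ.IsIrreducible ∧
    (∃ f : U →ₗ[ℝ] V, f ≠ 0 ∧ ∀ h u, f (σ h u) = ρ h (f u)) ∧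
    Nonempty (Representation.IntertwiningMap σ σ ≃ₐ[ℝ] A)

/-! ### Antilinear representations of a Real structure `G ≤ Γ` -/

variable {Γ : Type u} [Group Γ]

/-- A Real representation of `G` with respect to `G ≤ Γ` (`G` of index two): the group `Γ` acts on
the complex vector space `M`, the elements of `G` complex linearly and those outside `G`
antilinearly. Equivalently, a module over the twisted group algebra of `Γ` over `ℂ`. -/
structure RealRep (G : Subgroup Γ) (M : Type u) [AddCommGroup M] [Module ℂ M] where
  act : Γ →* Module.End ℝ M
  act_smul_of_mem : ∀ g ∈ G, ∀ (a : ℂ) (m : M), act g (a • m) = a • act g m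
  act_smul_of_notMem : ∀ g ∉ G, ∀ (a : ℂ) (m : M), act g (a • m) = conj a • act g m

namespace RealRep

variable {G : Subgroup Γ} {M : Type u} [AddCommGroup M] [Module ℂ M]

/-- Simplicity: `M` is nonzero and has no proper nonzero `Γ`-stable complex subspace. -/
def IsIrreducible (R : RealRep G M) : Prop :=
  Nontrivial M ∧ ∀ W : Submodule ℂ M, (∀ g, ∀ w ∈ W, R.act g w ∈ W) → W = ⊥ ∨ W = ⊤

/-- The real algebra of complex linear endomorphisms commuting with the action of `Γ`. -/
def endAlgebra (R : RealRep G M) : Subalgebra ℝ (Module.End ℂ M) where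
  carrier := {f | ∀ g m, f (R.act g m) = R.act g (f m)}
  mul_mem' := by
    intro a b ha hb g m
    have ha' := ha g
    have hb' := hb g
    simp_all
  add_mem' := by
    intro a b ha hb g m
    have ha' := ha g
    have hb' := hb g
    simp_all
  algebraMap_mem' := by
    intro r g m
    simp [Module.algebraMap_end_apply]

end RealRep

/-- `χ` is an irreducible character of `G`, and the endomorphism algebra of the corresponding simple
Real representation (the one whose restriction to `G` contains a module with character `χ`) is
isomorphic to `A`. -/
def HasAntilinearEnd (G : Subgroup Γ) (χ : G → ℂ) (A : Type) [Semiring A] [Algebra ℝ A] : Prop :=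
  ∃ (V : Type u) (_ : AddCommGroup V) (_ : Module ℂ V) (_ : FiniteDimensional ℂ V)
    (ρ : Representation ℂ G V) (M : Type u) (_ : AddCommGroup M) (_ : Module ℂ M)
    (R : RealRep G M),
    ρ.IsIrreducible ∧ ρ.character = χ ∧ R.IsIrreducible ∧
    (∃ f : V →ₗ[ℂ] M, f ≠ 0 ∧ ∀ (g : G) (v : V), f (ρ g v) = R.act (g : Γ) (f v)) ∧
    Nonempty (R.endAlgebra ≃ₐ[ℝ] A)

/-! ### The Klein four-group acting on characters and on classes

The actions of `b` and `c` use an element outside `G`; when `G` has index two they do not depend on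
its choice. -/

/-- The function `z ↦ χ (x z x⁻¹)`. -/
def twistChar (G : Subgroup Γ) [G.Normal] (x : Γ) (χ : G → ℂ) : G → ℂ :=
  fun z => χ (MulAut.conjNormal x z)

/-- The orbit of `χ`: the functions `χ`, `conj χ`, and their twists by elements outside `G`. -/
def charOrbit (G : Subgroup Γ) [G.Normal] (χ : G → ℂ) : Set (G → ℂ) :=
  {χ, fun z => conj (χ z)} ∪
    {η | ∃ x ∉ G, η = twistChar G x χ ∨ η = fun z => conj (twistChar G x χ z)}

/-- The class of inverses of a conjugacy class. -/
def invClass {H : Type u} [Group H] (K : ConjClasses H) : ConjClasses H :=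
  Quotient.map' (s₁ := IsConj.setoid H) (s₂ := IsConj.setoid H) (fun h => h⁻¹)
    (fun a b (hab : IsConj a b) => by
      obtain ⟨c, hc⟩ := isConj_iff.1 hab
      exact isConj_iff.2 ⟨c, by rw [← hc]; group⟩) K

/-- The class `x K x⁻¹`. -/
def twistClass (G : Subgroup Γ) [G.Normal] (x : Γ) (K : ConjClasses G) : ConjClasses G :=
  ConjClasses.map (MulAut.conjNormal x : G ≃* G).toMonoidHom K

/-- The orbit of a class `K` of `G`: `K`, `K⁻¹`, and `x K x⁻¹`, `x K⁻¹ x⁻¹` for `x` outside `G`. -/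
def classOrbit (G : Subgroup Γ) [G.Normal] (K : ConjClasses G) : Set (ConjClasses G) :=
  {K, invClass K} ∪ {L | ∃ x ∉ G, L = twistClass G x K ∨ L = twistClass G x (invClass K)}

/-- The five types of conjugacy classes of `G`. -/
inductive ClassType
  | one | twoA | twoB | twoC | four

/-- Class `K` has the given type: the size of its orbit and, for orbits of size two, the element of
the Klein four-group that fixes it. -/
def ClassHasType (G : Subgroup Γ) [G.Normal] (K : ConjClasses G) : ClassType → Prop
  | .one => (classOrbit G K).ncard = 1
  | .twoA => (classOrbit G K).ncard = 2 ∧ invClass K = K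
  | .twoB => (classOrbit G K).ncard = 2 ∧ ∀ x ∉ G, twistClass G x K = K
  | .twoC => (classOrbit G K).ncard = 2 ∧ ∀ x ∉ G, twistClass G x (invClass K) = K
  | .four => (classOrbit G K).ncard = 4

/-- The numbers `C_1, C_2a, C_2b, C_2c, C_4` of classes of `G` of each type. -/
def numClasses (G : Subgroup Γ) [G.Normal] (s : ClassType) : ℕ :=
  {K : ConjClasses G | ClassHasType G K s}.ncard

/-- The number of conjugacy classes `K` of `H` with `K⁻¹ ≠ K`. -/
def numNonrealClasses (H : Type u) [Group H] : ℕ :=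
  {K : ConjClasses H | invClass K ≠ K}.ncard

/-! ### Dyson's tenfold way -/

/-- The ten types. -/
inductive DysonType
  | I | II | III | IV | V | VI | VII | VIII | IX | X

/-- `χ` is an irreducible character of `G` of the given type. The two endomorphism algebras (of the
corresponding simple real `G`-module and of the corresponding simple Real representation) determine
the type, except that both are `ℂ` for type IV (Dyson's `CC2`) and for type VII (Dyson's `CC1`);
these differ by the number, two or four, of irreducible characters in the antilinear block of `χ`,
which is the orbit of `χ` under the Klein four-group. -/
def CharHasType (G : Subgroup Γ) [G.Normal] (χ : G → ℂ) : DysonType → Prop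
  | .I => HasRealEnd χ ℝ ∧ HasAntilinearEnd G χ ℝ
  | .II => HasRealEnd χ ℝ ∧ HasAntilinearEnd G χ ℍ[ℝ]
  | .III => HasRealEnd χ ℝ ∧ HasAntilinearEnd G χ ℂ
  | .IV => HasRealEnd χ ℂ ∧ HasAntilinearEnd G χ ℂ ∧ (charOrbit G χ).ncard = 2
  | .V => HasRealEnd χ ℂ ∧ HasAntilinearEnd G χ ℝ
  | .VI => HasRealEnd χ ℂ ∧ HasAntilinearEnd G χ ℍ[ℝ]
  | .VII => HasRealEnd χ ℂ ∧ HasAntilinearEnd G χ ℂ ∧ (charOrbit G χ).ncard = 4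
  | .VIII => HasRealEnd χ ℍ[ℝ] ∧ HasAntilinearEnd G χ ℍ[ℝ]
  | .IX => HasRealEnd χ ℍ[ℝ] ∧ HasAntilinearEnd G χ ℝ
  | .X => HasRealEnd χ ℍ[ℝ] ∧ HasAntilinearEnd G χ ℂ

/-- The numbers `N_I, …, N_X` of irreducible characters of `G` of each type. -/
def numChars (G : Subgroup Γ) [G.Normal] (t : DysonType) : ℕ :=
  {χ : G → ℂ | CharHasType G χ t}.ncard

/-! ### Frobenius-Schur indicators, and the numbers `S_v` and `S_w` -/

/-- `F(χ) = |G|⁻¹ ∑_{g ∈ G} χ(g²)`. -/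
def indicator (G : Subgroup Γ) (χ : G → ℂ) : ℂ :=
  (Nat.card G : ℂ)⁻¹ * ∑ᶠ g : G, χ (g ^ 2)

open Classical in
/-- `F♯(χ) = |G|⁻¹ ∑_{x ∈ Γ \ G} χ(x²)`; if `G` has index two then all `x²` lie in `G`. -/
def sharpIndicator (G : Subgroup Γ) (χ : G → ℂ) : ℂ :=
  (Nat.card G : ℂ)⁻¹ * ∑ᶠ x : {x : Γ // x ∉ G},
    if h : (x : Γ) ^ 2 ∈ G then χ ⟨(x : Γ) ^ 2, h⟩ else 0

/-- The complex number `z` is a positive real number. -/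
def IsPositive (z : ℂ) : Prop := ∃ r : ℝ, 0 < r ∧ z = r

/-- The number of positive elements of the multiset `[F♯(χ) / χ(1) | χ ∈ Irr(G)]`. -/
def Sv (G : Subgroup Γ) : ℕ :=
  {χ ∈ irrChars G | IsPositive (sharpIndicator G χ / χ 1)}.ncard

/-- The number of positive elements of the multiset `[F(χ)² F♯(χ) / χ(1) | χ ∈ Irr(G)]`. -/
def Sw (G : Subgroup Γ) : ℕ :=
  {χ ∈ irrChars G | IsPositive (indicator G χ ^ 2 * sharpIndicator G χ / χ 1)}.ncard

/-! ### The left-hand sides of the ten equations -/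

/-- The linear form `N ↦ N_t` in the ten unknowns. -/
def unknown (t : DysonType) : Module.Dual ℚ (DysonType → ℚ) := LinearMap.proj t

open DysonType in
/-- The left-hand sides of the ten equations. -/
def tenForms : Fin 10 → Module.Dual ℚ (DysonType → ℚ) :=
  ![unknown VII,
    unknown III + unknown X,
    unknown IV,
    unknown V + unknown VI,
    unknown I + unknown II + unknown VIII + unknown IX,
    unknown I + unknown II + unknown III,
    (4 : ℚ) • unknown I + unknown III + unknown V,
    unknown II + unknown IX,
    unknown I + unknown V + unknown IX,
    unknown I + unknown IX]

/-! ### Numbers of solutions of equations in groups -/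

/-- The number of solutions of `y₁² ⋯ y_m² = 1` in `H`. -/
def squareCount (H : Type u) [Group H] (m : ℕ) : ℕ :=
  Nat.card {y : Fin m → H // (List.ofFn fun i => y i ^ 2).prod = 1}

/-- The number of solutions of `z₁² ⋯ z_m² = 1` with all `z_i` in `Γ \ G`. -/
def vCount (G : Subgroup Γ) (m : ℕ) : ℕ :=
  Nat.card {z : Fin m → Γ // (∀ i, z i ∉ G) ∧ (List.ofFn fun i => z i ^ 2).prod = 1}

/-- The number of solutions of `y₁² y₂² z₁² y₃² y₄² z₂² ⋯ y_{2n-1}² y_{2n}² z_n² = 1` with all `y_i`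
in `G` and all `z_i` in `Γ \ G`; the `i`-th triple is `(y_{2i-1}, y_{2i}, z_i)`. -/
def wCount (G : Subgroup Γ) (n : ℕ) : ℕ :=
  Nat.card {p : Fin n → Γ × Γ × Γ //
    (∀ i, (p i).1 ∈ G ∧ (p i).2.1 ∈ G ∧ (p i).2.2 ∉ G) ∧
    (List.ofFn fun i => (p i).1 ^ 2 * (p i).2.1 ^ 2 * (p i).2.2 ^ 2).prod = 1}

/-- Two Real structures `G ≤ Γ` and `G' ≤ Γ'` with the same group-theoretic data: orders, numbers of
classes of each type, and numbers of solutions of equations; of the sequence `wCount` only the first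
`k` terms are compared. -/
structure SameGroupData {Γ' : Type u} [Group Γ'] (k : ℕ) (G : Subgroup Γ) [G.Normal]
    (G' : Subgroup Γ') [G'.Normal] : Prop where
  card_eq : Nat.card G = Nat.card G'
  numClasses_eq : ∀ s, numClasses G s = numClasses G' s
  card_classes_eq : Nat.card (ConjClasses Γ) = Nat.card (ConjClasses Γ')
  nonreal_eq : numNonrealClasses Γ = numNonrealClasses Γ'
  square_eq : ∀ m, 3 ≤ m → m ≤ Nat.card (ConjClasses G) + 3 → squareCount G m = squareCount G' m
  square_hat_eq : ∀ m, 3 ≤ m → m ≤ Nat.card (ConjClasses Γ) + 3 → squareCount Γ m = squareCount Γ' m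
  v_eq : ∀ m, 3 ≤ m → m ≤ Nat.card (ConjClasses G) + 3 → vCount G m = vCount G' m
  w_eq : ∀ n, 1 ≤ n → n ≤ k → wCount G n = wCount G' n

end

noncomputable section

namespace DysonTypes

set_option linter.unusedSectionVars false

open Representation

/-! ### Irreducible representations and their characters -/

/-! Everything is read off from two indicators. Let `ρ` be irreducible on `V` with character `χ`,
and let `φ` be an automorphism of the group whose square is conjugation by an element `s` with `φ s
= s`. By Schur's lemma the antilinear maps `J` with `J ρ(h) = ρ(φ h) J` are all zero or the
multiples of a single one. In the second case `J` can be scaled so that `J² = ε ρ(s)` with `ε = ±1`,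
and `ε` does not depend on the choice. The average of `χ(g φ(g) s)` is `ε` if `J` exists and `0` if
not (`twistedIndicator_trichotomy`). For `φ = id`, `s = 1` this average is `F(χ)`. For `φ`
conjugation by some `x ∉ G` and `s = x²` it is `F♯(χ)`, because `(g x)² = g (x g x⁻¹) x²`.

The same `J` decides whether `V` has a real form, respectively whether `V` extends to a Real
representation. So the values `1, 0, -1` of `F` and of `F♯` correspond to the endomorphism algebras
`ℝ, ℂ, ℍ` (`realEnd_matchesIndicator`, `antilinearEnd_matchesIndicator`). Thus `(F, F♯)` determines
the Dyson type, except that `(0, 0)` splits into IV and VII according to whether `χ^x = χ`. Part (1)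
follows: `F♯ = 1` on types I, V, IX, and `F² F♯ = 1` on types I, IX.

For (3), ten quantities that are linear in the unknowns are shown to depend only on the data
(`numChars_equations`). This system is not quite the one of (2), and it is solved directly by
elimination. Its equations have three sources.

Brauer's permutation lemma equates the numbers of characters and of classes that an element of the
Klein four-group fixes.

Restriction from `Γ` to `G` expresses indicators of `Γ` by those of `G`: a character with `χ^x = χ`
lies below two characters of `Γ` with indicator `(F + F♯) / 2`, and a pair `χ ≠ χ^x` lies below one
with indicator `F + F♯` (`sum_irr_hat`).

Frobenius's formula turns numbers of solutions into sums of `χ(1)² (|G| F / χ(1))^m`, and likewise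
for `F♯`. As the indicators lie in `{1, 0, -1}`, for `m ≥ 3` these are the power sums of `F / χ(1)`
up to a known factor, and by Newton's identities finitely many of them determine the multiset. For
the mixed equation the terms are `χ(1)² (F² F♯ / χ(1)³)^n`, and the weight does not cancel. However,
for `|G| = N` the bases lie in the finite set of `0` and `±d⁻³` with `d ≤ N`. A polynomial of degree
at most `2N` without constant term, with value `d⁻²` at `d⁻³` and `0` at `-d⁻³`, therefore combines
the first `2N` sums into the number of `χ` with `F² F♯ = 1`. Hence `k = 2N` suffices. -/

theorem isIrreducible_iff {k H V : Type*} [Field k] [Group H] [AddCommGroup V] [Module k V]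
    (ρ : Representation k H V) :
    ρ.IsIrreducible ↔ Nontrivial V ∧
      ∀ W : Submodule k V, (∀ h, ∀ w ∈ W, ρ h w ∈ W) → W = ⊥ ∨ W = ⊤ := by
  constructor
  · intro h
    refine ⟨?_, fun W hW => ?_⟩
    · by_contra hV
      rw [not_nontrivial_iff_subsingleton] at hV
      apply bot_ne_top (α := Subrepresentation ρ)
      apply Subrepresentation.toSubmodule_injective
      exact Subsingleton.elim _ _
    · rcases h.eq_bot_or_eq_top ⟨W, fun g v hv => hW g v hv⟩ with h | h
      · exact Or.inl (congrArg Subrepresentation.toSubmodule h)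
      · exact Or.inr (congrArg Subrepresentation.toSubmodule h)
  · rintro ⟨hV, h⟩
    have : Nontrivial (Subrepresentation ρ) := by
      refine ⟨⊥, ⊤, fun h => ?_⟩
      have := congrArg Subrepresentation.toSubmodule h
      exact bot_ne_top (α := Submodule k V) this
    refine ⟨fun W => ?_⟩
    rcases h W.toSubmodule (fun g v hv => W.apply_mem_toSubmodule g hv) with h | h
    · exact Or.inl (Subrepresentation.toSubmodule_injective h)
    · exact Or.inr (Subrepresentation.toSubmodule_injective h)

theorem exists_scalar {H V : Type*} [Group H] [AddCommGroup V] [Module ℂ V]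
    [FiniteDimensional ℂ V] (ρ : Representation ℂ H V) (hρ : ρ.IsIrreducible)
    (T : V →ₗ[ℂ] V) (hT : ∀ h v, T (ρ h v) = ρ h (T v)) : ∃ c : ℂ, T = c • LinearMap.id := by
  let f : IntertwiningMap ρ ρ := ⟨T, fun h => LinearMap.ext (hT h)⟩
  obtain ⟨c, hc⟩ := (IsIrreducible.algebraMap_intertwiningMap_bijective_of_isAlgClosed (ρ := ρ)).2 f
  refine ⟨c, LinearMap.ext fun v => ?_⟩
  have := congrArg (fun e : IntertwiningMap ρ ρ => e v) hc
  simp only [Algebra.algebraMap_eq_smul_one] at this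
  exact this.symm

theorem finrank_pos_of_isIrreducible {H V : Type*} [Group H] [AddCommGroup V] [Module ℂ V]
    [FiniteDimensional ℂ V] {ρ : Representation ℂ H V} (hρ : ρ.IsIrreducible) :
    0 < Module.finrank ℂ V := by
  have := ((isIrreducible_iff ρ).1 hρ).1
  exact Module.finrank_pos

/-- A commuting operator is the scalar with the same trace. -/
theorem finrank_smul_eq_trace_smul {H V : Type*} [Group H] [AddCommGroup V] [Module ℂ V]
    [FiniteDimensional ℂ V] (ρ : Representation ℂ H V) (hρ : ρ.IsIrreducible)
    (T : V →ₗ[ℂ] V) (hT : ∀ h v, T (ρ h v) = ρ h (T v)) :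
    T = (LinearMap.trace ℂ V T / Module.finrank ℂ V) • LinearMap.id := by
  obtain ⟨c, rfl⟩ := exists_scalar ρ hρ T hT
  have h0 : (Module.finrank ℂ V : ℂ) ≠ 0 := by
    exact_mod_cast (finrank_pos_of_isIrreducible hρ).ne'
  rw [map_smul, LinearMap.trace_id, smul_eq_mul, mul_div_assoc, div_self h0, mul_one]

/-- Every character of a finite group is a sum of irreducible characters. -/
theorem exists_character_eq_sum {H : Type u} [Group H] [Finite H] (n : ℕ) :
    ∀ (V : Type u) [AddCommGroup V] [Module ℂ V] [FiniteDimensional ℂ V]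
      (ρ : Representation ℂ H V), Module.finrank ℂ V = n →
      ∃ s : Multiset (H → ℂ), (∀ χ ∈ s, χ ∈ irrChars H) ∧ ρ.character = s.sum := by
  induction n using Nat.strong_induction_on with
  | _ n ih =>
  intro V _ _ _ ρ hn
  by_cases hV : Nontrivial V
  swap
  · rw [not_nontrivial_iff_subsingleton] at hV
    refine ⟨0, by simp, funext fun h => ?_⟩
    have : ρ h = 0 := Subsingleton.elim _ _
    simp [character, this]
  by_cases hirr : ρ.IsIrreducible
  · exact ⟨{ρ.character}, by simpa using ⟨V, _, _, ‹_›, ρ, hirr, rfl⟩, by simp⟩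
  rw [isIrreducible_iff] at hirr
  push Not at hirr
  obtain ⟨W, hW, h0, h1⟩ := hirr hV
  let W' : Subrepresentation ρ := ⟨W, fun g v hv => hW g v hv⟩
  have : NeZero (Nat.card H : ℂ) := ⟨by exact_mod_cast Nat.card_pos.ne'⟩
  have hss : IsSemisimpleRepresentation ρ := inferInstance
  obtain ⟨X, hX⟩ := exists_isCompl W'
  have hc : IsCompl W X.toSubmodule := by
    rw [isCompl_iff, disjoint_iff, codisjoint_iff] at hX ⊢
    exact ⟨congrArg Subrepresentation.toSubmodule hX.1,
      congrArg Subrepresentation.toSubmodule hX.2⟩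
  have hsum := Submodule.finrank_add_eq_of_isCompl hc
  have hW0 : 0 < Module.finrank ℂ W := by
    rw [Module.finrank_pos_iff]; exact Submodule.nontrivial_iff_ne_bot.2 h0
  have hWn : Module.finrank ℂ W < Module.finrank ℂ V := Submodule.finrank_lt h1
  obtain ⟨s, hs, hs'⟩ := ih _ (by omega) W W'.toRepresentation rfl
  obtain ⟨t, ht, ht'⟩ := ih _ (by omega) X.toSubmodule X.toRepresentation rfl
  refine ⟨s + t, fun χ hχ => ?_, ?_⟩
  · rcases Multiset.mem_add.1 hχ with h | h
    exacts [hs _ h, ht _ h]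
  · rw [Multiset.sum_add, ← hs', ← ht']
    funext h
    simp only [character, Pi.add_apply]
    rw [← LinearMap.trace_prodMap', ← LinearMap.trace_conj' _ (Submodule.prodEquivOfIsCompl _ _ hc)]
    congr 1
    ext v
    obtain ⟨⟨a, b⟩, rfl⟩ := (Submodule.prodEquivOfIsCompl _ _ hc).surjective v
    rw [LinearEquiv.conj_apply_apply, LinearEquiv.symm_apply_apply]
    simp [Subrepresentation.toRepresentation]

/-- The bilinear form on functions for which irreducible characters are orthonormal. -/
def charInner {H : Type u} [Group H] [Fintype H] (f h : H → ℂ) : ℂ :=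
  (Nat.card H : ℂ)⁻¹ * ∑ g : H, f g * h g⁻¹

/-! ### Orthogonality relations for irreducible characters -/

section

variable {H : Type u} [Group H] [Fintype H]

theorem natCard_ne_zero (H : Type*) [Group H] [Finite H] : (Nat.card H : ℂ) ≠ 0 := by
  exact_mod_cast Nat.card_pos.ne'

open Classical in
theorem charInner_irrChars {χ η : H → ℂ} (hχ : χ ∈ irrChars H) (hη : η ∈ irrChars H) :
    charInner χ η = if χ = η then 1 else 0 := by
  obtain ⟨V, _, _, _, ρ, hρ, rfl⟩ := hχ
  obtain ⟨W, _, _, _, σ, hσ, rfl⟩ := hη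
  have : Invertible (Nat.card H : ℂ) := invertibleOfNonzero (natCard_ne_zero H)
  have h1 := char_orthonormal ρ σ
  by_cases hiso : Nonempty (Equiv σ ρ)
  · obtain ⟨e⟩ := hiso
    rw [if_pos ⟨e⟩] at h1
    rw [if_pos (char_iso e).symm]
    exact h1
  · rw [if_neg hiso] at h1
    have : ρ.character ≠ σ.character := by
      intro h
      have h2 := char_orthonormal ρ ρ
      rw [if_pos ⟨Representation.Equiv.refl ρ⟩] at h2
      rw [← h, h2] at h1
      exact one_ne_zero h1
    rw [if_neg this]
    exact h1

theorem charInner_add_left (f₁ f₂ h : H → ℂ) :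
    charInner (f₁ + f₂) h = charInner f₁ h + charInner f₂ h := by
  simp [charInner, add_mul, Finset.sum_add_distrib, mul_add]

theorem charInner_smul_left (c : ℂ) (f h : H → ℂ) :
    charInner (c • f) h = c * charInner f h := by
  simp only [charInner, Pi.smul_apply, smul_eq_mul, mul_assoc, ← Finset.mul_sum]
  ring

theorem charInner_comm (f h : H → ℂ) : charInner f h = charInner h f := by
  simp only [charInner]
  congr 1
  rw [← Equiv.sum_comp (Equiv.inv H)]
  exact Finset.sum_congr rfl fun g _ => by simp [mul_comm]

theorem linearIndependent_irrChars :
    LinearIndependent ℂ (fun χ : irrChars H => (χ : H → ℂ)) := by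
  classical
  rw [linearIndependent_iff']
  intro s c hs i hi
  let L : (H → ℂ) →ₗ[ℂ] ℂ :=
    { toFun := fun f => charInner f i
      map_add' := fun a b => charInner_add_left _ _ _
      map_smul' := fun a b => charInner_smul_left _ _ _ }
  have := congrArg L hs
  rw [map_sum, map_zero] at this
  rw [← this, Finset.sum_eq_single i]
  · simp [L, charInner_irrChars i.2 i.2]
  · intro j _ hj
    have : (j : H → ℂ) ≠ i := fun h => hj (Subtype.ext h)
    simp [L, charInner_irrChars j.2 i.2, this]
  · exact fun h => absurd hi h

end

theorem finite_irrChars (H : Type u) [Group H] [Finite H] : (irrChars H).Finite := by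
  have := Fintype.ofFinite H
  have h := (linearIndependent_irrChars (H := H)).finite
  exact h

/-- The finite set of irreducible characters. -/
def irr (H : Type u) [Group H] [Finite H] : Finset (H → ℂ) := (finite_irrChars H).toFinset

theorem mem_irr {H : Type u} [Group H] [Finite H] {χ : H → ℂ} : χ ∈ irr H ↔ χ ∈ irrChars H := by
  simp [irr]

section

variable {H : Type u} [Group H] [Fintype H]

open Classical in
/-- A character is the combination of irreducible characters with coefficients its multiplicities,
which are natural numbers. -/
theorem character_eq_sum {V : Type u} [AddCommGroup V] [Module ℂ V] [FiniteDimensional ℂ V]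
    (ρ : Representation ℂ H V) :
    (∀ χ ∈ irr H, ∃ n : ℕ, charInner ρ.character χ = n) ∧
      ρ.character = ∑ χ ∈ irr H, charInner ρ.character χ • χ := by
  obtain ⟨s, hs, hs'⟩ := exists_character_eq_sum _ V ρ rfl
  have hsub : s.toFinset ⊆ irr H := fun χ hχ => mem_irr.2 (hs χ (Multiset.mem_toFinset.1 hχ))
  have key : ρ.character = ∑ χ ∈ irr H, (s.count χ : ℂ) • χ := by
    rw [hs', Finset.sum_multiset_count, Finset.sum_subset hsub]
    · simp [Nat.cast_smul_eq_nsmul]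
    · intro χ _ h
      simp [Multiset.count_eq_zero.2 (fun h' => h (Multiset.mem_toFinset.2 h'))]
  have hcoef : ∀ χ ∈ irr H, charInner ρ.character χ = s.count χ := by
    intro χ hχ
    let L : (H → ℂ) →ₗ[ℂ] ℂ :=
      { toFun := fun f => charInner f χ
        map_add' := fun a b => charInner_add_left _ _ _
        map_smul' := fun a b => charInner_smul_left _ _ _ }
    have : charInner ρ.character χ = L (∑ χ ∈ irr H, (s.count χ : ℂ) • χ) := by
      rw [← key]; rfl
    rw [this, map_sum, Finset.sum_eq_single χ]
    · simp [L, charInner_irrChars (mem_irr.1 hχ) (mem_irr.1 hχ)]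
    · intro j hj hne
      simp [L, charInner_irrChars (mem_irr.1 hj) (mem_irr.1 hχ), hne]
    · exact fun h => absurd hχ h
  refine ⟨fun χ hχ => ⟨_, hcoef χ hχ⟩, ?_⟩
  conv_lhs => rw [key]
  exact Finset.sum_congr rfl fun χ hχ => by rw [hcoef χ hχ]

open Classical in
theorem character_leftRegular (g : H) :
    (leftRegular ℂ H).character g = if g = 1 then (Nat.card H : ℂ) else 0 := by
  rw [character, LinearMap.trace_eq_matrix_trace ℂ (MonoidAlgebra.basis H ℂ), Matrix.trace]
  have hr : ∀ f : MonoidAlgebra ℂ H, ∀ h, (MonoidAlgebra.basis H ℂ).repr f h = f.coeff h :=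
    fun _ _ => rfl
  simp only [Matrix.diag, LinearMap.toMatrix_apply, hr, MonoidAlgebra.basis_apply]
  by_cases h : g = 1
  · subst h; simp
  · simp [h]

open Classical in
-- The regular character contains `χ` with multiplicity `χ(1)`.
theorem sum_irr_apply_one_mul (g : H) :
    ∑ χ ∈ irr H, χ 1 * χ g = if g = 1 then (Nat.card H : ℂ) else 0 := by
  rw [← character_leftRegular]
  conv_rhs => rw [(character_eq_sum (leftRegular ℂ H)).2]
  simp only [Finset.sum_apply, Pi.smul_apply, smul_eq_mul]
  refine Finset.sum_congr rfl fun χ _ => ?_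
  congr 1
  rw [charInner, Finset.sum_eq_single 1]
  · rw [character_leftRegular, if_pos rfl, inv_one, inv_mul_cancel_left₀ (natCard_ne_zero H)]
  · intro b _ hb; simp [character_leftRegular, hb]
  · simp

omit [Fintype H] in
theorem irrChars_apply_one {χ : H → ℂ} (hχ : χ ∈ irrChars H) : ∃ d : ℕ, 0 < d ∧ χ 1 = d := by
  obtain ⟨V, _, _, _, ρ, hρ, rfl⟩ := hχ
  exact ⟨_, finrank_pos_of_isIrreducible hρ, char_one ρ⟩

omit [Fintype H] in
theorem irrChars_conj {χ : H → ℂ} (hχ : χ ∈ irrChars H) (g h : H) : χ (h * g * h⁻¹) = χ g := by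
  obtain ⟨V, _, _, _, ρ, hρ, rfl⟩ := hχ
  exact char_conj ρ g h

/-- The sum of `ρ` over the conjugates of `g` commutes with `ρ`, so it is a scalar, found by
comparing traces. -/
theorem sum_conj_mul {χ : H → ℂ} (hχ : χ ∈ irrChars H) (g h : H) :
    χ 1 * ∑ c : H, χ (c * g * c⁻¹ * h) = Nat.card H * (χ g * χ h) := by
  obtain ⟨V, _, _, _, ρ, hρ, rfl⟩ := hχ
  let T : V →ₗ[ℂ] V := ∑ c : H, ρ (c * g * c⁻¹)
  have hT := finrank_smul_eq_trace_smul ρ hρ T (by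
    intro a v
    simp only [T, LinearMap.sum_apply, map_sum]
    rw [← Equiv.sum_comp (Equiv.mulLeft a)]
    refine Finset.sum_congr rfl fun c _ => ?_
    rw [← Module.End.mul_apply, ← Module.End.mul_apply, ← map_mul, ← map_mul]
    simp [mul_assoc])
  have htr : LinearMap.trace ℂ V T = Nat.card H * ρ.character g := by
    simp only [T, map_sum]
    exact (Finset.sum_congr rfl (fun c _ => char_conj ρ g c)).trans (by simp)
  have h2 : ∑ c : H, ρ.character (c * g * c⁻¹ * h) = LinearMap.trace ℂ V (T * ρ h) := by
    simp only [T, Finset.sum_mul, map_sum, ← map_mul, character]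
  have h0 : (Module.finrank ℂ V : ℂ) ≠ 0 := by
    exact_mod_cast (finrank_pos_of_isIrreducible hρ).ne'
  rw [h2, hT, htr, char_one, smul_mul_assoc, map_smul, smul_eq_mul]
  change _ * (_ * LinearMap.trace ℂ V (ρ h)) = _
  rw [character]
  field_simp
  rfl

open Classical in
/-- Column orthogonality. -/
theorem sum_irr_mul_inv (g h : H) :
    ∑ χ ∈ irr H, χ g * χ h⁻¹ = Fintype.card {c : H // c * g * c⁻¹ = h} := by
  have hc := natCard_ne_zero H
  apply mul_left_cancel₀ hc
  -- Each product of values becomes a sum of `χ(1) χ(c g c⁻¹ h⁻¹)` over `c`. Summed over `χ` this is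
  -- the regular character, which detects `c g c⁻¹ = h`.
  rw [Finset.mul_sum, Finset.sum_congr rfl
    (fun χ hχ => (sum_conj_mul (mem_irr.1 hχ) g h⁻¹).symm)]
  simp_rw [Finset.mul_sum]
  rw [Finset.sum_comm]
  simp_rw [sum_irr_apply_one_mul, mul_inv_eq_one]
  rw [Fintype.card_subtype, Finset.sum_ite]
  simp [mul_comm]

end

/-! ### Irreducibility by norm one, and Brauer's permutation lemma -/

section

variable {H : Type u} [Group H] [Fintype H]

theorem charInner_sum_left {ι : Type*} (s : Finset ι) (f : ι → H → ℂ) (h : H → ℂ) :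
    charInner (∑ i ∈ s, f i) h = ∑ i ∈ s, charInner (f i) h :=
  map_sum (⟨⟨fun f => charInner f h, by simp [charInner]⟩, fun a b => charInner_add_left a b h⟩ :
    (H → ℂ) →+ ℂ) f s

theorem charInner_character_self {V : Type u} [AddCommGroup V] [Module ℂ V]
    [FiniteDimensional ℂ V] (ρ : Representation ℂ H V) :
    charInner ρ.character ρ.character = ∑ χ ∈ irr H, charInner ρ.character χ ^ 2 := by
  refine (congrArg (charInner · ρ.character) (character_eq_sum ρ).2).trans ?_
  simp only [charInner_sum_left]
  refine Finset.sum_congr rfl fun χ _ => ?_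
  rw [charInner_smul_left, charInner_comm χ, sq]

/-- The squares of the multiplicities are natural numbers with sum `1`, so exactly one constituent
occurs, once. -/
theorem character_mem_irrChars {V : Type u} [AddCommGroup V] [Module ℂ V]
    [FiniteDimensional ℂ V] (ρ : Representation ℂ H V)
    (h : charInner ρ.character ρ.character = 1) : ρ.character ∈ irrChars H := by
  classical
  obtain ⟨h1, h2⟩ := character_eq_sum ρ
  choose! n hn using h1
  have hsum : ∑ χ ∈ irr H, n χ ^ 2 = 1 := by
    rw [charInner_character_self, Finset.sum_congr rfl fun χ hχ => by rw [hn χ hχ]] at h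
    exact_mod_cast h
  obtain ⟨χ, hχ, hne⟩ : ∃ χ ∈ irr H, n χ ≠ 0 := by
    by_contra! h0
    rw [Finset.sum_eq_zero fun χ hχ => by simp [h0 χ hχ]] at hsum
    exact zero_ne_one hsum
  have hpos : 1 ≤ n χ ^ 2 := Nat.one_le_iff_ne_zero.2 (pow_ne_zero 2 hne)
  rw [← Finset.add_sum_erase _ _ hχ] at hsum
  have hz : ∑ η ∈ (irr H).erase χ, n η ^ 2 = 0 := by omega
  have h1 : n χ = 1 := by
    have : n χ ^ 2 = 1 := by omega
    simpa using this
  rw [Finset.sum_eq_zero_iff] at hz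
  rw [h2, ← Finset.add_sum_erase _ _ hχ, Finset.sum_eq_zero, add_zero, hn χ hχ, h1]
  · simpa using mem_irr.1 hχ
  · intro η hη
    have := hz η hη
    rw [hn η (Finset.mem_of_mem_erase hη), pow_eq_zero_iff two_ne_zero |>.1 this]
    simp

theorem irrChars_comp_inv {χ : H → ℂ} (hχ : χ ∈ irrChars H) : (fun g => χ g⁻¹) ∈ irrChars H := by
  classical
  have h1 : charInner χ χ = 1 := by rw [charInner_irrChars hχ hχ, if_pos rfl]
  obtain ⟨V, _, _, _, ρ, hρ, rfl⟩ := hχ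
  have : ρ.dual.character = fun g => ρ.character g⁻¹ := funext (char_dual ρ)
  rw [← this]
  have hd : charInner ρ.dual.character ρ.dual.character = 1 := by
    rw [this, ← h1, charInner, charInner, ← Equiv.sum_comp (Equiv.inv H)]
    simp
  exact character_mem_irrChars ρ.dual hd

theorem irrChars_comp_mulEquiv {χ : H → ℂ} (hχ : χ ∈ irrChars H) (φ : H ≃* H) :
    (fun g => χ (φ g)) ∈ irrChars H := by
  classical
  have h1 : charInner χ χ = 1 := by rw [charInner_irrChars hχ hχ, if_pos rfl]
  obtain ⟨V, _, _, _, ρ, hρ, rfl⟩ := hχ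
  refine character_mem_irrChars (ρ.comp φ.toMonoidHom) ?_
  rw [← h1, charInner, charInner]
  conv_rhs => rw [← Equiv.sum_comp φ.toEquiv]
  simp [character]

open Classical in
theorem card_conj_eq_of_isConj {a b : H} (h : IsConj a b) (g : H) :
    Fintype.card {c : H // c * a * c⁻¹ = g} = Fintype.card {c : H // c * b * c⁻¹ = g} := by
  obtain ⟨d, rfl⟩ := isConj_iff.1 h
  exact Fintype.card_congr ⟨fun c => ⟨c * d⁻¹, Eq.trans (by group) c.2⟩,
    fun c => ⟨c * d, Eq.trans (by group) c.2⟩, fun c => by simp, fun c => by simp⟩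

open Classical in
theorem sum_card_conj (a : H) :
    ∑ g : H, Fintype.card {c : H // c * a * c⁻¹ = g} = Fintype.card H := by
  rw [← Fintype.card_sigma]
  exact Fintype.card_congr (Equiv.sigmaFiberEquiv fun c : H => c * a * c⁻¹)

open Classical in
/-- Brauer's permutation lemma: a permutation of the group that acts on irreducible characters and on
conjugacy classes fixes equally many of them. -/
theorem card_fixed_irr_eq (σ : H → H) (hσ : ∀ χ ∈ irrChars H, (fun g => χ (σ g)) ∈ irrChars H)
    (τ : ConjClasses H → ConjClasses H) (hτ : ∀ g, τ (ConjClasses.mk g) = ConjClasses.mk (σ g)) :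
    ((irr H).filter fun χ => (fun g => χ (σ g)) = χ).card =
      {K : ConjClasses H | τ K = K}.ncard := by
  -- By orthonormality each fixed character contributes `⟨χ ∘ σ, χ⟩ = 1` and every other one `0`.
  -- Column orthogonality converts the total into a count of `c` with `c σ(g) c⁻¹ = g`.
  have h1 : ((((irr H).filter fun χ => (fun g => χ (σ g)) = χ).card : ℕ) : ℂ) =
      (Nat.card H : ℂ)⁻¹ * ((∑ g : H, Fintype.card {c : H // c * σ g * c⁻¹ = g} : ℕ) : ℂ) := by
    rw [Finset.card_filter, Nat.cast_sum, Nat.cast_sum]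
    rw [Finset.sum_congr rfl fun χ hχ => (by
      rw [charInner_irrChars (hσ χ (mem_irr.1 hχ)) (mem_irr.1 hχ)]; simp :
      (((if (fun g => χ (σ g)) = χ then 1 else 0 : ℕ)) : ℂ) = charInner (fun g => χ (σ g)) χ)]
    simp only [charInner]
    rw [← Finset.mul_sum, Finset.sum_comm]
    congr 1
    exact Finset.sum_congr rfl fun g _ => sum_irr_mul_inv (σ g) g
  -- Summed over `g` in one class, this count is `|H|` if `τ` fixes the class and `0` otherwise.
  have h2 : ∑ g : H, Fintype.card {c : H // c * σ g * c⁻¹ = g} =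
      Nat.card H * {K : ConjClasses H | τ K = K}.ncard := by
    rw [← Finset.sum_fiberwise Finset.univ ConjClasses.mk]
    have : ∀ K : ConjClasses H, ∑ g : H with ConjClasses.mk g = K,
        Fintype.card {c : H // c * σ g * c⁻¹ = g} = if τ K = K then Nat.card H else 0 := by
      intro K
      obtain ⟨a, rfl⟩ := ConjClasses.mk_surjective K
      split_ifs with h
      · rw [Nat.card_eq_fintype_card, ← sum_card_conj a, Finset.sum_filter]
        refine Finset.sum_congr rfl fun g _ => ?_
        split_ifs with hg
        · apply card_conj_eq_of_isConj
          rw [← ConjClasses.mk_eq_mk_iff_isConj, ← hτ, hg, h]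
        · symm
          rw [Fintype.card_eq_zero_iff]
          exact ⟨fun c => hg (ConjClasses.mk_eq_mk_iff_isConj.2
            (isConj_comm.1 (isConj_iff.2 ⟨c.1, c.2⟩)))⟩
      · refine Finset.sum_eq_zero fun g hg => ?_
        rw [Fintype.card_eq_zero_iff]
        refine ⟨fun c => h ?_⟩
        rw [← (Finset.mem_filter.1 hg).2, hτ]
        exact ConjClasses.mk_eq_mk_iff_isConj.2 (isConj_iff.2 ⟨c.1, c.2⟩)
    rw [Finset.sum_congr rfl fun K _ => this K, ← Finset.sum_filter, Finset.sum_const, smul_eq_mul,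
      mul_comm, Set.ncard_eq_toFinset_card']
    simp
  rw [h2] at h1
  push_cast at h1
  rw [inv_mul_cancel_left₀ (natCard_ne_zero H)] at h1
  exact_mod_cast h1

theorem card_irr : (irr H).card = Nat.card (ConjClasses H) := by
  classical
  have := card_fixed_irr_eq (H := H) id (fun χ hχ => hχ) id (fun _ => rfl)
  simpa [Set.ncard_univ] using this

end

section

open Matrix
open scoped ComplexOrder

/-! ### Unitary matrix forms of irreducible representations -/

open scoped MatrixOrder in
theorem exists_isUnit_conjTranspose_mul_eq {d : ℕ} {A : Matrix (Fin d) (Fin d) ℂ} (hA : A.PosDef) :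
    ∃ S : Matrix (Fin d) (Fin d) ℂ, IsUnit S ∧ Sᴴ * S = A := by
  obtain ⟨S, hS⟩ := CStarAlgebra.nonneg_iff_eq_star_mul_self.mp hA.posSemidef.nonneg
  refine ⟨S, ?_, hS.symm⟩
  have := hA.isUnit
  rw [hS] at this
  rw [Matrix.isUnit_iff_isUnit_det] at this ⊢
  rw [Matrix.det_mul] at this
  exact isUnit_of_mul_isUnit_right this

/-- Weyl's trick: `A = ∑ P₀(h)ᴴ P₀(h)` is positive definite and invariant, and conjugation by `S`
with `Sᴴ S = A` makes all matrices unitary. -/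
theorem exists_unitary_form {H V : Type*} [Group H] [Fintype H] [AddCommGroup V] [Module ℂ V]
    [FiniteDimensional ℂ V] (ρ : Representation ℂ H V) :
    ∃ (e : V ≃ₗ[ℂ] (Fin (Module.finrank ℂ V) → ℂ))
      (P : H →* Matrix (Fin (Module.finrank ℂ V)) (Fin (Module.finrank ℂ V)) ℂ),
      (∀ h v, e (ρ h v) = P h *ᵥ e v) ∧ ∀ h, P h⁻¹ = (P h)ᴴ := by
  set d := Module.finrank ℂ V
  let b := Module.finBasis ℂ V
  let P₀ : H →* Matrix (Fin d) (Fin d) ℂ :=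
    { toFun := fun h => LinearMap.toMatrix b b (ρ h)
      map_one' := by simp
      map_mul' := fun x y => by simp [LinearMap.toMatrix_mul] }
  let A : Matrix (Fin d) (Fin d) ℂ := ∑ h : H, (P₀ h)ᴴ * P₀ h
  have hunit : ∀ h, IsUnit (P₀ h) := fun h => (Group.isUnit h).map P₀
  have hA : A.PosDef := by
    apply Matrix.posDef_sum (Finset.univ_nonempty)
    intro h _
    exact Matrix.PosDef.conjTranspose_mul_self _ (Matrix.mulVec_injective_of_isUnit (hunit h))
  have hAinv : ∀ h, (P₀ h)ᴴ * A * P₀ h = A := by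
    intro h
    simp only [A, Finset.mul_sum, Finset.sum_mul]
    conv_rhs => rw [← Equiv.sum_comp (Equiv.mulRight h)]
    refine Finset.sum_congr rfl fun g _ => ?_
    simp [Matrix.conjTranspose_mul, Matrix.mul_assoc]
  obtain ⟨S, ⟨S, rfl⟩, hS⟩ := exists_isUnit_conjTranspose_mul_eq hA
  let P : H →* Matrix (Fin d) (Fin d) ℂ :=
    { toFun := fun h => S * P₀ h * (S⁻¹ : (Matrix (Fin d) (Fin d) ℂ)ˣ)
      map_one' := by simp
      map_mul' := fun x y => by simp [mul_assoc] }
  let eS : (Fin d → ℂ) ≃ₗ[ℂ] (Fin d → ℂ) :=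
    { Matrix.mulVecLin (S : Matrix (Fin d) (Fin d) ℂ) with
      invFun := fun v => (S⁻¹ : (Matrix (Fin d) (Fin d) ℂ)ˣ).val *ᵥ v
      left_inv := fun v => by simp
      right_inv := fun v => by simp }
  refine ⟨b.equivFun.trans eS, P, fun h v => ?_, fun h => ?_⟩
  · change S.val *ᵥ (b.repr (ρ h v)) = (S.val * P₀ h * (S⁻¹).val) *ᵥ (S.val *ᵥ b.repr v)
    rw [Matrix.mulVec_mulVec, mul_assoc, Units.inv_mul, mul_one, ← Matrix.mulVec_mulVec]
    congr 1
    exact (LinearMap.toMatrix_mulVec_repr b b (ρ h) v).symm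
  · have h1 : (P h)ᴴ * P h = 1 := by
      have h2 : (S⁻¹.val)ᴴ * (S.val)ᴴ = 1 := by
        rw [← Matrix.conjTranspose_mul, Units.mul_inv, Matrix.conjTranspose_one]
      change (S.val * P₀ h * (S⁻¹).val)ᴴ * (S.val * P₀ h * (S⁻¹).val) = 1
      rw [Matrix.conjTranspose_mul, Matrix.conjTranspose_mul]
      calc _ = (S⁻¹.val)ᴴ * ((P₀ h)ᴴ * ((S.val)ᴴ * S.val) * P₀ h) * S⁻¹.val := by
            simp only [mul_assoc]
        _ = (S⁻¹.val)ᴴ * (S.val)ᴴ * (S.val * S⁻¹.val) := by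
            rw [hS, hAinv, ← hS]; simp only [mul_assoc]
        _ = 1 := by rw [h2, Units.mul_inv, mul_one]
    calc P h⁻¹ = (P h)ᴴ * P h * P h⁻¹ := by rw [h1, one_mul]
      _ = (P h)ᴴ := by rw [mul_assoc, ← map_mul, mul_inv_cancel, map_one, mul_one]

/-- A unitary matrix representation whose commutant consists of scalars. -/
structure IsUnitaryIrrep {H : Type*} [Group H] {d : ℕ} (P : H →* Matrix (Fin d) (Fin d) ℂ) :
    Prop where
  pos : 0 < d
  inv : ∀ h, P h⁻¹ = (P h)ᴴ
  schur : ∀ A : Matrix (Fin d) (Fin d) ℂ, (∀ h, P h * A = A * P h) → ∃ c : ℂ, A = c • 1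

theorem exists_isUnitaryIrrep {H V : Type*} [Group H] [Fintype H] [AddCommGroup V] [Module ℂ V]
    [FiniteDimensional ℂ V] (ρ : Representation ℂ H V) (hρ : ρ.IsIrreducible) :
    ∃ (e : V ≃ₗ[ℂ] (Fin (Module.finrank ℂ V) → ℂ))
      (P : H →* Matrix (Fin (Module.finrank ℂ V)) (Fin (Module.finrank ℂ V)) ℂ),
      (∀ h v, e (ρ h v) = P h *ᵥ e v) ∧ IsUnitaryIrrep P ∧ ∀ h, (P h).trace = ρ.character h := by
  obtain ⟨e, P, he, hP⟩ := exists_unitary_form ρ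
  refine ⟨e, P, he, ⟨finrank_pos_of_isIrreducible hρ, hP, fun A hA => ?_⟩, fun h => ?_⟩
  · obtain ⟨c, hc⟩ := exists_scalar ρ hρ (e.symm.toLinearMap ∘ₗ A.mulVecLin ∘ₗ e.toLinearMap) (by
      intro h v
      apply e.injective
      simp [he, hA])
    refine ⟨c, ?_⟩
    apply Matrix.toLin'.injective
    ext1 i
    ext1
    have := congrArg e (LinearMap.congr_fun hc (e.symm (Pi.single i 1)))
    simpa using this
  · have : P h = LinearMap.toMatrix' (e.conj (ρ h)) := by
      apply Matrix.toLin'.injective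
      rw [Matrix.toLin'_toMatrix']
      ext1 i
      ext1
      simp [LinearEquiv.conj_apply_apply, he]
    rw [this, ← Matrix.trace_toLin'_eq, Matrix.toLin'_toMatrix', LinearMap.trace_conj', character]

end

section

open Matrix
open scoped ComplexOrder

/-! ### The twisted Frobenius-Schur indicator -/

section

variable {H : Type*} [Group H] {d : ℕ} {P : H →* Matrix (Fin d) (Fin d) ℂ}

theorem IsUnitaryIrrep.mul_inv (h : H) : P h * P h⁻¹ = 1 := by rw [← map_mul]; simp

theorem IsUnitaryIrrep.inv_mul (h : H) : P h⁻¹ * P h = 1 := by rw [← map_mul]; simp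

theorem IsUnitaryIrrep.map_conj (hP : IsUnitaryIrrep P) (h : H) :
    (P h).map (starRingEnd ℂ) = (P h⁻¹)ᵀ := by
  rw [hP.inv]; ext i j; simp [Matrix.conjTranspose_apply]

theorem IsUnitaryIrrep.natCast_ne_zero (hP : IsUnitaryIrrep P) : (d : ℂ) ≠ 0 := by
  exact_mod_cast hP.pos.ne'

variable [Fintype H]

theorem IsUnitaryIrrep.sum_mul_mul_inv (hP : IsUnitaryIrrep P) (A : Matrix (Fin d) (Fin d) ℂ) :
    ∑ g : H, P g * A * P g⁻¹ = (Nat.card H * A.trace / d : ℂ) • 1 := by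
  obtain ⟨c, hc⟩ := hP.schur (∑ g : H, P g * A * P g⁻¹) (by
    intro h
    rw [Finset.mul_sum, Finset.sum_mul]
    conv_rhs => rw [← Equiv.sum_comp (Equiv.mulLeft h)]
    refine Finset.sum_congr rfl fun g _ => ?_
    simp only [Equiv.coe_mulLeft, _root_.mul_inv_rev, map_mul]
    simp only [mul_assoc, IsUnitaryIrrep.inv_mul, mul_one])
  have ht := congrArg Matrix.trace hc
  rw [Matrix.trace_sum, Matrix.trace_smul, Matrix.trace_one, Finset.sum_congr rfl (fun g _ => by
    rw [Matrix.trace_mul_comm, ← mul_assoc, IsUnitaryIrrep.inv_mul, one_mul])] at ht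
  have h0 := hP.natCast_ne_zero
  simp only [Finset.sum_const, Finset.card_univ, nsmul_eq_mul, Fintype.card_fin, smul_eq_mul] at ht
  rw [hc, Nat.card_eq_fintype_card, ht, mul_div_assoc, div_self h0, mul_one]

/-- Orthogonality of matrix coefficients. -/
theorem IsUnitaryIrrep.sum_coeff (hP : IsUnitaryIrrep P) (i j k l : Fin d) :
    ∑ g : H, P g i j * P g⁻¹ k l =
      if i = l ∧ j = k then (Nat.card H / d : ℂ) else 0 := by
  have h := congrFun (congrFun (hP.sum_mul_mul_inv (Matrix.single j k 1)) i) l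
  rw [Matrix.sum_apply] at h
  simp only [Matrix.smul_apply, Matrix.one_apply, smul_eq_mul] at h
  rw [Finset.sum_congr rfl (fun g _ => (by
    simp [Matrix.mul_apply, Matrix.single_apply, ite_and] :
    P g i j * P g⁻¹ k l = (P g * Matrix.single j k 1 * P g⁻¹ : Matrix (Fin d) (Fin d) ℂ) i l)), h]
  by_cases hjk : j = k
  · subst hjk; simp
  · simp [hjk, Matrix.trace_single_eq_of_ne]

/-- Orthogonality of coefficients, with the inverse transposed so that the indices of `A` are
swapped. This is the averaging that evaluates the indicator. -/
theorem IsUnitaryIrrep.sum_mul_mul_transpose (hP : IsUnitaryIrrep P)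
    (A : Matrix (Fin d) (Fin d) ℂ) :
    ∑ g : H, P g * A * (P g⁻¹)ᵀ = (Nat.card H / d : ℂ) • Aᵀ := by
  ext i l
  rw [Matrix.sum_apply]
  simp only [Matrix.mul_apply, Finset.sum_mul, Matrix.transpose_apply, Matrix.smul_apply,
    smul_eq_mul]
  rw [Finset.sum_comm]
  simp_rw [Finset.sum_comm (s := (Finset.univ : Finset H))]
  have : ∀ x y : Fin d, ∑ g : H, P g i y * A y x * P g⁻¹ l x =
      A y x * if i = x ∧ y = l then (Nat.card H / d : ℂ) else 0 := by
    intro x y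
    rw [← hP.sum_coeff, Finset.mul_sum]
    exact Finset.sum_congr rfl fun g _ => by ring
  simp_rw [this]
  simp [ite_and, mul_comm]

/-- The matrices of antilinear maps that intertwine `P` with its twist by `φ`. -/
def IsTwisting (P : H →* Matrix (Fin d) (Fin d) ℂ) (φ : H ≃* H) (B : Matrix (Fin d) (Fin d) ℂ) :
    Prop :=
  ∀ h, P (φ h) * B = B * (P h⁻¹)ᵀ

theorem isTwisting_sum (φ : H ≃* H) (C : Matrix (Fin d) (Fin d) ℂ) :
    IsTwisting P φ (∑ g : H, P (φ g) * C * (P g)ᵀ) := by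
  intro h
  rw [Finset.mul_sum, Finset.sum_mul]
  conv_rhs => rw [← Equiv.sum_comp (Equiv.mulLeft h)]
  refine Finset.sum_congr rfl fun g _ => ?_
  simp only [Equiv.coe_mulLeft, map_mul, Matrix.transpose_mul]
  have : (P h)ᵀ * (P h⁻¹)ᵀ = 1 := by
    rw [← Matrix.transpose_mul, IsUnitaryIrrep.inv_mul, Matrix.transpose_one]
  simp only [mul_assoc, this, mul_one]

variable (φ : H ≃* H)

/-- The sums are the entries of the twisting matrices obtained by averaging elementary matrices. -/
theorem sum_coeff_eq_zero_of_isTwisting (h0 : ∀ B, IsTwisting P φ B → B = 0) (i j k l : Fin d) :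
    ∑ g : H, P (φ g) i j * P g k l = 0 := by
  have h := congrFun (congrFun (h0 _ (isTwisting_sum φ (Matrix.single j l 1))) i) k
  rw [Matrix.sum_apply] at h
  refine Eq.trans (Finset.sum_congr rfl fun g _ => ?_) h
  simp [Matrix.mul_apply, Matrix.single_apply, ite_and]

omit [Fintype H] in
-- `B Bᴴ` commutes with `P`, so it is a scalar. The scalar is the squared norm of a row of `B`,
-- hence positive, and dividing `B` by its root gives a unitary matrix.
theorem exists_unitary_isTwisting (hP : IsUnitaryIrrep P) {B : Matrix (Fin d) (Fin d) ℂ}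
    (hB : IsTwisting P φ B) (hB0 : B ≠ 0) :
    ∃ B', IsTwisting P φ B' ∧ B' * B'ᴴ = 1 := by
  obtain ⟨c, hc⟩ := hP.schur (B * Bᴴ) (by
    intro h
    obtain ⟨h, rfl⟩ := φ.surjective h
    have h1 : Bᴴ * P (φ h) = (P h⁻¹)ᵀ * Bᴴ := by
      have := congrArg Matrix.conjTranspose (hB h⁻¹)
      rw [Matrix.conjTranspose_mul, Matrix.conjTranspose_mul, map_inv, ← hP.inv, inv_inv,
        inv_inv] at this
      rw [this]
      congr 1
      ext i j
      simp [hP.inv, Matrix.conjTranspose_apply]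
    rw [← mul_assoc, hB h, mul_assoc, mul_assoc, h1])
  have hc' : c = ((∑ j, Complex.normSq (B ⟨0, hP.pos⟩ j) : ℝ) : ℂ) := by
    have := congrFun (congrFun hc ⟨0, hP.pos⟩) ⟨0, hP.pos⟩
    simp only [Matrix.mul_apply, Matrix.conjTranspose_apply, Matrix.smul_apply,
      Matrix.one_apply_eq, smul_eq_mul, mul_one] at this
    rw [← this]
    push_cast
    exact Finset.sum_congr rfl fun j _ => Complex.mul_conj _
  set r := ∑ j, Complex.normSq (B ⟨0, hP.pos⟩ j)
  have hr0 : 0 ≤ r := Finset.sum_nonneg fun j _ => Complex.normSq_nonneg _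
  have hr : 0 < r := by
    refine lt_of_le_of_ne hr0 fun h => hB0 ?_
    rw [← h] at hc'
    rw [hc', Complex.ofReal_zero, zero_smul] at hc
    exact Matrix.self_mul_conjTranspose_eq_zero.1 hc
  refine ⟨((Real.sqrt r)⁻¹ : ℂ) • B, fun h => by
    rw [Matrix.mul_smul, hB h, Matrix.smul_mul], ?_⟩
  rw [Matrix.conjTranspose_smul, Matrix.smul_mul, Matrix.mul_smul, hc, hc', smul_smul, smul_smul]
  have : ((Real.sqrt r : ℝ) : ℂ) * (Real.sqrt r : ℝ) = r := by
    rw [← Complex.ofReal_mul, Real.mul_self_sqrt hr0]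
  have hs : ((Real.sqrt r : ℝ) : ℂ) ≠ 0 := by
    exact_mod_cast (Real.sqrt_pos.2 hr).ne'
  convert one_smul ℂ _ using 2
  rw [← this]
  simp only [star_inv₀, Complex.star_def, Complex.conj_ofReal]
  field_simp

/-- `B` times its entrywise conjugate is the matrix of the square of an antilinear map. It
intertwines `P` with `P ∘ φ²`, which is `P` conjugated by `P s`, so it is a multiple `ε P s`.
Associativity makes `ε` real and unitarity gives `ε² = 1`. -/
theorem exists_sign_of_unitary_isTwisting (hP : IsUnitaryIrrep P) {s : H}
    (hφ : ∀ h, φ (φ h) = s * h * s⁻¹) (hs : φ s = s) {B : Matrix (Fin d) (Fin d) ℂ}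
    (hB : IsTwisting P φ B) (hB1 : B * Bᴴ = 1) :
    ∃ ε : ℂ, (ε = 1 ∨ ε = -1) ∧ B * B.map (starRingEnd ℂ) = ε • P s ∧
      (Nat.card H : ℂ)⁻¹ * ∑ g : H, (P (g * φ g * s)).trace = ε := by
  have hBc : ∀ h, (P (φ h⁻¹))ᵀ * B.map (starRingEnd ℂ) = B.map (starRingEnd ℂ) * P h := by
    intro h
    have := congrArg (fun M => Matrix.map M (starRingEnd ℂ)) (hB h)
    simp only [Matrix.map_mul] at this
    rw [hP.map_conj, ← map_inv, show (P h⁻¹)ᵀ.map (starRingEnd ℂ) = P h by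
      rw [Matrix.transpose_map, hP.map_conj, inv_inv, Matrix.transpose_transpose]] at this
    exact this
  have hB2 : Bᴴ * B = 1 := mul_eq_one_comm.1 hB1
  have hmul : (P s).map (starRingEnd ℂ) * (P s⁻¹).map (starRingEnd ℂ) = 1 := by
    rw [← Matrix.map_mul, IsUnitaryIrrep.mul_inv]; simp
  have hconj1 : B.map (starRingEnd ℂ) * (B.map (starRingEnd ℂ))ᴴ = 1 := by
    have := congrArg (fun M => Matrix.map M (starRingEnd ℂ)) hB1
    simp only [Matrix.map_mul] at this
    rw [show (1 : Matrix (Fin d) (Fin d) ℂ).map (starRingEnd ℂ) = 1 by simp] at this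
    rw [← this]
    congr 1
  obtain ⟨ε, hε⟩ := hP.schur (P s⁻¹ * (B * B.map (starRingEnd ℂ))) (by
    intro h
    have h1 : P (s * h * s⁻¹) * (B * B.map (starRingEnd ℂ)) =
        B * B.map (starRingEnd ℂ) * P h := by
      rw [← hφ, ← mul_assoc, hB, mul_assoc, ← map_inv, hBc, mul_assoc]
    rw [← mul_assoc (P h), ← map_mul, mul_assoc (P s⁻¹), ← h1, ← mul_assoc (P s⁻¹), ← map_mul]
    congr 2
    group)
  have hBB : B * B.map (starRingEnd ℂ) = ε • P s := by
    calc B * B.map (starRingEnd ℂ) = P s * (P s⁻¹ * (B * B.map (starRingEnd ℂ))) := by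
          rw [← mul_assoc, IsUnitaryIrrep.mul_inv, one_mul]
      _ = ε • P s := by rw [hε, Matrix.mul_smul, mul_one]
  have hBB' : B.map (starRingEnd ℂ) * B = conj ε • (P s).map (starRingEnd ℂ) := by
    have := congrArg (fun M => Matrix.map M (starRingEnd ℂ)) hBB
    simp only [Matrix.map_mul] at this
    rw [show (B.map (starRingEnd ℂ)).map (starRingEnd ℂ) = B by ext; simp] at this
    rw [this]
    ext; simp
  have h1 : (1 : Matrix (Fin d) (Fin d) ℂ) ≠ 0 := by
    intro h
    have := congrFun (congrFun h ⟨0, hP.pos⟩) ⟨0, hP.pos⟩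
    simp at this
  -- The product `B B̄ B` is evaluated in two ways, once with `B B̄ = ε P s` and once with the
  -- conjugate equation; `φ s = s` makes the two comparable.
  have hreal : ε = conj ε := by
    have e1 : B * B.map (starRingEnd ℂ) * B = ε • (B * (P s).map (starRingEnd ℂ)) := by
      rw [hBB, Matrix.smul_mul, hP.map_conj, ← hB, hs]
    rw [mul_assoc, hBB', Matrix.mul_smul] at e1
    have e2 := congrArg (fun M => Bᴴ * M * (P s⁻¹).map (starRingEnd ℂ)) e1
    simp only [Matrix.mul_smul, Matrix.smul_mul] at e2
    rw [← mul_assoc Bᴴ, hB2, one_mul, hmul] at e2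
    have := sub_eq_zero.2 e2
    rw [← sub_smul, smul_eq_zero] at this
    exact (sub_eq_zero.1 (this.resolve_right h1)).symm
  have hsq : ε * ε = 1 := by
    have e1 : (B * B.map (starRingEnd ℂ)) * (B * B.map (starRingEnd ℂ))ᴴ = 1 := by
      rw [Matrix.conjTranspose_mul, mul_assoc, ← mul_assoc (B.map _), hconj1, one_mul, hB1]
    rw [hBB, Matrix.conjTranspose_smul, Matrix.smul_mul, Matrix.mul_smul, ← hP.inv,
      IsUnitaryIrrep.mul_inv, smul_smul, Complex.star_def, ← hreal] at e1
    have : (ε * ε - 1) • (1 : Matrix (Fin d) (Fin d) ℂ) = 0 := by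
      rw [sub_smul, e1, one_smul, sub_self]
    exact sub_eq_zero.1 ((smul_eq_zero.1 this).resolve_right h1)
  refine ⟨ε, mul_self_eq_one_iff.1 hsq, hBB, ?_⟩
  have hPs : P s = ε • (B * B.map (starRingEnd ℂ)) := by
    rw [hBB, smul_smul, hsq, one_smul]
  have hφg : ∀ g, P (φ g) = B * (P g⁻¹)ᵀ * Bᴴ := by
    intro g; rw [← hB g, mul_assoc, hB1, mul_one]
  -- Substituting `P (φ g) = B P(g⁻¹)ᵀ Bᴴ` and `P s = ε B B̄` brings the summand into the form to
  -- which `sum_mul_mul_transpose` applies; what is left is `tr (Bᵀ B̄) = d`.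
  have hterm : ∀ g, (P (g * φ g * s)).trace =
      ε * (P g * B * (P g⁻¹)ᵀ * B.map (starRingEnd ℂ)).trace := by
    intro g
    rw [map_mul, map_mul, hPs, hφg, Matrix.mul_smul, Matrix.trace_smul, smul_eq_mul]
    congr 2
    calc _ = P g * B * (P g⁻¹)ᵀ * (Bᴴ * B) * B.map (starRingEnd ℂ) := by simp only [mul_assoc]
      _ = _ := by rw [hB2, mul_one]
  have hBt : (Bᵀ * B.map (starRingEnd ℂ)).trace = d := by
    rw [Matrix.trace_mul_comm]
    have : B.map (starRingEnd ℂ) * Bᵀ = (B * Bᴴ)ᵀ := by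
      rw [Matrix.transpose_mul]; congr 1
    rw [this, hB1, Matrix.transpose_one, Matrix.trace_one, Fintype.card_fin]
  rw [Finset.sum_congr rfl fun g _ => hterm g, ← Finset.mul_sum, ← Matrix.trace_sum,
    ← Finset.sum_mul, hP.sum_mul_mul_transpose, Matrix.smul_mul, Matrix.trace_smul, hBt,
    smul_eq_mul]
  have h0 := hP.natCast_ne_zero
  have hc := natCard_ne_zero H
  field_simp

end

end

/-! ### The twisted indicator of an irreducible representation, in terms of antilinear maps -/

section

open Matrix

theorem irrChars_inv {H : Type u} [Group H] [Fintype H] {χ : H → ℂ} (hχ : χ ∈ irrChars H) (h : H) :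
    χ h⁻¹ = conj (χ h) := by
  obtain ⟨V, _, _, _, ρ, hρ, rfl⟩ := hχ
  obtain ⟨e, P, -, hP, htr⟩ := exists_isUnitaryIrrep ρ hρ
  rw [← htr, ← htr, hP.inv, Matrix.trace_conjTranspose, Complex.star_def]

/-- The average of `χ (g φ(g) s)`; for `φ = id` and `s = 1` it is the Frobenius-Schur indicator. -/
def twistedIndicator {H : Type*} [Group H] [Fintype H] (φ : H ≃* H) (s : H) (χ : H → ℂ) : ℂ :=
  (Nat.card H : ℂ)⁻¹ * ∑ g : H, χ (g * φ g * s)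

/-- The antilinear maps that intertwine `ρ` with its twist by `φ`. -/
def IsAntiIntertwining {H V : Type*} [Group H] [AddCommGroup V] [Module ℂ V]
    (ρ : Representation ℂ H V) (φ : H ≃* H) (J : V →ₛₗ[starRingEnd ℂ] V) : Prop :=
  ∀ h v, J (ρ h v) = ρ (φ h) (J v)

/-- The Frobenius-Schur trichotomy. -/
theorem twistedIndicator_trichotomy {H V : Type*} [Group H] [Fintype H] [AddCommGroup V]
    [Module ℂ V] [FiniteDimensional ℂ V] (ρ : Representation ℂ H V) (hρ : ρ.IsIrreducible)
    (φ : H ≃* H) {s : H} (hφ : ∀ h, φ (φ h) = s * h * s⁻¹) (hs : φ s = s) :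
    (∃ ε : ℂ, (ε = 1 ∨ ε = -1) ∧ twistedIndicator φ s ρ.character = ε ∧
      (∀ h, ρ.character (φ h) = conj (ρ.character h)) ∧
      ∃ J : V →ₛₗ[starRingEnd ℂ] V, IsAntiIntertwining ρ φ J ∧ ∀ v, J (J v) = ε • ρ s v) ∨
    (twistedIndicator φ s ρ.character = 0 ∧ (¬ ∀ h, ρ.character (φ h) = conj (ρ.character h)) ∧
      ∀ J : V →ₛₗ[starRingEnd ℂ] V, IsAntiIntertwining ρ φ J → J = 0) := by
  obtain ⟨e, P, he, hP, htr⟩ := exists_isUnitaryIrrep ρ hρ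
  have hconj : ∀ h, conj (ρ.character h) = (P h⁻¹).trace := by
    intro h
    rw [hP.inv, Matrix.trace_conjTranspose, Complex.star_def, htr]
  by_cases hB : ∃ B, IsTwisting P φ B ∧ B ≠ 0
  · left
    obtain ⟨B₀, hB₀, hB₀0⟩ := hB
    obtain ⟨B, hB, hB1⟩ := exists_unitary_isTwisting φ hP hB₀ hB₀0
    obtain ⟨ε, hε, hBB, hF⟩ := exists_sign_of_unitary_isTwisting φ hP hφ hs hB hB1
    refine ⟨ε, hε, ?_, fun h => ?_, ?_⟩
    · rw [← hF, twistedIndicator]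
      simp only [htr]
    · rw [hconj, ← htr]
      have : P (φ h) = B * (P h⁻¹)ᵀ * Bᴴ := by rw [← hB h, mul_assoc, hB1, mul_one]
      rw [this, Matrix.trace_mul_comm, ← mul_assoc, mul_eq_one_comm.1 hB1, one_mul,
        Matrix.trace_transpose]
    · let C : (Fin (Module.finrank ℂ V) → ℂ) →ₛₗ[starRingEnd ℂ] (Fin (Module.finrank ℂ V) → ℂ) :=
        { toFun := fun v i => conj (v i)
          map_add' := fun a b => by ext; simp
          map_smul' := fun c a => by ext; simp }
      have hC : ∀ (M : Matrix _ _ ℂ) v, C (M *ᵥ v) = M.map (starRingEnd ℂ) *ᵥ C v := by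
        intro M v
        ext i
        simp [C, Matrix.mulVec, dotProduct]
      have hCC : ∀ v, C (C v) = v := fun v => by ext; simp [C]
      -- In coordinates `J` is entrywise conjugation followed by `B`.
      refine ⟨(e.symm.toLinearMap ∘ₗ B.mulVecLin).comp (C.comp e.toLinearMap), fun h v => ?_,
        fun v => ?_⟩
      · apply e.injective
        simp [he, hC, hP.map_conj, hB h]
      · apply e.injective
        simp [he, hC, hCC, hBB, Matrix.smul_mulVec]
  · right
    push Not at hB
    refine ⟨?_, fun hχ => ?_, fun J hJ => ?_⟩
    · rw [twistedIndicator]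
      have : ∀ g, ρ.character (g * φ g * s) =
          ∑ i, ∑ k, ∑ j, P s k i * (P (φ g) j k * P g i j) := by
        intro g
        rw [← htr, map_mul, map_mul, Matrix.trace]
        simp only [Matrix.diag, Matrix.mul_apply, Finset.sum_mul]
        refine Finset.sum_congr rfl fun i _ => Finset.sum_congr rfl fun k _ =>
          Finset.sum_congr rfl fun j _ => by ring
      simp only [this]
      rw [Finset.sum_comm, Finset.sum_eq_zero, mul_zero]
      intro i _
      rw [Finset.sum_comm, Finset.sum_eq_zero]
      intro k _
      rw [Finset.sum_comm, Finset.sum_eq_zero]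
      intro j _
      rw [← Finset.mul_sum, sum_coeff_eq_zero_of_isTwisting φ hB, mul_zero]
    -- If `χ ∘ φ` were the conjugate of `χ`, the vanishing coefficient sums would give `∑ |χ(g)|² =
    -- 0`, against `χ(1) ≠ 0`.
    · have h1 : ∑ g, ρ.character (φ g) * ρ.character g = 0 := by
        simp only [← htr, Matrix.trace, Matrix.diag, Finset.sum_mul_sum]
        rw [Finset.sum_comm, Finset.sum_eq_zero]
        intro i _
        rw [Finset.sum_comm, Finset.sum_eq_zero]
        intro k _
        exact sum_coeff_eq_zero_of_isTwisting φ hB _ _ _ _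
      have h2 : ∑ g, ρ.character (φ g) * ρ.character g =
          ((∑ g, Complex.normSq (ρ.character g) : ℝ) : ℂ) := by
        push_cast
        exact Finset.sum_congr rfl fun g _ => by rw [hχ, Complex.normSq_eq_conj_mul_self]
      rw [h2] at h1
      have h3 := (Finset.sum_eq_zero_iff_of_nonneg fun g _ => Complex.normSq_nonneg _).1
        (Complex.ofReal_eq_zero.1 h1) 1 (Finset.mem_univ _)
      rw [Complex.normSq_eq_zero, char_one] at h3
      exact hP.natCast_ne_zero h3
    · let B : Matrix (Fin (Module.finrank ℂ V)) (Fin (Module.finrank ℂ V)) ℂ :=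
        Matrix.of fun i j => e (J (e.symm (Pi.single j 1))) i
      have hJB : ∀ v, e (J v) = B *ᵥ fun i => conj (e v i) := by
        intro v
        obtain ⟨w, rfl⟩ := e.symm.surjective v
        have : w = ∑ i, w i • Pi.single i (1 : ℂ) := by
          ext j; simp [Finset.sum_apply, Pi.single_apply]
        conv_lhs => rw [this]
        ext i
        simp [Matrix.mulVec, dotProduct, B, Finset.sum_apply, mul_comm]
      have hBt : IsTwisting P φ B := by
        intro h
        have key : ∀ v : Fin (Module.finrank ℂ V) → ℂ,
            (P (φ h) * B) *ᵥ (fun i => conj (v i)) = (B * (P h⁻¹)ᵀ) *ᵥ (fun i => conj (v i)) := by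
          intro v
          have h1 := congrArg e (hJ h (e.symm v))
          rw [he, hJB, hJB, he] at h1
          simp only [LinearEquiv.apply_symm_apply] at h1
          rw [← Matrix.mulVec_mulVec, ← Matrix.mulVec_mulVec, ← h1, ← hP.map_conj]
          congr 1
          ext i
          simp [Matrix.mulVec, dotProduct]
        ext i j
        have := congrFun (key (Pi.single j 1)) i
        have hs : (fun i => conj ((Pi.single j 1 : Fin (Module.finrank ℂ V) → ℂ) i)) =
            Pi.single j 1 := by
          ext k; by_cases hk : k = j <;> simp [hk]
        rw [hs] at this
        simpa using this
      have hB0 := hB B hBt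
      ext v
      apply e.injective
      rw [hJB, hB0]
      simp

end

/-! ### Recognizing `ℝ`, `ℂ` and `ℍ` -/

section

variable (E : Type*) [Semiring E] [Algebra ℝ E] [Nontrivial E]

theorem nonempty_algEquiv_real (h : ∀ T : E, ∃ a : ℝ, T = a • 1) : Nonempty (E ≃ₐ[ℝ] ℝ) := by
  refine ⟨(AlgEquiv.ofBijective (Algebra.ofId ℝ E) ⟨(algebraMap ℝ E).injective, fun T => ?_⟩).symm⟩
  obtain ⟨a, rfl⟩ := h T
  exact ⟨a, by rw [Algebra.ofId_apply, Algebra.algebraMap_eq_smul_one]⟩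

variable {E}

/-- Only spanning has to be checked: a homomorphism from a division ring to a nontrivial ring is
injective. The same holds for the quaternions below. -/
theorem nonempty_algEquiv_complex (I : E) (hI : I * I = (-1 : ℝ) • 1)
    (h : ∀ T : E, ∃ a b : ℝ, T = a • 1 + b • I) : Nonempty (E ≃ₐ[ℝ] ℂ) := by
  let _ : Ring E := Algebra.semiringToRing ℝ
  rw [neg_one_smul] at hI
  refine ⟨(AlgEquiv.ofBijective (Complex.lift ⟨I, hI⟩)
    ⟨RingHom.injective (Complex.lift ⟨I, hI⟩ : ℂ →ₐ[ℝ] E).toRingHom, fun T => ?_⟩).symm⟩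
  obtain ⟨a, b, rfl⟩ := h T
  exact ⟨⟨a, b⟩, by simp [Complex.liftAux_apply, Algebra.algebraMap_eq_smul_one]⟩

theorem nonempty_algEquiv_quaternion (I J : E) (hI : I * I = (-1 : ℝ) • 1)
    (hJ : J * J = (-1 : ℝ) • 1) (hIJ : J * I = (-1 : ℝ) • (I * J))
    (h : ∀ T : E, ∃ a b c d : ℝ, T = a • 1 + b • I + c • J + d • (I * J)) :
    Nonempty (E ≃ₐ[ℝ] ℍ[ℝ]) := by
  let _ : Ring E := Algebra.semiringToRing ℝ
  let q : QuaternionAlgebra.Basis E (-1 : ℝ) 0 (-1) :=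
    { i := I, j := J, k := I * J, i_mul_i := by simp [hI], j_mul_j := by simp [hJ]
      i_mul_j := rfl, j_mul_i := by simp [hIJ] }
  let F : ℍ[ℝ] →ₐ[ℝ] E := q.liftHom
  refine ⟨(AlgEquiv.ofBijective F ⟨RingHom.injective F.toRingHom, fun T => ?_⟩).symm⟩
  obtain ⟨a, b, c, d, rfl⟩ := h T
  refine ⟨⟨a, b, c, d⟩, ?_⟩
  change q.lift _ = _
  simp [q, QuaternionAlgebra.Basis.lift, Algebra.algebraMap_eq_smul_one]

end

/-! ### Real linear maps between complex vector spaces -/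

section

variable {V W : Type*} [AddCommGroup V] [Module ℂ V] [AddCommGroup W] [Module ℂ W]

/-- A real linear map that commutes with `I` as a complex linear map. -/
def complexLinear (T : V →ₗ[ℝ] W) (hT : ∀ v, T (Complex.I • v) = Complex.I • T v) : V →ₗ[ℂ] W where
  toFun := T
  map_add' := map_add T
  map_smul' c v := by
    have : c • v = c.re • v + c.im • (Complex.I • v) := by
      conv_lhs => rw [← Complex.re_add_im c]
      rw [add_smul, mul_smul]; rfl
    rw [this, map_add, map_smul, map_smul, hT]
    conv_rhs => rw [← Complex.re_add_im c]
    rw [RingHom.id_apply, add_smul, mul_smul]; rfl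

/-- A real linear map that anticommutes with `I` as an antilinear map. -/
def antilinear (T : V →ₗ[ℝ] W) (hT : ∀ v, T (Complex.I • v) = -(Complex.I • T v)) :
    V →ₛₗ[starRingEnd ℂ] W where
  toFun := T
  map_add' := map_add T
  map_smul' c v := by
    have : c • v = c.re • v + c.im • (Complex.I • v) := by
      conv_lhs => rw [← Complex.re_add_im c]
      rw [add_smul, mul_smul]; rfl
    rw [this, map_add, map_smul, map_smul, hT]
    have : conj c = c.re - c.im * Complex.I := by
      apply Complex.ext <;> simp
    rw [this, sub_smul, mul_smul, smul_neg, ← sub_eq_add_neg]; rfl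

/-- An antilinear map as a real linear map. -/
def antilinearReal (J : V →ₛₗ[starRingEnd ℂ] W) : V →ₗ[ℝ] W where
  toFun := J
  map_add' := map_add J
  map_smul' c v := by
    change J ((c : ℂ) • v) = (c : ℂ) • J v
    rw [map_smulₛₗ, Complex.conj_ofReal]

theorem I_smul_I_smul (v : V) : Complex.I • Complex.I • v = -v := by
  rw [smul_smul, Complex.I_mul_I, neg_one_smul]

theorem exists_eq_complexLinear_add_antilinear (T : V →ₗ[ℝ] V) :
    ∃ (L : V →ₗ[ℂ] V) (A : V →ₛₗ[starRingEnd ℂ] V), (∀ v, T v = L v + A v) ∧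
      (∀ v, L v = (2⁻¹ : ℝ) • (T v - Complex.I • T (Complex.I • v))) ∧
      ∀ v, A v = (2⁻¹ : ℝ) • (T v + Complex.I • T (Complex.I • v)) := by
  let R : V →ₗ[ℝ] V := (LinearMap.lsmul ℂ V Complex.I).restrictScalars ℝ
  have hR : ∀ v, R v = Complex.I • v := fun v => rfl
  refine ⟨complexLinear ((2⁻¹ : ℝ) • (T - R ∘ₗ T ∘ₗ R)) ?_,
    antilinear ((2⁻¹ : ℝ) • (T + R ∘ₗ T ∘ₗ R)) ?_, fun v => ?_, fun v => rfl, fun v => rfl⟩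
  · intro v
    simp only [LinearMap.smul_apply, LinearMap.sub_apply, LinearMap.comp_apply, hR, I_smul_I_smul,
      map_neg, smul_comm Complex.I (2⁻¹ : ℝ), smul_sub, smul_neg]
    abel
  · intro v
    simp only [LinearMap.smul_apply, LinearMap.add_apply, LinearMap.comp_apply, hR, I_smul_I_smul,
      map_neg, smul_comm Complex.I (2⁻¹ : ℝ), smul_add, smul_neg]
    abel
  · change T v = (2⁻¹ : ℝ) • (T v - Complex.I • T (Complex.I • v)) +
      (2⁻¹ : ℝ) • (T v + Complex.I • T (Complex.I • v))
    rw [← smul_add]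
    have : T v - Complex.I • T (Complex.I • v) + (T v + Complex.I • T (Complex.I • v)) =
        (2 : ℝ) • T v := by rw [two_smul]; abel
    rw [this, smul_smul]; norm_num

end

/-! ### Antilinear intertwining maps: uniqueness up to scalars, invariance of the sign -/

section

variable {H V : Type*} [Group H] [AddCommGroup V] [Module ℂ V]
  [FiniteDimensional ℂ V] {ρ : Representation ℂ H V} {φ : H ≃* H} {s : H}
  {J J' : V →ₛₗ[starRingEnd ℂ] V}

omit [FiniteDimensional ℂ V] in
theorem rho_inv_apply (h : H) (v : V) : ρ h⁻¹ (ρ h v) = v := by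
  rw [← Module.End.mul_apply, ← map_mul]; simp

omit [FiniteDimensional ℂ V] in
theorem rho_apply_inv (h : H) (v : V) : ρ h (ρ h⁻¹ v) = v := by
  rw [← Module.End.mul_apply, ← map_mul]; simp

/-- The composite `ρ(s⁻¹) J J'` is complex linear and commutes with `ρ`, so it is a scalar; applying
`J` once more recovers `J'`. -/
theorem exists_eq_smul_of_isAntiIntertwining (hρ : ρ.IsIrreducible)
    (hφ : ∀ h, φ (φ h) = s * h * s⁻¹) (hs : φ s = s)
    (hJ : IsAntiIntertwining ρ φ J) (hJ' : IsAntiIntertwining ρ φ J') {ε : ℂ}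
    (hε : ε ≠ 0) (hJJ : ∀ v, J (J v) = ε • ρ s v) : ∃ c : ℂ, ∀ v, J' v = c • J v := by
  obtain ⟨c, hc⟩ := exists_scalar ρ hρ (ρ s⁻¹ ∘ₗ (J.comp J')) (by
    intro h v
    simp only [LinearMap.comp_apply]
    rw [hJ', hJ, hφ, ← Module.End.mul_apply, ← Module.End.mul_apply, ← map_mul, ← map_mul]
    congr 2
    group)
  refine ⟨ε⁻¹ * conj c, fun v => ?_⟩
  have h1 : J (J' v) = c • ρ s v := by
    have := congrArg (ρ s) (LinearMap.congr_fun hc v)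
    simpa [rho_apply_inv] using this
  have h2 := congrArg J h1
  rw [hJJ, map_smulₛₗ, hJ, hs] at h2
  have h3 := congrArg (ρ s⁻¹) h2
  rw [map_smul, map_smul, rho_inv_apply, rho_inv_apply] at h3
  rw [mul_smul, ← h3, smul_smul, inv_mul_cancel₀ hε, one_smul]

/-- Replacing `J` by `c J` multiplies its square by `|c|²`, which is never negative. -/
theorem not_isAntiIntertwining_of_sign (hρ : ρ.IsIrreducible)
    (hφ : ∀ h, φ (φ h) = s * h * s⁻¹) (hs : φ s = s)
    (hJ : IsAntiIntertwining ρ φ J) (hJJ : ∀ v, J (J v) = ρ s v)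
    (hJ' : IsAntiIntertwining ρ φ J') (hJJ' : ∀ v, J' (J' v) = -ρ s v) : False := by
  obtain ⟨c, hc⟩ := exists_eq_smul_of_isAntiIntertwining hρ hφ hs hJ hJ' one_ne_zero
    (by simpa using hJJ)
  have := ((isIrreducible_iff ρ).1 hρ).1
  obtain ⟨v, hv⟩ := exists_ne (0 : V)
  have h1 := hJJ' v
  rw [hc, hc, map_smulₛₗ, hJJ, smul_smul, Complex.mul_conj, ← neg_one_smul ℂ (ρ s v)] at h1
  have hv' : ρ s v ≠ 0 := fun h => hv (by rw [← rho_inv_apply (ρ := ρ) s v, h, map_zero])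
  have h2 := smul_left_injective ℂ hv' h1
  have h3 : (Complex.normSq c : ℝ) = -1 := by exact_mod_cast h2
  linarith [Complex.normSq_nonneg c]

end

/-! ### The simple real constituents of a complex irreducible representation -/

section

variable {H V U : Type*} [Group H] [AddCommGroup V] [Module ℂ V] [FiniteDimensional ℂ V]
  [AddCommGroup U] [Module ℝ U] {ρ : Representation ℂ H V} {σ : Representation ℝ H U}

theorem intertwiningMap_nontrivial (hσ : σ.IsIrreducible) : Nontrivial (IntertwiningMap σ σ) := by
  have := ((isIrreducible_iff σ).1 hσ).1
  obtain ⟨u, hu⟩ := exists_ne (0 : U)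
  refine ⟨1, 0, fun h => hu ?_⟩
  have := congrArg (fun T : IntertwiningMap σ σ => T u) h
  simpa using this

variable (hρ : ρ.IsIrreducible) (hσ : σ.IsIrreducible) (f : U →ₗ[ℝ] V)
  (hf : ∀ h u, f (σ h u) = ρ h (f u))

omit [FiniteDimensional ℂ V] in
include hσ hf in
theorem injective_of_real_equivariant (hf0 : f ≠ 0) : Function.Injective f := by
  rw [← LinearMap.ker_eq_bot]
  refine (((isIrreducible_iff σ).1 hσ).2 (LinearMap.ker f) fun h w hw => ?_).resolve_right
    fun h => hf0 (LinearMap.ker_eq_top.1 h)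
  rw [LinearMap.mem_ker] at hw ⊢
  rw [hf, hw, map_zero]

omit [FiniteDimensional ℂ V] in
include hρ hσ hf in
/-- The image of `U` in `V` is either a real form of `V`, or everything. -/
theorem real_form_or_surjective (hf0 : f ≠ 0) :
    Function.Surjective f ∨
      Function.Bijective (fun p : U × U => f p.1 + Complex.I • f p.2) := by
  have hinj := injective_of_real_equivariant hσ f hf hf0
  have hn := ((isIrreducible_iff σ).1 hσ).1
  obtain ⟨u₀, hu₀⟩ := exists_ne (0 : U)
  have hfu₀ : f u₀ ≠ 0 := fun h => hu₀ (hinj (by rw [h, map_zero]))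
  -- `K` consists of the `u` with `i f(u)` in the image of `f`. It is invariant, hence zero or
  -- everything. If it is zero, the image meets its multiple by `i` trivially and the two span `V`;
  -- if it is everything, the image is a complex subspace and equals `V`.
  let K : Submodule ℝ U := (LinearMap.range f).comap
    ((LinearMap.lsmul ℂ V Complex.I).restrictScalars ℝ ∘ₗ f)
  have hKmem : ∀ u, u ∈ K ↔ ∃ w, f w = Complex.I • f u := fun u => Iff.rfl
  have hsub : ∀ W : Submodule ℂ V, (∀ h, ∀ w ∈ W, ρ h w ∈ W) → f u₀ ∈ W → W = ⊤ := by
    intro W hW h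
    refine (((isIrreducible_iff ρ).1 hρ).2 W hW).resolve_left fun hb => hfu₀ ?_
    rwa [hb, Submodule.mem_bot] at h
  rcases ((isIrreducible_iff σ).1 hσ).2 K (fun h w hw => by
      rw [hKmem] at hw ⊢
      obtain ⟨x, hx⟩ := hw
      exact ⟨σ h x, by rw [hf, hx, map_smul, hf]⟩) with hK | hK
  · right
    constructor
    · intro p q hpq
      have hab : f (p.1 - q.1) + Complex.I • f (p.2 - q.2) = 0 := by
        have h := sub_eq_zero.2 hpq
        simp only at h
        rw [← h, map_sub, map_sub, smul_sub]; abel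
      have hb : p.2 - q.2 ∈ K := by
        rw [hKmem]
        exact ⟨-(p.1 - q.1), by rw [map_neg]; exact (eq_neg_of_add_eq_zero_right hab).symm⟩
      rw [hK, Submodule.mem_bot] at hb
      rw [hb, map_zero, smul_zero, add_zero] at hab
      exact Prod.ext (sub_eq_zero.1 (hinj (hab.trans (map_zero f).symm))) (sub_eq_zero.1 hb)
    · let W : Submodule ℂ V :=
        { carrier := Set.range fun p : U × U => f p.1 + Complex.I • f p.2
          add_mem' := by
            rintro _ _ ⟨p, rfl⟩ ⟨q, rfl⟩
            exact ⟨p + q, by simp; abel⟩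
          zero_mem' := ⟨0, by simp⟩
          smul_mem' := by
            rintro c _ ⟨p, rfl⟩
            refine ⟨(c.re • p.1 - c.im • p.2, c.re • p.2 + c.im • p.1), ?_⟩
            have h1 : ∀ (r : ℝ) (v : V), r • v = (r : ℂ) • v := fun _ _ => rfl
            simp only [map_add, map_sub, map_smul, h1]
            have : c • (f p.1 + Complex.I • f p.2) =
                ((c.re : ℂ) + c.im * Complex.I) • (f p.1 + Complex.I • f p.2) := by
              rw [Complex.re_add_im]
            rw [this]
            have h2 := I_smul_I_smul (f p.2)
            simp only [add_smul, smul_add, mul_smul, h2, smul_neg, smul_comm Complex.I (_ : ℂ)]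
            abel }
      have hW := hsub W (by
        rintro h _ ⟨p, rfl⟩
        exact ⟨(σ h p.1, σ h p.2), by simp [hf]⟩) ⟨(u₀, 0), by simp⟩
      intro v
      have : v ∈ W := hW ▸ Submodule.mem_top
      exact this
  · left
    let W : Submodule ℂ V :=
      { carrier := Set.range f
        add_mem' := by
          rintro _ _ ⟨p, rfl⟩ ⟨q, rfl⟩
          exact ⟨p + q, map_add _ _ _⟩
        zero_mem' := ⟨0, map_zero f⟩
        smul_mem' := by
          rintro c _ ⟨p, rfl⟩
          obtain ⟨w, hw⟩ : p ∈ K := hK ▸ Submodule.mem_top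
          refine ⟨c.re • p + c.im • w, ?_⟩
          rw [map_add, map_smul, map_smul, hw]
          conv_rhs => rw [← Complex.re_add_im c]
          rw [add_smul, mul_smul]; rfl }
    have hW := hsub W (by
      rintro h _ ⟨p, rfl⟩
      exact ⟨σ h p, hf h p⟩) ⟨u₀, rfl⟩
    intro v
    have : v ∈ W := hW ▸ Submodule.mem_top
    exact this

include hρ hσ hf in
-- An endomorphism of `U` extends complex linearly to `V = U ⊕ iU`, where it is a scalar; preserving
-- `U` makes the scalar real. `J` is the conjugation that fixes `U`.
theorem end_real_of_real_form
    (hb : Function.Bijective (fun p : U × U => f p.1 + Complex.I • f p.2)) :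
    Nonempty (IntertwiningMap σ σ ≃ₐ[ℝ] ℝ) ∧
      ∃ J : V →ₛₗ[starRingEnd ℂ] V, IsAntiIntertwining ρ (MulEquiv.refl H) J ∧ ∀ v, J (J v) = v := by
  have hn := ((isIrreducible_iff σ).1 hσ).1
  have := intertwiningMap_nontrivial hσ
  let I' : V →ₗ[ℝ] V := (LinearMap.lsmul ℂ V Complex.I).restrictScalars ℝ
  let E₀ : U × U →ₗ[ℝ] V := f ∘ₗ LinearMap.fst ℝ U U + I' ∘ₗ f ∘ₗ LinearMap.snd ℝ U U
  let E : (U × U) ≃ₗ[ℝ] V := LinearEquiv.ofBijective E₀ hb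
  have hE : ∀ p, E p = f p.1 + Complex.I • f p.2 := fun p => rfl
  have hEI : ∀ p, Complex.I • E p = E (-p.2, p.1) := by
    intro p
    rw [hE, hE, smul_add, I_smul_I_smul, map_neg]; abel
  have hEρ : ∀ h p, ρ h (E p) = E (σ h p.1, σ h p.2) := by
    intro h p; rw [hE, hE]; simp [hf]
  constructor
  · refine nonempty_algEquiv_real (IntertwiningMap σ σ) fun T => ?_
    let Tc : V →ₗ[ℂ] V := complexLinear
      (E.toLinearMap ∘ₗ (T.toLinearMap.prodMap T.toLinearMap) ∘ₗ E.symm.toLinearMap) (by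
        intro v
        obtain ⟨p, rfl⟩ := E.surjective v
        simp [hEI])
    have hTc : ∀ p, Tc (E p) = E (T p.1, T p.2) := by
      intro p
      change E ((T.toLinearMap.prodMap T.toLinearMap) (E.symm (E p))) = _
      rw [LinearEquiv.symm_apply_apply]; rfl
    obtain ⟨c, hc⟩ := exists_scalar ρ hρ Tc (by
      intro h v
      obtain ⟨p, rfl⟩ := E.surjective v
      rw [hEρ, hTc, hTc, hEρ]
      simp [IntertwiningMap.isIntertwining])
    have key : ∀ u, T u = c.re • u ∧ c.im • u = 0 := by
      intro u
      have h1 : Tc (E (u, 0)) = c • E (u, 0) := by rw [hc]; rfl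
      rw [hTc] at h1
      have h2 : c • E (u, 0) = E (c.re • u, c.im • u) := by
        rw [hE, hE]
        simp only [map_zero, smul_zero, add_zero, map_smul]
        conv_lhs => rw [← Complex.re_add_im c]
        rw [add_smul, mul_comm, mul_smul]; rfl
      rw [h2] at h1
      have h3 := E.injective h1
      simp only [map_zero, Prod.mk.injEq] at h3
      exact ⟨h3.1, h3.2.symm⟩
    refine ⟨c.re, ?_⟩
    ext u
    simpa using (key u).1
  · let J : V →ₛₗ[starRingEnd ℂ] V := antilinear
      (E.toLinearMap ∘ₗ (LinearMap.prodMap LinearMap.id (-LinearMap.id)) ∘ₗ E.symm.toLinearMap) (by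
        intro v
        obtain ⟨p, rfl⟩ := E.surjective v
        simp only [LinearMap.comp_apply, LinearEquiv.coe_coe, hEI, LinearEquiv.symm_apply_apply]
        rw [← map_neg]
        simp)
    have hJ : ∀ p, J (E p) = E (p.1, -p.2) := by
      intro p
      change E ((LinearMap.prodMap LinearMap.id (-LinearMap.id)) (E.symm (E p))) = _
      rw [LinearEquiv.symm_apply_apply]; rfl
    refine ⟨J, fun h v => ?_, fun v => ?_⟩
    · obtain ⟨p, rfl⟩ := E.surjective v
      rw [hEρ, hJ, hJ]
      simp [hEρ]
    · obtain ⟨p, rfl⟩ := E.surjective v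
      rw [hJ, hJ]
      simp

omit [FiniteDimensional ℂ V] in
include hσ hf in
-- The fixed vectors of `J` correspond to an invariant real subspace of `U`. If it is everything, `J
-- = 1`; if it is zero, `v + J v = 0` for all `v`, so `J = -1`. Neither is antilinear.
theorem not_exists_conj_of_surjective (hf0 : f ≠ 0) (hs : Function.Surjective f)
    (J : V →ₛₗ[starRingEnd ℂ] V) (hJ : IsAntiIntertwining ρ (MulEquiv.refl H) J)
    (hJJ : ∀ v, J (J v) = v) : False := by
  have hinj := injective_of_real_equivariant hσ f hf hf0
  have hn := ((isIrreducible_iff σ).1 hσ).1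
  obtain ⟨u, hu⟩ := exists_ne (0 : U)
  have hfu : f u ≠ 0 := fun h => hu (hinj (by rw [h, map_zero]))
  have hfu2 : (2 : ℝ) • f u ≠ 0 := smul_ne_zero two_ne_zero hfu
  let K : Submodule ℝ U := LinearMap.ker ((antilinearReal J - LinearMap.id) ∘ₗ f)
  have hK : ∀ w, w ∈ K ↔ J (f w) = f w := by
    intro w
    change J (f w) - f w = 0 ↔ _
    exact sub_eq_zero
  rcases ((isIrreducible_iff σ).1 hσ).2 K (fun h w hw => by
      rw [hK] at hw ⊢
      rw [hf, hJ, hw]; rfl) with h | h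
  · have hall : ∀ v, J v = -v := by
      intro v
      obtain ⟨w, hw⟩ := hs (v + J v)
      have h1 : w ∈ K := by rw [hK, hw, map_add, hJJ, add_comm]
      rw [h, Submodule.mem_bot] at h1
      rw [h1, map_zero] at hw
      exact eq_neg_of_add_eq_zero_right hw.symm
    have h2 := hall (Complex.I • f u)
    rw [map_smulₛₗ, hall, Complex.conj_I, neg_smul, smul_neg, neg_neg] at h2
    have h3 := congrArg (fun v => -(Complex.I • v)) h2
    simp only [smul_neg, I_smul_I_smul, neg_neg] at h3
    exact hfu2 (by rw [two_smul]; exact (eq_neg_iff_add_eq_zero.1 h3))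
  · have hall : ∀ v, J v = v := by
      intro v
      obtain ⟨w, rfl⟩ := hs v
      exact (hK w).1 (h ▸ Submodule.mem_top)
    have h2 := hall (Complex.I • f u)
    rw [map_smulₛₗ, hall, Complex.conj_I, neg_smul] at h2
    have h3 := congrArg (fun v => -(Complex.I • v)) h2
    simp only [smul_neg, I_smul_I_smul, neg_neg] at h3
    exact hfu2 (by rw [two_smul]; exact (eq_neg_iff_add_eq_zero.1 h3.symm))

include hρ in
-- The linear part of a real endomorphism of `V` commutes with `ρ` and is a scalar by Schur; the
-- antilinear part is again intertwining.
theorem exists_smul_add_of_end_of_surjective (e : U ≃ₗ[ℝ] V) (he : ∀ h u, e (σ h u) = ρ h (e u))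
    (T : IntertwiningMap σ σ) : ∃ (c : ℂ) (A : V →ₛₗ[starRingEnd ℂ] V),
      IsAntiIntertwining ρ (MulEquiv.refl H) A ∧ ∀ u, e (T u) = c • e u + A (e u) := by
  have he' : ∀ h v, e.symm (ρ h v) = σ h (e.symm v) := by
    intro h v
    apply e.injective
    rw [he]; simp
  obtain ⟨L, A, h1, h2, h3⟩ := exists_eq_complexLinear_add_antilinear
    (e.toLinearMap ∘ₗ T.toLinearMap ∘ₗ e.symm.toLinearMap)
  have hT : ∀ h v, e (T (e.symm (ρ h v))) = ρ h (e (T (e.symm v))) := by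
    intro h v
    rw [he', IntertwiningMap.isIntertwining, he]
  have hT2 : ∀ h v, e (T (e.symm (Complex.I • ρ h v))) =
      ρ h (e (T (e.symm (Complex.I • v)))) := fun h v => by rw [← map_smul, hT]
  have hI : ∀ h v, ρ h (Complex.I • v) = Complex.I • ρ h v := fun h v => map_smul _ _ _
  have hsm : ∀ (r : ℝ) h v, ρ h (r • v) = r • ρ h v := fun r h v => map_smul (ρ h) (r : ℂ) v
  obtain ⟨c, hc⟩ := exists_scalar ρ hρ L (by
    intro h v
    rw [h2, h2, hsm, map_sub]
    simp only [hI, LinearMap.comp_apply, LinearEquiv.coe_coe, IntertwiningMap.toLinearMap_apply, hT,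
      hT2])
  refine ⟨c, A, fun h v => ?_, fun u => ?_⟩
  · rw [h3, h3, MulEquiv.refl_apply, hsm, map_add]
    simp only [hI, LinearMap.comp_apply, LinearEquiv.coe_coe, IntertwiningMap.toLinearMap_apply, hT,
      hT2]
  · have := h1 (e u)
    rw [hc] at this
    simpa using this

/-- Conjugating a real linear endomorphism of `V` to an intertwining map of `σ`. -/
def endOfEquiv (e : U ≃ₗ[ℝ] V) (he : ∀ h u, e (σ h u) = ρ h (e u)) (T : V →ₗ[ℝ] V)
    (hT : ∀ h v, T (ρ h v) = ρ h (T v)) : IntertwiningMap σ σ :=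
  ⟨e.symm.toLinearMap ∘ₗ T ∘ₗ e.toLinearMap, fun h => by
    ext u
    apply e.injective
    simp [he, hT]⟩

omit [FiniteDimensional ℂ V] in
theorem apply_endOfEquiv (e : U ≃ₗ[ℝ] V) (he : ∀ h u, e (σ h u) = ρ h (e u)) (T : V →ₗ[ℝ] V)
    (hT : ∀ h v, T (ρ h v) = ρ h (T v)) (u : U) : e (endOfEquiv e he T hT u) = T (e u) :=
  e.apply_symm_apply _

include hρ hσ in
theorem end_complex_of_equiv (e : U ≃ₗ[ℝ] V) (he : ∀ h u, e (σ h u) = ρ h (e u))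
    (hJ : ∀ J : V →ₛₗ[starRingEnd ℂ] V, IsAntiIntertwining ρ (MulEquiv.refl H) J → J = 0) :
    Nonempty (IntertwiningMap σ σ ≃ₐ[ℝ] ℂ) := by
  have := intertwiningMap_nontrivial hσ
  let I' : V →ₗ[ℝ] V := (LinearMap.lsmul ℂ V Complex.I).restrictScalars ℝ
  let I := endOfEquiv e he I' fun h v => (map_smul (ρ h) _ _).symm
  have hI : ∀ u, e (I u) = Complex.I • e u := apply_endOfEquiv e he I' _
  refine nonempty_algEquiv_complex I ?_ fun T => ?_
  · ext u
    apply e.injective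
    change e (I (I u)) = e ((-1 : ℝ) • u)
    rw [hI, hI, I_smul_I_smul, neg_one_smul, map_neg]
  · obtain ⟨c, A, hA, h⟩ := exists_smul_add_of_end_of_surjective hρ e he T
    refine ⟨c.re, c.im, ?_⟩
    ext u
    apply e.injective
    change e (T u) = e (c.re • u + c.im • I u)
    rw [h, hJ A hA, map_add, map_smul, map_smul, hI, LinearMap.zero_apply, add_zero]
    conv_lhs => rw [← Complex.re_add_im c]
    rw [add_smul, mul_smul]; rfl

include hρ hσ in
-- The antilinear parts are the complex multiples of `J₀`, so `1, i, J₀, i J₀` span over `ℝ`, and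
-- antilinearity of `J₀` supplies the anticommutation.
theorem end_quaternion_of_equiv (e : U ≃ₗ[ℝ] V) (he : ∀ h u, e (σ h u) = ρ h (e u))
    (J₀ : V →ₛₗ[starRingEnd ℂ] V) (hJ : IsAntiIntertwining ρ (MulEquiv.refl H) J₀)
    (hJJ : ∀ v, J₀ (J₀ v) = -v) :
    Nonempty (IntertwiningMap σ σ ≃ₐ[ℝ] ℍ[ℝ]) := by
  have := intertwiningMap_nontrivial hσ
  let I' : V →ₗ[ℝ] V := (LinearMap.lsmul ℂ V Complex.I).restrictScalars ℝ
  let I := endOfEquiv e he I' fun h v => (map_smul (ρ h) _ _).symm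
  have hI : ∀ u, e (I u) = Complex.I • e u := apply_endOfEquiv e he I' _
  let J := endOfEquiv e he (antilinearReal J₀) hJ
  have hJe : ∀ u, e (J u) = J₀ (e u) := apply_endOfEquiv e he (antilinearReal J₀) hJ
  refine nonempty_algEquiv_quaternion I J ?_ ?_ ?_ fun T => ?_
  · ext u
    apply e.injective
    change e (I (I u)) = e ((-1 : ℝ) • u)
    rw [hI, hI, I_smul_I_smul, neg_one_smul, map_neg]
  · ext u
    apply e.injective
    change e (J (J u)) = e ((-1 : ℝ) • u)
    rw [hJe, hJe, hJJ, neg_one_smul, map_neg]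
  · ext u
    apply e.injective
    change e (J (I u)) = e ((-1 : ℝ) • (I (J u)))
    rw [hJe, hI, neg_one_smul, map_neg, hI, hJe, map_smulₛₗ, Complex.conj_I, neg_smul]
  · obtain ⟨c, A, hA, h⟩ := exists_smul_add_of_end_of_surjective hρ e he T
    obtain ⟨b, hb⟩ := exists_eq_smul_of_isAntiIntertwining hρ (s := 1) (by simp) (by simp) hJ hA
      (neg_ne_zero.2 one_ne_zero) (by simpa using hJJ)
    refine ⟨c.re, c.im, b.re, b.im, ?_⟩
    ext u
    apply e.injective
    change e (T u) = e (c.re • u + c.im • I u + b.re • J u + b.im • I (J u))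
    rw [h, hb, map_add, map_add, map_add, map_smul, map_smul, map_smul, map_smul, hI, hI, hJe]
    conv_lhs => rw [← Complex.re_add_im c, ← Complex.re_add_im b]
    rw [add_smul, add_smul, mul_smul, mul_smul, ← add_assoc]; rfl

end

/-! ### The indicator `F` and the endomorphism algebra of the simple real module -/

theorem exists_irreducible_subrepresentation {k H V : Type*} [Field k] [Group H] [AddCommGroup V]
    [Module k V] [FiniteDimensional k V] [Nontrivial V] (σ : Representation k H V) :
    ∃ W : Subrepresentation σ, W.toRepresentation.IsIrreducible := by
  classical
  have hex : ∃ n, ∃ W : Subrepresentation σ, W.toSubmodule ≠ ⊥ ∧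
      Module.finrank k W.toSubmodule = n := ⟨_, ⊤, top_ne_bot (α := Submodule k V), rfl⟩
  obtain ⟨W, hW0, hWn⟩ := Nat.find_spec hex
  refine ⟨W, (isIrreducible_iff _).2 ⟨Submodule.nontrivial_iff_ne_bot.2 hW0, fun X hX => ?_⟩⟩
  by_cases hX0 : X = ⊥
  · exact Or.inl hX0
  right
  have hmin := Nat.find_min' hex ⟨⟨X.map W.toSubmodule.subtype, ?_⟩, ?_, rfl⟩
  · rw [← hWn] at hmin
    apply Submodule.eq_top_of_finrank_eq
    refine le_antisymm (Submodule.finrank_le X) (hmin.trans ?_)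
    exact Submodule.finrank_map_le _ _
  · rintro h _ ⟨x, hx, rfl⟩
    exact ⟨_, hX h x hx, rfl⟩
  · exact fun h => hX0 (Submodule.map_injective_of_injective (Submodule.subtype_injective _)
      (h.trans (Submodule.map_bot _).symm))

theorem not_nonempty_algEquiv_of_finrank_ne {E A B : Type*} [Semiring E] [Algebra ℝ E] [Ring A]
    [Algebra ℝ A] [Ring B] [Algebra ℝ B] (hE : Nonempty (E ≃ₐ[ℝ] A))
    (hAB : Module.finrank ℝ A ≠ Module.finrank ℝ B) : ¬ Nonempty (E ≃ₐ[ℝ] B) := by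
  rintro ⟨e⟩
  obtain ⟨e'⟩ := hE
  exact hAB (e'.symm.trans e).toLinearEquiv.finrank_eq

theorem finrank_real_ne_complex : Module.finrank ℝ ℝ ≠ Module.finrank ℝ ℂ := by
  simp [Complex.finrank_real_complex]

theorem finrank_real_ne_quaternion : Module.finrank ℝ ℝ ≠ Module.finrank ℝ ℍ[ℝ] := by
  simp [Quaternion.finrank_eq_four]

theorem finrank_complex_ne_quaternion : Module.finrank ℝ ℂ ≠ Module.finrank ℝ ℍ[ℝ] := by
  simp [Complex.finrank_real_complex, Quaternion.finrank_eq_four]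

/-- The algebra `E` is the one that the indicator `F` predicts. -/
def MatchesIndicator (F : ℂ) (E : Type*) [Semiring E] [Algebra ℝ E] : Prop :=
  (F = 1 ∧ Nonempty (E ≃ₐ[ℝ] ℝ)) ∨ (F = 0 ∧ Nonempty (E ≃ₐ[ℝ] ℂ)) ∨
    (F = -1 ∧ Nonempty (E ≃ₐ[ℝ] ℍ[ℝ]))

section

variable {F : ℂ} {E : Type*} [Semiring E] [Algebra ℝ E] (h : MatchesIndicator F E)

include h

theorem MatchesIndicator.real_iff : Nonempty (E ≃ₐ[ℝ] ℝ) ↔ F = 1 := by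
  rcases h with ⟨rfl, h⟩ | ⟨rfl, h⟩ | ⟨rfl, h⟩
  · simp [h]
  · simpa using not_nonempty_algEquiv_of_finrank_ne h finrank_real_ne_complex.symm
  · have := not_nonempty_algEquiv_of_finrank_ne h finrank_real_ne_quaternion.symm
    norm_num [this]

theorem MatchesIndicator.complex_iff : Nonempty (E ≃ₐ[ℝ] ℂ) ↔ F = 0 := by
  rcases h with ⟨rfl, h⟩ | ⟨rfl, h⟩ | ⟨rfl, h⟩
  · simpa using not_nonempty_algEquiv_of_finrank_ne h finrank_real_ne_complex
  · simp [h]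
  · simpa using not_nonempty_algEquiv_of_finrank_ne h finrank_complex_ne_quaternion.symm

theorem MatchesIndicator.quaternion_iff : Nonempty (E ≃ₐ[ℝ] ℍ[ℝ]) ↔ F = -1 := by
  rcases h with ⟨rfl, h⟩ | ⟨rfl, h⟩ | ⟨rfl, h⟩
  · have := not_nonempty_algEquiv_of_finrank_ne h finrank_real_ne_quaternion
    norm_num [this]
  · simpa using not_nonempty_algEquiv_of_finrank_ne h finrank_complex_ne_quaternion
  · simp [h]

end

/-- If `U` is all of `V`, there is no `J` with `J² = 1`, so the indicator is `-1` or `0`. If `U` is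
a real form, its conjugation is such a `J` and excludes these two values. -/
theorem realEnd_matchesIndicator {H V U : Type*} [Group H] [Fintype H] [AddCommGroup V] [Module ℂ V]
    [FiniteDimensional ℂ V] [AddCommGroup U] [Module ℝ U] {ρ : Representation ℂ H V}
    {σ : Representation ℝ H U} (hρ : ρ.IsIrreducible) (hσ : σ.IsIrreducible) (f : U →ₗ[ℝ] V)
    (hf : ∀ h u, f (σ h u) = ρ h (f u)) (hf0 : f ≠ 0) :
    MatchesIndicator (twistedIndicator (MulEquiv.refl H) 1 ρ.character)
      (IntertwiningMap σ σ) := by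
  have hV := ((isIrreducible_iff ρ).1 hρ).1
  have tri := twistedIndicator_trichotomy ρ hρ (MulEquiv.refl H) (s := 1) (by simp) (by simp)
  rcases real_form_or_surjective hρ hσ f hf hf0 with hs | hb
  · let e := LinearEquiv.ofBijective f ⟨injective_of_real_equivariant hσ f hf hf0, hs⟩
    rcases tri with ⟨ε, rfl | rfl, hF, -, J, hJ, hJJ⟩ | ⟨hF, -, hJ⟩
    · exact (not_exists_conj_of_surjective hσ f hf hf0 hs J hJ (by simpa using hJJ)).elim
    · exact Or.inr (Or.inr ⟨hF, end_quaternion_of_equiv hρ hσ e hf J hJ (by simpa using hJJ)⟩)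
    · exact Or.inr (Or.inl ⟨hF, end_complex_of_equiv hρ hσ e hf hJ⟩)
  · obtain ⟨hend, J', hJ', hJJ'⟩ := end_real_of_real_form hρ hσ f hf hb
    rcases tri with ⟨ε, rfl | rfl, hF, -, J, hJ, hJJ⟩ | ⟨hF, -, hJ⟩
    · exact Or.inl ⟨hF, hend⟩
    · exact (not_isAntiIntertwining_of_sign hρ (s := 1) (by simp) (by simp) hJ'
        (by simpa using hJJ') hJ (by simpa using hJJ)).elim
    · obtain ⟨v, hv⟩ := exists_ne (0 : V)
      exact (hv (by rw [← hJJ' v, hJ J' hJ']; rfl)).elim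

section

variable {H : Type u} [Group H] [Fintype H] {χ : H → ℂ} (hχ : χ ∈ irrChars H)

include hχ in
-- Every choice of `V` and `U` admitted by `HasRealEnd` matches the same indicator, so the choices
-- are immaterial. A choice exists: any simple real submodule of `V`.
theorem hasRealEnd_iff (A : Type) [Semiring A] [Algebra ℝ A] (F₀ : ℂ)
    (hA : ∀ (F : ℂ) (E : Type u) [Semiring E] [Algebra ℝ E], MatchesIndicator F E →
      (Nonempty (E ≃ₐ[ℝ] A) ↔ F = F₀)) :
    HasRealEnd χ A ↔ twistedIndicator (MulEquiv.refl H) 1 χ = F₀ := by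
  constructor
  · rintro ⟨V, _, _, _, ρ, U, _, _, σ, hρ, rfl, hσ, ⟨f, hf0, hf⟩, hE⟩
    exact (hA _ _ (realEnd_matchesIndicator hρ hσ f hf hf0)).1 hE
  · intro hF
    obtain ⟨V, _, _, _, ρ, hρ, rfl⟩ := hχ
    have hV := ((isIrreducible_iff ρ).1 hρ).1
    let σ₀ : Representation ℝ H V :=
      { toFun := fun h => (ρ h).restrictScalars ℝ
        map_one' := by ext; simp
        map_mul' := fun a b => by ext; simp }
    have : FiniteDimensional ℝ V := FiniteDimensional.complexToReal V
    obtain ⟨W, hW⟩ := exists_irreducible_subrepresentation σ₀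
    have hf0 : W.toSubmodule.subtype ≠ 0 := by
      intro h
      have hWn := ((isIrreducible_iff _).1 hW).1
      obtain ⟨w, hw⟩ := exists_ne (0 : W.toSubmodule)
      exact hw (Subtype.ext (LinearMap.congr_fun h w))
    refine ⟨V, _, _, ‹_›, ρ, W.toSubmodule, _, _, W.toRepresentation, hρ, rfl, hW,
      ⟨W.toSubmodule.subtype, hf0, fun h u => rfl⟩, ?_⟩
    exact (hA _ _ (realEnd_matchesIndicator hρ hW W.toSubmodule.subtype (fun h u => rfl) hf0)).2 hF

include hχ

theorem hasRealEnd_real_iff : HasRealEnd χ ℝ ↔ twistedIndicator (MulEquiv.refl H) 1 χ = 1 :=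
  hasRealEnd_iff hχ ℝ 1 fun _ _ _ _ h => h.real_iff

theorem hasRealEnd_complex_iff : HasRealEnd χ ℂ ↔ twistedIndicator (MulEquiv.refl H) 1 χ = 0 :=
  hasRealEnd_iff hχ ℂ 0 fun _ _ _ _ h => h.complex_iff

theorem hasRealEnd_quaternion_iff :
    HasRealEnd χ ℍ[ℝ] ↔ twistedIndicator (MulEquiv.refl H) 1 χ = -1 :=
  hasRealEnd_iff hχ ℍ[ℝ] (-1) fun _ _ _ _ h => h.quaternion_iff

end

/-! ### Subgroups of index two -/

section

variable {Γ : Type u} [Group Γ] {G : Subgroup Γ} [G.Normal]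

/-- The square of an element, in a subgroup of index two. -/
def sqElem (hG : G.index = 2) (x : Γ) : G := ⟨x ^ 2, Subgroup.sq_mem_of_index_two hG x⟩

theorem conjNormal_conjNormal (hG : G.index = 2) (x : Γ) (h : G) :
    MulAut.conjNormal x (MulAut.conjNormal x h) = sqElem hG x * h * (sqElem hG x)⁻¹ := by
  ext
  simp [MulAut.conjNormal_apply, sqElem, pow_two, mul_assoc]

theorem conjNormal_sqElem (hG : G.index = 2) (x : Γ) :
    MulAut.conjNormal x (sqElem hG x) = sqElem hG x := by
  ext
  simp only [MulAut.conjNormal_apply, sqElem]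
  group

omit [G.Normal] in
theorem exists_notMem_of_index_two (hG : G.index = 2) : ∃ x, x ∉ G := by
  by_contra! h
  rw [(Subgroup.eq_top_iff' G).2 h, Subgroup.index_top] at hG
  omega

omit [G.Normal] in
theorem mul_inv_mem_of_index_two (hG : G.index = 2) {x y : Γ} (hx : x ∉ G) (hy : y ∉ G) :
    y * x⁻¹ ∈ G := by
  rw [Subgroup.mul_mem_iff_of_index_two hG, inv_mem_iff]
  simp [hx, hy]

/-- The complement of `G` is `G x`, and `(g x)² = g (x g x⁻¹) x²`. -/
theorem sharpIndicator_eq [Fintype G] (hG : G.index = 2) {x : Γ} (hx : x ∉ G) (χ : G → ℂ) :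
    sharpIndicator G χ = twistedIndicator (MulAut.conjNormal x) (sqElem hG x) χ := by
  classical
  let e : G ≃ {y : Γ // y ∉ G} :=
    { toFun := fun g => ⟨g * x, by rw [Subgroup.mul_mem_iff_of_index_two hG]; simp [hx]⟩
      invFun := fun y => ⟨y * x⁻¹, mul_inv_mem_of_index_two hG hx y.2⟩
      left_inv := fun g => by simp
      right_inv := fun y => by simp }
  have : Fintype {y : Γ // y ∉ G} := Fintype.ofEquiv _ e
  rw [sharpIndicator, twistedIndicator, finsum_eq_sum_of_fintype, ← Equiv.sum_comp e]
  congr 1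
  refine Finset.sum_congr rfl fun g _ => ?_
  rw [dif_pos (Subgroup.sq_mem_of_index_two hG _)]
  congr 1
  ext
  simp only [e, Equiv.coe_fn_mk, Subgroup.coe_mul, MulAut.conjNormal_apply, sqElem]
  simp [pow_two, mul_assoc]

omit [G.Normal] in
theorem indicator_eq [Fintype G] (χ : G → ℂ) :
    indicator G χ = twistedIndicator (MulEquiv.refl G) 1 χ := by
  rw [indicator, twistedIndicator, finsum_eq_sum_of_fintype]
  simp [pow_two]

end

/-! ### The simple Real representation that contains an irreducible representation -/

section

variable {Γ : Type u} [Group Γ] {G : Subgroup Γ} [G.Normal] {M : Type u}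
  [AddCommGroup M] [Module ℂ M] (R : RealRep G M)

omit [G.Normal] in
theorem RealRep.act_mul (a b : Γ) (m : M) : R.act a (R.act b m) = R.act (a * b) m := by
  rw [map_mul]; rfl

variable {R}

theorem stable_of_index_two (hG : G.index = 2) {x : Γ} (hx : x ∉ G) (W : Set M)
    (h1 : ∀ g : G, ∀ w ∈ W, R.act g w ∈ W) (h2 : ∀ w ∈ W, R.act x w ∈ W) (γ : Γ) (w : M)
    (hw : w ∈ W) : R.act γ w ∈ W := by
  by_cases hγ : γ ∈ G
  · exact h1 ⟨γ, hγ⟩ w hw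
  · have := h1 ⟨γ * x⁻¹, mul_inv_mem_of_index_two hG hx hγ⟩ _ (h2 w hw)
    rw [RealRep.act_mul] at this
    simpa using this

theorem mem_endAlgebra (hG : G.index = 2) {x : Γ} (hx : x ∉ G) (T : Module.End ℂ M)
    (h1 : ∀ (g : G) m, T (R.act g m) = R.act g (T m)) (h2 : ∀ m, T (R.act x m) = R.act x (T m)) :
    T ∈ R.endAlgebra := by
  intro γ m
  by_cases hγ : γ ∈ G
  · exact h1 ⟨γ, hγ⟩ m
  · have := h1 ⟨γ * x⁻¹, mul_inv_mem_of_index_two hG hx hγ⟩ (R.act x m)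
    rw [RealRep.act_mul, h2, RealRep.act_mul] at this
    simpa using this

variable {V : Type u} [AddCommGroup V] [Module ℂ V]
  {ρ : Representation ℂ G V}

omit [G.Normal] in
theorem endAlgebra_nontrivial (hR : R.IsIrreducible) : Nontrivial R.endAlgebra := by
  have := hR.1
  obtain ⟨m, hm⟩ := exists_ne (0 : M)
  refine ⟨1, 0, fun h => hm ?_⟩
  have := congrArg (fun T : R.endAlgebra => (T : Module.End ℂ M) m) h
  simpa using this

variable (hG : G.index = 2) {x : Γ} (hx : x ∉ G) (hρ : ρ.IsIrreducible) (hR : R.IsIrreducible)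
  (f : V →ₗ[ℂ] M) (hf : ∀ (g : G) v, f (ρ g v) = R.act g (f v))

theorem act_x_act (g : G) (m : M) :
    R.act x (R.act g m) = R.act (MulAut.conjNormal x g : G) (R.act x m) := by
  rw [RealRep.act_mul, RealRep.act_mul]
  congr 2
  rw [MulAut.conjNormal_apply]; group

omit [G.Normal] in
theorem act_x_act_x (m : M) : R.act x (R.act x m) = R.act (sqElem hG x : Γ) m := by
  rw [RealRep.act_mul]
  congr 2
  exact (pow_two x).symm

include hρ hf in
theorem injective_of_equivariant (hf0 : f ≠ 0) : Function.Injective f := by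
  rw [← LinearMap.ker_eq_bot]
  refine (((isIrreducible_iff ρ).1 hρ).2 (LinearMap.ker f) fun h w hw => ?_).resolve_right
    fun h => hf0 (LinearMap.ker_eq_top.1 h)
  rw [LinearMap.mem_ker] at hw ⊢
  rw [hf, hw, map_zero]

include hG hx hρ hR hf in
theorem surjective_or_bijective_sum (hf0 : f ≠ 0) :
    Function.Surjective f ∨ Function.Bijective (fun p : V × V => f p.1 + R.act x (f p.2)) := by
  have hinj := injective_of_equivariant hρ f hf hf0
  have hn := ((isIrreducible_iff ρ).1 hρ).1
  obtain ⟨u₀, hu₀⟩ := exists_ne (0 : V)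
  have hfu₀ : f u₀ ≠ 0 := fun h => hu₀ (hinj (by rw [h, map_zero]))
  have hsub : ∀ W : Submodule ℂ M, (∀ g : G, ∀ w ∈ W, R.act g w ∈ W) →
      (∀ w ∈ W, R.act x w ∈ W) → f u₀ ∈ W → W = ⊤ := by
    intro W h1 h2 h
    refine (hR.2 W (stable_of_index_two hG hx (W : Set M) h1 h2)).resolve_left fun hb => hfu₀ ?_
    rwa [hb, Submodule.mem_bot] at h
  -- The role of `i` in the real case is now played by `x`: `K` consists of the `v` with `x f(v)` in
  -- the image of `f`. It is zero or everything, so `M` is the sum of the image and its translate,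
  -- or the image alone.
  let K : Submodule ℂ V :=
    { carrier := {v | ∃ w, f w = R.act x (f v)}
      add_mem' := by
        rintro a b ⟨w, hw⟩ ⟨w', hw'⟩
        exact ⟨w + w', by rw [map_add, map_add, map_add, hw, hw']⟩
      zero_mem' := ⟨0, by simp⟩
      smul_mem' := by
        rintro c a ⟨w, hw⟩
        exact ⟨conj c • w, by rw [map_smul, map_smul, R.act_smul_of_notMem x hx, hw]⟩ }
  have hKmem : ∀ v, v ∈ K ↔ ∃ w, f w = R.act x (f v) := fun u => Iff.rfl
  rcases ((isIrreducible_iff ρ).1 hρ).2 K (fun g w hw => by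
      rw [hKmem] at hw ⊢
      obtain ⟨y, hy⟩ := hw
      exact ⟨ρ (MulAut.conjNormal x g) y, by rw [hf, hy, hf, act_x_act]⟩) with hK | hK
  · right
    constructor
    · intro p q hpq
      have hab : f (p.1 - q.1) + R.act x (f (p.2 - q.2)) = 0 := by
        have h := sub_eq_zero.2 hpq
        simp only at h
        rw [← h, map_sub, map_sub, map_sub]; abel
      have hb : p.2 - q.2 ∈ K := by
        rw [hKmem]
        exact ⟨-(p.1 - q.1), by rw [map_neg]; exact (eq_neg_of_add_eq_zero_right hab).symm⟩
      rw [hK, Submodule.mem_bot] at hb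
      rw [hb, map_zero, map_zero, add_zero] at hab
      exact Prod.ext (sub_eq_zero.1 (hinj (hab.trans (map_zero f).symm))) (sub_eq_zero.1 hb)
    · let W : Submodule ℂ M :=
        { carrier := Set.range fun p : V × V => f p.1 + R.act x (f p.2)
          add_mem' := by
            rintro _ _ ⟨p, rfl⟩ ⟨q, rfl⟩
            exact ⟨p + q, by simp; abel⟩
          zero_mem' := ⟨0, by simp⟩
          smul_mem' := by
            rintro c _ ⟨p, rfl⟩
            refine ⟨(c • p.1, conj c • p.2), ?_⟩
            simp only
            rw [map_smul, map_smul, R.act_smul_of_notMem x hx, Complex.conj_conj, smul_add] }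
      have hW := hsub W (by
        rintro g _ ⟨p, rfl⟩
        refine ⟨(ρ g p.1, ρ ((MulAut.conjNormal x).symm g) p.2), ?_⟩
        simp only
        rw [hf, hf, act_x_act, MulEquiv.apply_symm_apply, map_add]) (by
        rintro _ ⟨p, rfl⟩
        refine ⟨(ρ (sqElem hG x) p.2, p.1), ?_⟩
        simp only
        rw [hf, map_add, act_x_act_x hG, add_comm]) ⟨(u₀, 0), by simp⟩
      intro v
      have : v ∈ W := hW ▸ Submodule.mem_top
      exact this
  · left
    have hW := hsub (LinearMap.range f) (by
      rintro g _ ⟨p, rfl⟩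
      exact ⟨ρ g p, hf g p⟩) (by
      rintro _ ⟨p, rfl⟩
      exact (hKmem p).1 (hK ▸ Submodule.mem_top)) ⟨u₀, rfl⟩
    exact LinearMap.range_eq_top.1 hW

variable [FiniteDimensional ℂ V]

include hG hx hρ hR hf in
-- Here `x` itself acts on `V`, which gives `J` with `J² = ρ(x²)`. An endomorphism is a complex
-- scalar by Schur, and commuting with the antilinear `x` makes it real.
theorem end_real_of_surjective (hf0 : f ≠ 0) (hs : Function.Surjective f) :
    Nonempty (R.endAlgebra ≃ₐ[ℝ] ℝ) ∧ ∃ J : V →ₛₗ[starRingEnd ℂ] V,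
      IsAntiIntertwining ρ (MulAut.conjNormal x) J ∧ ∀ v, J (J v) = ρ (sqElem hG x) v := by
  let e := LinearEquiv.ofBijective f ⟨injective_of_equivariant hρ f hf hf0, hs⟩
  have he : ∀ (g : G) v, e (ρ g v) = R.act g (e v) := hf
  have hn := hR.1
  have := endAlgebra_nontrivial hR
  constructor
  · refine nonempty_algEquiv_real R.endAlgebra fun T => ?_
    obtain ⟨c, hc⟩ := exists_scalar ρ hρ
      (e.symm.toLinearMap ∘ₗ (T : Module.End ℂ M) ∘ₗ e.toLinearMap) (by
        intro g v
        apply e.injective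
        simp only [LinearMap.comp_apply, LinearEquiv.coe_coe, LinearEquiv.apply_symm_apply, he]
        exact T.2 g (e v))
    have hT : ∀ m, (T : Module.End ℂ M) m = c • m := by
      intro m
      have := congrArg e (LinearMap.congr_fun hc (e.symm m))
      simpa using this
    obtain ⟨m, hm⟩ := exists_ne (0 : M)
    have hxm : R.act x m ≠ 0 := by
      intro h
      have h2 := congrArg (R.act x⁻¹) h
      rw [RealRep.act_mul, inv_mul_cancel, map_one, map_zero] at h2
      exact hm h2
    have h1 := T.2 x m
    rw [hT, hT, R.act_smul_of_notMem x hx] at h1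
    have h2 : c = conj c := smul_left_injective ℂ hxm h1
    refine ⟨c.re, ?_⟩
    ext m
    change (T : Module.End ℂ M) m = (c.re : ℂ) • m
    rw [hT, Complex.conj_eq_iff_re.1 h2.symm]
  · let J : V →ₛₗ[starRingEnd ℂ] V :=
      { toFun := fun v => e.symm (R.act x (e v))
        map_add' := fun a b => by simp
        map_smul' := fun c a => by rw [map_smul, R.act_smul_of_notMem x hx, map_smul] }
    have hJ : ∀ v, e (J v) = R.act x (e v) := fun v => e.apply_symm_apply _
    refine ⟨J, fun g v => ?_, fun v => ?_⟩
    · apply e.injective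
      rw [hJ, he, he, hJ, act_x_act]
    · apply e.injective
      rw [hJ, hJ, he, act_x_act_x hG]

end

/-! ### Endomorphisms of an induced Real representation -/

section

variable {Γ : Type u} [Group Γ] {G : Subgroup Γ} [G.Normal] {M : Type u}
  [AddCommGroup M] [Module ℂ M] {R : RealRep G M}
  {V : Type u} [AddCommGroup V] [Module ℂ V] [FiniteDimensional ℂ V] {ρ : Representation ℂ G V}

/-- A Real representation that is the sum of `V` and its translate by `x`. -/
structure IsInducedBy (R : RealRep G M) (ρ : Representation ℂ G V) (hG : G.index = 2) (x : Γ)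
    (E : (V × V) ≃ₗ[ℝ] M) : Prop where
  notMem : x ∉ G
  smul : ∀ (c : ℂ) p, c • E p = E (c • p.1, conj c • p.2)
  act : ∀ (g : G) p, R.act g (E p) = E (ρ g p.1, ρ ((MulAut.conjNormal x).symm g) p.2)
  act_x : ∀ p, R.act x (E p) = E (ρ (sqElem hG x) p.2, p.1)

theorem exists_isInducedBy (hG : G.index = 2) {x : Γ} (hx : x ∉ G)
    (f : V →ₗ[ℂ] M) (hf : ∀ (g : G) v, f (ρ g v) = R.act g (f v))
    (hb : Function.Bijective (fun p : V × V => f p.1 + R.act x (f p.2))) :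
    ∃ E : (V × V) ≃ₗ[ℝ] M, IsInducedBy R ρ hG x E := by
  let E₀ : V × V →ₗ[ℝ] M := f.restrictScalars ℝ ∘ₗ LinearMap.fst ℝ V V +
    R.act x ∘ₗ f.restrictScalars ℝ ∘ₗ LinearMap.snd ℝ V V
  let E : (V × V) ≃ₗ[ℝ] M := LinearEquiv.ofBijective E₀ hb
  have hE : ∀ p, E p = f p.1 + R.act x (f p.2) := fun p => rfl
  refine ⟨E, hx, fun c p => ?_, fun g p => ?_, fun p => ?_⟩
  · rw [hE, hE, map_smul, map_smul, R.act_smul_of_notMem x hx, Complex.conj_conj, smul_add]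
  · rw [hE, hE, hf, hf, act_x_act, MulEquiv.apply_symm_apply, map_add]
  · rw [hE, hE, hf, map_add, act_x_act_x hG, add_comm]

variable {hG : G.index = 2} {x : Γ} {E : (V × V) ≃ₗ[ℝ] M} (hE : IsInducedBy R ρ hG x E)
  (hρ : ρ.IsIrreducible) (hR : R.IsIrreducible)

theorem symm_mul_sqElem_inv (hG : G.index = 2) (x : Γ) (g : G) :
    (MulAut.conjNormal x).symm g * (sqElem hG x)⁻¹ = (sqElem hG x)⁻¹ * MulAut.conjNormal x g := by
  obtain ⟨h, rfl⟩ := (MulAut.conjNormal x).surjective g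
  rw [MulEquiv.symm_apply_apply, conjNormal_conjNormal hG]
  group

theorem rho_symm_apply (g : G) (v : V) :
    ρ ((MulAut.conjNormal x).symm g) (ρ (sqElem hG x)⁻¹ v) =
      ρ (sqElem hG x)⁻¹ (ρ (MulAut.conjNormal x g) v) := by
  rw [← Module.End.mul_apply, ← Module.End.mul_apply, ← map_mul, ← map_mul, symm_mul_sqElem_inv]

include hE hρ hR in
-- The graph of `ρ(x²)⁻¹ J` would be a proper nonzero stable complex subspace of the simple `M`.
theorem not_exists_conj_of_isInducedBy {J : V →ₛₗ[starRingEnd ℂ] V}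
    (hJ : IsAntiIntertwining ρ (MulAut.conjNormal x) J)
    (hJJ : ∀ v, J (J v) = ρ (sqElem hG x) v) : False := by
  have hn := ((isIrreducible_iff ρ).1 hρ).1
  obtain ⟨v₀, hv₀⟩ := exists_ne (0 : V)
  let W : Submodule ℂ M :=
    { carrier := {m | ∃ v, m = E (v, ρ (sqElem hG x)⁻¹ (J v))}
      add_mem' := by
        rintro _ _ ⟨a, rfl⟩ ⟨b, rfl⟩
        exact ⟨a + b, by rw [← map_add]; simp⟩
      zero_mem' := ⟨0, by rw [map_zero, map_zero, ← Prod.zero_eq_mk, map_zero]⟩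
      smul_mem' := by
        rintro c _ ⟨a, rfl⟩
        exact ⟨c • a, by rw [hE.smul, map_smulₛₗ, map_smul]⟩ }
  rcases hR.2 W (stable_of_index_two hG hE.notMem (W : Set M) (by
      rintro g _ ⟨a, rfl⟩
      exact ⟨ρ g a, by rw [hE.act, hJ, rho_symm_apply]⟩) (by
      rintro _ ⟨a, rfl⟩
      exact ⟨J a, by rw [hE.act_x, hJJ, rho_apply_inv, rho_inv_apply]⟩)) with h | h
  · have : E (v₀, ρ (sqElem hG x)⁻¹ (J v₀)) ∈ W := ⟨v₀, rfl⟩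
    rw [h, Submodule.mem_bot] at this
    have h2 := E.injective (this.trans (map_zero E).symm)
    exact hv₀ (congrArg Prod.fst h2)
  · have : E (v₀, 0) ∈ W := h ▸ Submodule.mem_top
    obtain ⟨w, hw⟩ := this
    have h2 := E.injective hw
    rw [Prod.mk.injEq] at h2
    obtain ⟨rfl, h3⟩ := h2
    have h4 := congrArg (ρ (sqElem hG x)) h3
    rw [rho_apply_inv, map_zero] at h4
    have h5 := hJJ v₀
    rw [← h4, map_zero] at h5
    exact hv₀ (by rw [← rho_inv_apply (ρ := ρ) (sqElem hG x) v₀, ← h5, map_zero])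

include hE in
/-- A real linear map of `V × V` that respects all structures gives an endomorphism. -/
theorem exists_mem_endAlgebra (T : V × V →ₗ[ℝ] V × V)
    (h0 : ∀ p, T (Complex.I • p.1, -(Complex.I • p.2)) =
      (Complex.I • (T p).1, -(Complex.I • (T p).2)))
    (h1 : ∀ (g : G) p, T (ρ g p.1, ρ ((MulAut.conjNormal x).symm g) p.2) =
      (ρ g (T p).1, ρ ((MulAut.conjNormal x).symm g) (T p).2))
    (h2 : ∀ p, T (ρ (sqElem hG x) p.2, p.1) = (ρ (sqElem hG x) (T p).2, (T p).1)) :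
    ∃ T' : R.endAlgebra, ∀ p, (T' : Module.End ℂ M) (E p) = E (T p) := by
  have hI : ∀ p, Complex.I • E p = E (Complex.I • p.1, -(Complex.I • p.2)) := by
    intro p; rw [hE.smul, Complex.conj_I, neg_smul]
  let T' : Module.End ℂ M := complexLinear (E.toLinearMap ∘ₗ T ∘ₗ E.symm.toLinearMap) (by
    intro m
    obtain ⟨p, rfl⟩ := E.surjective m
    rw [hI]
    simp only [LinearMap.comp_apply, LinearEquiv.coe_coe, LinearEquiv.symm_apply_apply]
    rw [h0, hI])
  have hT' : ∀ p, T' (E p) = E (T p) := by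
    intro p
    change E (T (E.symm (E p))) = _
    rw [LinearEquiv.symm_apply_apply]
  refine ⟨⟨T', mem_endAlgebra hG hE.notMem T' ?_ ?_⟩, hT'⟩
  · intro g m
    obtain ⟨p, rfl⟩ := E.surjective m
    rw [hE.act, hT', hT', hE.act, h1]
  · intro m
    obtain ⟨p, rfl⟩ := E.surjective m
    rw [hE.act_x, hT', hT', hE.act_x, h2]

include hE hρ in
-- On the first summand the components of `T` are a complex linear map commuting with `G`, so a
-- scalar, and an antilinear map into the second summand, where `g` acts by `ρ(x⁻¹ g x)`. Composing
-- the latter with `ρ(x²)` changes this into the twist by `x`.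
theorem exists_smul_of_mem_endAlgebra (T : R.endAlgebra) :
    ∃ (c : ℂ) (A : V →ₛₗ[starRingEnd ℂ] V), IsAntiIntertwining ρ (MulAut.conjNormal x) A ∧
      ∀ v, (T : Module.End ℂ M) (E (v, 0)) = E (c • v, ρ (sqElem hG x)⁻¹ (A v)) := by
  let B : V →ₗ[ℝ] V × V := E.symm.toLinearMap ∘ₗ (T : Module.End ℂ M).restrictScalars ℝ ∘ₗ
    E.toLinearMap ∘ₗ LinearMap.inl ℝ V V
  have hB : ∀ v, E (B v) = (T : Module.End ℂ M) (E (v, 0)) := fun v => E.apply_symm_apply _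
  have hBI : ∀ v, B (Complex.I • v) = (Complex.I • (B v).1, -(Complex.I • (B v).2)) := by
    intro v
    apply E.injective
    have h1 : E (Complex.I • v, 0) = Complex.I • E (v, 0) := by
      rw [hE.smul, smul_zero]
    rw [hB, h1, map_smul, ← hB, hE.smul, Complex.conj_I, neg_smul]
  have hBg : ∀ (g : G) v, B (ρ g v) =
      (ρ g (B v).1, ρ ((MulAut.conjNormal x).symm g) (B v).2) := by
    intro g v
    apply E.injective
    have h1 : E (ρ g v, 0) = R.act g (E (v, 0)) := by rw [hE.act, map_zero]
    rw [hB, h1, T.2, ← hB, hE.act]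
  let L : V →ₗ[ℂ] V := complexLinear (LinearMap.fst ℝ V V ∘ₗ B) (fun v => by simp [hBI])
  let A : V →ₛₗ[starRingEnd ℂ] V := antilinear (LinearMap.snd ℝ V V ∘ₗ B) (fun v => by simp [hBI])
  have hL : ∀ v, L v = (B v).1 := fun v => rfl
  have hA : ∀ v, A v = (B v).2 := fun v => rfl
  obtain ⟨c, hc⟩ := exists_scalar ρ hρ L (fun g v => by rw [hL, hL, hBg])
  refine ⟨c, (ρ (sqElem hG x)).comp A, fun g v => ?_, fun v => ?_⟩
  · obtain ⟨h, rfl⟩ := (MulAut.conjNormal x).surjective g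
    rw [LinearMap.comp_apply, LinearMap.comp_apply, hA, hA, hBg, MulEquiv.symm_apply_apply,
      conjNormal_conjNormal hG]
    simp [map_mul]
  · rw [← hB]
    congr 1
    refine Prod.ext ?_ ?_
    · rw [← hL, hc]; rfl
    · simp only [LinearMap.comp_apply, rho_inv_apply, hA]

include hE in
theorem endAlgebra_ext {T T' : R.endAlgebra}
    (h : ∀ v, (T : Module.End ℂ M) (E (v, 0)) = (T' : Module.End ℂ M) (E (v, 0))) : T = T' := by
  ext m
  obtain ⟨p, rfl⟩ := E.surjective m
  have : E p = E (p.1, 0) + R.act x (E (p.2, 0)) := by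
    rw [hE.act_x, ← map_add]; simp
  rw [this, map_add, map_add, h, T.2, T'.2, h]

theorem smul_eq_re_add_im {W : Type*} [AddCommGroup W] [Module ℂ W] (c : ℂ) (v : W) :
    c • v = c.re • v + c.im • (Complex.I • v) := by
  conv_lhs => rw [← Complex.re_add_im c]
  rw [add_smul, mul_smul]; rfl

include hE in
-- Scalar multiplication by `i` on `M` is `i` on the first coordinate and `-i` on the second, and
-- anticommutes with `x`. The coordinatewise `i` is the one that commutes with all of `Γ`.
theorem exists_I_mem_endAlgebra :
    ∃ I : R.endAlgebra, ∀ p, (I : Module.End ℂ M) (E p) = E (Complex.I • p.1, Complex.I • p.2) := by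
  let I' : V →ₗ[ℝ] V := (LinearMap.lsmul ℂ V Complex.I).restrictScalars ℝ
  refine exists_mem_endAlgebra hE (I'.prodMap I') ?_ ?_ ?_
  · intro p
    exact Prod.ext rfl (smul_neg _ _)
  · intro g p
    exact Prod.ext (map_smul (ρ g) Complex.I p.1).symm (map_smul (ρ _) Complex.I p.2).symm
  · intro p
    exact Prod.ext (map_smul (ρ (sqElem hG x)) Complex.I p.2).symm rfl

include hE hρ hR in
theorem end_complex_of_isInducedBy
    (hJ : ∀ J : V →ₛₗ[starRingEnd ℂ] V, IsAntiIntertwining ρ (MulAut.conjNormal x) J → J = 0) :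
    Nonempty (R.endAlgebra ≃ₐ[ℝ] ℂ) := by
  have := endAlgebra_nontrivial hR
  obtain ⟨I, hI⟩ := exists_I_mem_endAlgebra hE
  refine nonempty_algEquiv_complex I ?_ fun T => ?_
  · apply endAlgebra_ext hE
    intro v
    change (I : Module.End ℂ M) ((I : Module.End ℂ M) (E (v, 0))) = (-1 : ℝ) • E (v, 0)
    rw [hI, hI, ← map_smul]
    simp [I_smul_I_smul]
  · obtain ⟨c, A, hA, h⟩ := exists_smul_of_mem_endAlgebra hE hρ T
    refine ⟨c.re, c.im, endAlgebra_ext hE fun v => ?_⟩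
    change _ = c.re • E (v, 0) + c.im • (I : Module.End ℂ M) (E (v, 0))
    rw [h, hJ A hA, hI, ← map_smul, ← map_smul, ← map_add, smul_eq_re_add_im c v]
    simp

include hE hρ hR in
theorem end_quaternion_of_isInducedBy {J₀ : V →ₛₗ[starRingEnd ℂ] V}
    (hJ : IsAntiIntertwining ρ (MulAut.conjNormal x) J₀)
    (hJJ : ∀ v, J₀ (J₀ v) = -ρ (sqElem hG x) v) :
    Nonempty (R.endAlgebra ≃ₐ[ℝ] ℍ[ℝ]) := by
  have := endAlgebra_nontrivial hR
  obtain ⟨I, hI⟩ := exists_I_mem_endAlgebra hE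
  have hJs : ∀ v, J₀ (ρ (sqElem hG x) v) = ρ (sqElem hG x) (J₀ v) := fun v => by
    rw [hJ, conjNormal_sqElem hG]
  have hJs' : ∀ v, J₀ (ρ (sqElem hG x)⁻¹ v) = ρ (sqElem hG x)⁻¹ (J₀ v) := fun v => by
    rw [hJ, map_inv, conjNormal_sqElem hG]
  let S : V →ₗ[ℝ] V := (ρ (sqElem hG x)⁻¹).restrictScalars ℝ
  have hS : ∀ v, S v = ρ (sqElem hG x)⁻¹ v := fun _ => rfl
  -- Interchanging the summands through `J₀` gives the second quaternion unit: the square is `J₀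
  -- ρ(x²)⁻¹ J₀ = ρ(x²)⁻¹ J₀² = -1`.
  let T₀ : V × V →ₗ[ℝ] V × V := (antilinearReal J₀ ∘ₗ LinearMap.snd ℝ V V).prod
    (S ∘ₗ antilinearReal J₀ ∘ₗ LinearMap.fst ℝ V V)
  have hT₀ : ∀ p, T₀ p = (J₀ p.2, ρ (sqElem hG x)⁻¹ (J₀ p.1)) := fun p => rfl
  obtain ⟨J, hJ'⟩ := exists_mem_endAlgebra hE T₀ (by
    intro p
    rw [hT₀, hT₀]
    simp) (by
    intro g p
    rw [hT₀, hT₀, hJ, hJ, MulEquiv.apply_symm_apply, rho_symm_apply]) (by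
    intro p
    rw [hT₀, hT₀, hJs, rho_inv_apply, rho_apply_inv])
  have hJe : ∀ p, (J : Module.End ℂ M) (E p) = E (J₀ p.2, ρ (sqElem hG x)⁻¹ (J₀ p.1)) := hJ'
  refine nonempty_algEquiv_quaternion I J ?_ ?_ ?_ fun T => ?_
  · apply endAlgebra_ext hE
    intro v
    change (I : Module.End ℂ M) ((I : Module.End ℂ M) (E (v, 0))) = (-1 : ℝ) • E (v, 0)
    rw [hI, hI, ← map_smul]
    simp [I_smul_I_smul]
  · apply endAlgebra_ext hE
    intro v
    change (J : Module.End ℂ M) ((J : Module.End ℂ M) (E (v, 0))) = (-1 : ℝ) • E (v, 0)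
    rw [hJe, hJe, ← map_smul]
    simp [hJs', hJJ]
  · apply endAlgebra_ext hE
    intro v
    change (J : Module.End ℂ M) ((I : Module.End ℂ M) (E (v, 0))) =
      (-1 : ℝ) • (I : Module.End ℂ M) ((J : Module.End ℂ M) (E (v, 0)))
    rw [hI, hJe, hJe, hI, ← map_smul]
    simp
  · obtain ⟨c, A, hA, h⟩ := exists_smul_of_mem_endAlgebra hE hρ T
    obtain ⟨b, hb⟩ := exists_eq_smul_of_isAntiIntertwining hρ (conjNormal_conjNormal hG x)
      (conjNormal_sqElem hG x) hJ hA (neg_ne_zero.2 one_ne_zero) (by simpa using hJJ)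
    refine ⟨c.re, c.im, b.re, b.im, endAlgebra_ext hE fun v => ?_⟩
    change _ = c.re • E (v, 0) + c.im • (I : Module.End ℂ M) (E (v, 0)) +
      b.re • (J : Module.End ℂ M) (E (v, 0)) +
      b.im • (I : Module.End ℂ M) ((J : Module.End ℂ M) (E (v, 0)))
    have hρb : ρ (sqElem hG x)⁻¹ (b • J₀ v) = b • ρ (sqElem hG x)⁻¹ (J₀ v) := map_smul _ _ _
    rw [h, hb, hρb, hJe, hI, hI, ← map_smul E, ← map_smul E, ← map_smul E, ← map_smul E,
      ← map_add E, ← map_add E, ← map_add E, smul_eq_re_add_im c v, smul_eq_re_add_im b]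
    simp

end

/-- The complex conjugate of a complex vector space. -/
def ConjSpace (V : Type u) : Type u := V

section

variable (V : Type u) [AddCommGroup V] [Module ℂ V]

instance : AddCommGroup (ConjSpace V) := inferInstanceAs (AddCommGroup V)

instance : Module ℂ (ConjSpace V) := Module.compHom V (starRingEnd ℂ)

/-- The identity, as an antilinear map to the conjugate space. -/
def toConjSpace : V →ₛₗ[starRingEnd ℂ] ConjSpace V where
  toFun v := v
  map_add' _ _ := rfl
  map_smul' c v := by
    change c • v = conj (conj c) • v
    rw [Complex.conj_conj]

/-- The identity, as an antilinear map from the conjugate space. -/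
def ofConjSpace : ConjSpace V →ₛₗ[starRingEnd ℂ] V where
  toFun v := v
  map_add' _ _ := rfl
  map_smul' _ _ := rfl

variable {V}

@[simp] theorem of_toConjSpace (v : V) : ofConjSpace V (toConjSpace V v) = v := rfl

@[simp] theorem to_ofConjSpace (v : ConjSpace V) : toConjSpace V (ofConjSpace V v) = v := rfl

instance [FiniteDimensional ℂ V] : FiniteDimensional ℂ (ConjSpace V) :=
  Module.Finite.of_surjective (toConjSpace V) fun v => ⟨ofConjSpace V v, rfl⟩

end

/-! ### Existence of the simple Real representation: induction from `G` -/

section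

variable {Γ : Type u} [Group Γ] {G : Subgroup Γ} {V : Type u} [AddCommGroup V] [Module ℂ V]

open Classical in
/-- A representation of a subgroup, extended by zero. -/
def extendZero (ρ : Representation ℂ G V) (γ : Γ) : V →ₗ[ℂ] V :=
  if h : γ ∈ G then ρ ⟨γ, h⟩ else 0

theorem extendZero_of_notMem (ρ : Representation ℂ G V) {γ : Γ} (h : γ ∉ G) :
    extendZero ρ γ = 0 := dif_neg h

theorem extendZero_of_mem (ρ : Representation ℂ G V) {γ : Γ} (h : γ ∈ G) :
    extendZero ρ γ = ρ ⟨γ, h⟩ := dif_pos h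

/-- Multiplicativity of the block matrices of an induced representation for the coset
representatives `1` and `x`; at most one of the two terms is nonzero. -/
theorem extendZero_mul (hG : G.index = 2) {x : Γ} (hx : x ∉ G) (ρ : Representation ℂ G V)
    (a b : Γ) (v : V) : extendZero ρ (a * b) v =
      extendZero ρ a (extendZero ρ b v) + extendZero ρ (a * x) (extendZero ρ (x⁻¹ * b) v) := by
  have hmul : ∀ c d : Γ, c * d ∈ G ↔ (c ∈ G ↔ d ∈ G) :=
    fun _ _ => Subgroup.mul_mem_iff_of_index_two hG
  by_cases ha : a ∈ G
  · rw [extendZero_of_notMem ρ (γ := a * x) (by simp [hmul, ha, hx])]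
    by_cases hb : b ∈ G
    · rw [extendZero_of_mem ρ ha, extendZero_of_mem ρ hb, extendZero_of_mem ρ (mul_mem ha hb),
        ← Module.End.mul_apply (ρ _), ← map_mul]
      simp
    · rw [extendZero_of_notMem ρ hb, extendZero_of_notMem ρ (γ := a * b) (by simp [hmul, ha, hb])]
      simp
  · rw [extendZero_of_notMem ρ ha]
    by_cases hb : b ∈ G
    · rw [extendZero_of_notMem ρ (γ := a * b) (by simp [hmul, ha, hb]),
        extendZero_of_notMem ρ (γ := x⁻¹ * b) (by simp [hmul, hx, hb])]
      simp
    · have h1 : a * x ∈ G := by simp [hmul, ha, hx]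
      have h2 : x⁻¹ * b ∈ G := by simp [hmul, hx, hb]
      rw [extendZero_of_mem ρ (γ := a * b) (by simp [hmul, ha, hb]), extendZero_of_mem ρ h1,
        extendZero_of_mem ρ h2, ← Module.End.mul_apply (ρ _), ← map_mul, LinearMap.zero_apply,
        zero_add]
      congr 2
      ext
      simp

theorem extendZero_one (ρ : Representation ℂ G V) (v : V) : extendZero ρ 1 v = v := by
  rw [extendZero_of_mem ρ G.one_mem]
  have : (⟨1, G.one_mem⟩ : G) = 1 := rfl
  rw [this, map_one]; rfl

/-- The Real representation induced by a representation of `G`. -/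
def inducedRealRep (hG : G.index = 2) {x : Γ} (hx : x ∉ G) (ρ : Representation ℂ G V) :
    RealRep G (V × ConjSpace V) where
  act :=
    { toFun := fun γ =>
        -- Diagonal blocks vanish for `γ ∉ G` and off-diagonal ones for `γ ∈ G`. The off-diagonal
        -- blocks pass between `V` and its conjugate space, so elements outside `G` act
        -- antilinearly.
        { toFun := fun p => (extendZero ρ γ p.1 + extendZero ρ (γ * x) (ofConjSpace V p.2),
            toConjSpace V (extendZero ρ (x⁻¹ * γ) p.1 +
              extendZero ρ (x⁻¹ * γ * x) (ofConjSpace V p.2)))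
          map_add' := fun p q => by
            refine Prod.ext ?_ ?_
            · simp; abel
            · simp; abel
          map_smul' := fun r p => by
            refine Prod.ext ?_ ?_
            · change extendZero ρ γ ((r : ℂ) • p.1) +
                extendZero ρ (γ * x) (ofConjSpace V ((r : ℂ) • p.2)) = (r : ℂ) • (_ + _)
              rw [map_smul, map_smulₛₗ, map_smul, Complex.conj_ofReal, smul_add]
            · change toConjSpace V (extendZero ρ (x⁻¹ * γ) ((r : ℂ) • p.1) +
                extendZero ρ (x⁻¹ * γ * x) (ofConjSpace V ((r : ℂ) • p.2))) =
                  (r : ℂ) • toConjSpace V _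
              rw [map_smul, map_smulₛₗ, map_smul, Complex.conj_ofReal, ← smul_add, map_smulₛₗ,
                Complex.conj_ofReal] }
      map_one' := by
        refine LinearMap.ext fun p => ?_
        refine Prod.ext ?_ ?_
        · simp [extendZero_one, extendZero_of_notMem ρ hx]
        · have hx' : x⁻¹ ∉ G := by simpa using hx
          simp [extendZero_one, extendZero_of_notMem ρ hx']
      map_mul' := fun a b => by
        refine LinearMap.ext fun p => ?_
        refine Prod.ext ?_ ?_
        · simp only [LinearMap.coe_mk, AddHom.coe_mk, Module.End.mul_apply, of_toConjSpace,
            map_add]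
          rw [extendZero_mul hG hx ρ a b, mul_assoc a b x, extendZero_mul hG hx ρ a (b * x),
            mul_assoc x⁻¹ b x]
          abel
        · simp only [LinearMap.coe_mk, AddHom.coe_mk, Module.End.mul_apply, of_toConjSpace,
            map_add]
          rw [← mul_assoc x⁻¹ a b, extendZero_mul hG hx ρ (x⁻¹ * a) b, mul_assoc (x⁻¹ * a) b x,
            extendZero_mul hG hx ρ (x⁻¹ * a) (b * x), mul_assoc x⁻¹ b x]
          simp only [map_add]
          abel }
  act_smul_of_mem g hg c p := by
    have h1 : g * x ∉ G := by
      rw [Subgroup.mul_mem_iff_of_index_two hG]; simp [hg, hx]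
    have h2 : x⁻¹ * g ∉ G := by
      rw [Subgroup.mul_mem_iff_of_index_two hG]; simp [hg, hx]
    refine Prod.ext ?_ ?_
    · simp [extendZero_of_notMem ρ h1]
    · simp [extendZero_of_notMem ρ h2]
  act_smul_of_notMem g hg c p := by
    have h2 : x⁻¹ * g * x ∉ G := by
      rw [Subgroup.mul_mem_iff_of_index_two hG, Subgroup.mul_mem_iff_of_index_two hG]
      simp [hg, hx]
    refine Prod.ext ?_ ?_
    · simp [extendZero_of_notMem ρ hg]
    · simp [extendZero_of_notMem ρ h2]

/-- The restriction of a Real representation to a stable subspace. -/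
def RealRep.restrict {M : Type u} [AddCommGroup M] [Module ℂ M] (R : RealRep G M)
    (W : Submodule ℂ M) (hW : ∀ γ, ∀ w ∈ W, R.act γ w ∈ W) : RealRep G W where
  act :=
    { toFun := fun γ =>
        { toFun := fun w => ⟨R.act γ w, hW γ w w.2⟩
          map_add' := fun a b => Subtype.ext (map_add (R.act γ) _ _)
          map_smul' := fun r a => Subtype.ext (map_smul (R.act γ) r (a : M)) }
      map_one' := by ext; simp
      map_mul' := fun a b => by ext; simp }
  act_smul_of_mem g hg c m := Subtype.ext (R.act_smul_of_mem g hg c m)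
  act_smul_of_notMem g hg c m := Subtype.ext (R.act_smul_of_notMem g hg c m)

theorem exists_irreducible_restrict {M : Type u} [AddCommGroup M] [Module ℂ M]
    [FiniteDimensional ℂ M] [Nontrivial M] (R : RealRep G M) :
    ∃ (W : Submodule ℂ M) (hW : ∀ γ, ∀ w ∈ W, R.act γ w ∈ W),
      (RealRep.restrict R W hW).IsIrreducible := by
  classical
  have hex : ∃ n, ∃ W : Submodule ℂ M, (∀ γ, ∀ w ∈ W, R.act γ w ∈ W) ∧ W ≠ ⊥ ∧
      Module.finrank ℂ W = n := ⟨_, ⊤, fun _ _ _ => Submodule.mem_top, top_ne_bot, rfl⟩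
  obtain ⟨W, hW, hW0, hWn⟩ := Nat.find_spec hex
  refine ⟨W, hW, Submodule.nontrivial_iff_ne_bot.2 hW0, fun X hX => ?_⟩
  by_cases hX0 : X = ⊥
  · exact Or.inl hX0
  right
  have hmin := Nat.find_min' hex ⟨X.map W.subtype, ?_, ?_, rfl⟩
  · rw [← hWn] at hmin
    apply Submodule.eq_top_of_finrank_eq
    refine le_antisymm (Submodule.finrank_le X) (hmin.trans ?_)
    exact Submodule.finrank_map_le _ _
  · rintro h _ ⟨x, hx, rfl⟩
    exact ⟨_, hX h x hx, rfl⟩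
  · exact fun h => hX0 (Submodule.map_injective_of_injective (Submodule.subtype_injective _)
      (h.trans (Submodule.map_bot _).symm))

/-- The restriction of a Real representation to a complex representation of `G`. -/
def RealRep.toRepresentation {M : Type u} [AddCommGroup M] [Module ℂ M] (R : RealRep G M) :
    Representation ℂ G M where
  toFun g :=
    { toFun := R.act g
      map_add' := map_add _
      map_smul' := fun c m => R.act_smul_of_mem g g.2 c m }
  map_one' := by ext; simp
  map_mul' a b := by ext; simp

/-- The character formula for the dimension of the space of intertwining maps is symmetric under `g
↦ g⁻¹`. -/
theorem exists_intertwiningMap_ne_zero_symm {H V W : Type*} [Group H] [Finite H]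
    [AddCommGroup V] [Module ℂ V] [FiniteDimensional ℂ V] [AddCommGroup W] [Module ℂ W]
    [FiniteDimensional ℂ W] {ρ : Representation ℂ H V} {σ : Representation ℂ H W}
    (f : IntertwiningMap ρ σ) (hf : f ≠ 0) : ∃ f' : IntertwiningMap σ ρ, f' ≠ 0 := by
  have := Fintype.ofFinite H
  have : Invertible (Nat.card H : ℂ) := invertibleOfNonzero (natCard_ne_zero H)
  have h1 := card_inv_mul_sum_char_mul_char_eq_finrank ρ σ
  have h2 := card_inv_mul_sum_char_mul_char_eq_finrank σ ρ
  have h3 : Module.finrank ℂ (IntertwiningMap ρ σ) = Module.finrank ℂ (IntertwiningMap σ ρ) := by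
    have : (Module.finrank ℂ (IntertwiningMap ρ σ) : ℂ) =
        Module.finrank ℂ (IntertwiningMap σ ρ) := by
      rw [← h1, ← h2]
      congr 1
      rw [← Equiv.sum_comp (Equiv.inv H)]
      exact Finset.sum_congr rfl fun g _ => by simp [mul_comm]
    exact_mod_cast this
  by_contra! h
  have hs : Subsingleton (IntertwiningMap σ ρ) := ⟨fun a b => by rw [h a, h b]⟩
  rw [Module.finrank_zero_of_subsingleton (M := IntertwiningMap σ ρ)] at h3
  have hfin : FiniteDimensional ℂ (IntertwiningMap ρ σ) :=
    Module.Finite.of_injective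
      (⟨⟨fun g => g.toLinearMap, fun _ _ => rfl⟩, fun _ _ => rfl⟩ :
        IntertwiningMap ρ σ →ₗ[ℂ] (V →ₗ[ℂ] W)) (IntertwiningMap.toLinearMap_injective ρ σ)
  have : Subsingleton (IntertwiningMap ρ σ) := Module.finrank_zero_iff.1 h3
  exact hf (Subsingleton.elim _ _)

/-- In a simple constituent `W` of the induced representation, the first projection to `V` is
nonzero because `x⁻¹` moves the second coordinate to the first. A nonzero map from `W` to `V` yields
one from `V` to `W`. -/
theorem exists_irreducible_realRep [Finite Γ] [FiniteDimensional ℂ V] (hG : G.index = 2)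
    (ρ : Representation ℂ G V) (hρ : ρ.IsIrreducible) :
    ∃ (M : Type u) (_ : AddCommGroup M) (_ : Module ℂ M) (R : RealRep G M), R.IsIrreducible ∧
      ∃ f : V →ₗ[ℂ] M, f ≠ 0 ∧ ∀ (g : G) (v : V), f (ρ g v) = R.act (g : Γ) (f v) := by
  obtain ⟨x, hx⟩ := exists_notMem_of_index_two hG
  have hV := ((isIrreducible_iff ρ).1 hρ).1
  obtain ⟨W, hW, hirr⟩ := exists_irreducible_restrict (inducedRealRep hG hx ρ)
  refine ⟨W, _, _, RealRep.restrict _ W hW, hirr, ?_⟩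
  have hact : ∀ (γ : Γ) (w : W), (((RealRep.restrict (inducedRealRep hG hx ρ) W hW).act γ w : W) :
      V × ConjSpace V) = (extendZero ρ γ w.1.1 + extendZero ρ (γ * x) (ofConjSpace V w.1.2),
            toConjSpace V (extendZero ρ (x⁻¹ * γ) w.1.1 +
              extendZero ρ (x⁻¹ * γ * x) (ofConjSpace V w.1.2))) := fun _ _ => rfl
  let p : IntertwiningMap (RealRep.toRepresentation (RealRep.restrict (inducedRealRep hG hx ρ) W hW)) ρ :=
    ⟨LinearMap.fst ℂ V (ConjSpace V) ∘ₗ W.subtype, fun g => by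
      ext w
      have h1 : (g : Γ) * x ∉ G := by
        rw [Subgroup.mul_mem_iff_of_index_two hG]; simp [hx]
      change ((((RealRep.restrict (inducedRealRep hG hx ρ) W hW).act g w : W) :
        V × ConjSpace V)).1 = ρ g w.1.1
      rw [hact, extendZero_of_notMem ρ h1, extendZero_of_mem ρ g.2]
      simp⟩
  have hp : p ≠ 0 := by
    intro h
    have hp0 : ∀ w : W, w.1.1 = 0 := fun w =>
      congrArg (fun q : IntertwiningMap (RealRep.toRepresentation (RealRep.restrict (inducedRealRep hG hx ρ) W hW)) ρ => q w) h
    have := hirr.1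
    obtain ⟨w, hw⟩ := exists_ne (0 : W)
    apply hw
    ext
    · exact hp0 w
    · have h2 := hp0 ((RealRep.restrict (inducedRealRep hG hx ρ) W hW).act x⁻¹ w)
      rw [hact] at h2
      have h3 : ofConjSpace V w.1.2 = 0 := by simpa [hp0, extendZero_one] using h2
      exact h3
  obtain ⟨f, hf⟩ := exists_intertwiningMap_ne_zero_symm p hp
  refine ⟨f.toLinearMap, fun h => hf (IntertwiningMap.toLinearMap_injective _ _ h), fun g v => ?_⟩
  exact f.isIntertwining _ _ g v

end

/-! ### The indicator `F♯` and the endomorphism algebra of the simple Real representation -/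

section

variable {Γ : Type u} [Group Γ] {G : Subgroup Γ} [G.Normal] [Fintype G]

/-- In contrast to the real case, `f` surjective is the case of `ℝ`: the action of `x` is then a `J`
of positive sign. In the induced case such a `J` would split `M`, and what remains is `ℍ` or `ℂ`. -/
theorem antilinearEnd_matchesIndicator (hG : G.index = 2) {x : Γ} (hx : x ∉ G) {M : Type u}
    [AddCommGroup M] [Module ℂ M] {R : RealRep G M} {V : Type u} [AddCommGroup V] [Module ℂ V]
    [FiniteDimensional ℂ V] {ρ : Representation ℂ G V} (hρ : ρ.IsIrreducible)
    (hR : R.IsIrreducible) (f : V →ₗ[ℂ] M) (hf : ∀ (g : G) v, f (ρ g v) = R.act g (f v))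
    (hf0 : f ≠ 0) :
    MatchesIndicator (twistedIndicator (MulAut.conjNormal x) (sqElem hG x) ρ.character)
      R.endAlgebra := by
  have hV := ((isIrreducible_iff ρ).1 hρ).1
  have tri := twistedIndicator_trichotomy ρ hρ (MulAut.conjNormal x)
    (conjNormal_conjNormal hG x) (conjNormal_sqElem hG x)
  rcases surjective_or_bijective_sum hG hx hρ hR f hf hf0 with hs | hb
  · obtain ⟨hend, J', hJ', hJJ'⟩ := end_real_of_surjective hG hx hρ hR f hf hf0 hs
    rcases tri with ⟨ε, rfl | rfl, hF, -, J, hJ, hJJ⟩ | ⟨hF, -, hJ⟩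
    · exact Or.inl ⟨hF, hend⟩
    · exact (not_isAntiIntertwining_of_sign hρ (conjNormal_conjNormal hG x)
        (conjNormal_sqElem hG x) hJ' hJJ' hJ (by simpa using hJJ)).elim
    · obtain ⟨v, hv⟩ := exists_ne (0 : V)
      have h1 := hJJ' v
      rw [hJ J' hJ'] at h1
      exact (hv (by rw [← rho_inv_apply (ρ := ρ) (sqElem hG x) v, ← h1]; simp)).elim
  · obtain ⟨E, hE⟩ := exists_isInducedBy hG hx f hf hb
    rcases tri with ⟨ε, rfl | rfl, hF, -, J, hJ, hJJ⟩ | ⟨hF, -, hJ⟩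
    · exact (not_exists_conj_of_isInducedBy hE hρ hR hJ (by simpa using hJJ)).elim
    · exact Or.inr (Or.inr ⟨hF, end_quaternion_of_isInducedBy hE hρ hR hJ (by simpa using hJJ)⟩)
    · exact Or.inr (Or.inl ⟨hF, end_complex_of_isInducedBy hE hρ hR hJ⟩)

variable [Finite Γ] {χ : G → ℂ}

theorem hasAntilinearEnd_iff (hG : G.index = 2) (hχ : χ ∈ irrChars G) (A : Type) [Semiring A]
    [Algebra ℝ A] (F₀ : ℂ)
    (hA : ∀ (F : ℂ) (E : Type u) [Semiring E] [Algebra ℝ E], MatchesIndicator F E →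
      (Nonempty (E ≃ₐ[ℝ] A) ↔ F = F₀)) :
    HasAntilinearEnd G χ A ↔ sharpIndicator G χ = F₀ := by
  obtain ⟨x, hx⟩ := exists_notMem_of_index_two hG
  rw [sharpIndicator_eq hG hx]
  constructor
  · rintro ⟨V, _, _, _, ρ, M, _, _, R, hρ, rfl, hR, ⟨f, hf0, hf⟩, hE⟩
    exact (hA _ _ (antilinearEnd_matchesIndicator hG hx hρ hR f hf hf0)).1 hE
  · intro hF
    obtain ⟨V, _, _, _, ρ, hρ, rfl⟩ := hχ
    obtain ⟨M, _, _, R, hR, f, hf0, hf⟩ := exists_irreducible_realRep hG ρ hρ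
    exact ⟨V, _, _, ‹_›, ρ, M, _, _, R, hρ, rfl, hR, ⟨f, hf0, hf⟩,
      (hA _ _ (antilinearEnd_matchesIndicator hG hx hρ hR f hf hf0)).2 hF⟩

variable (hG : G.index = 2) (hχ : χ ∈ irrChars G)

include hG hχ

theorem hasAntilinearEnd_real_iff : HasAntilinearEnd G χ ℝ ↔ sharpIndicator G χ = 1 :=
  hasAntilinearEnd_iff hG hχ ℝ 1 fun _ _ _ _ h => h.real_iff

theorem hasAntilinearEnd_complex_iff : HasAntilinearEnd G χ ℂ ↔ sharpIndicator G χ = 0 :=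
  hasAntilinearEnd_iff hG hχ ℂ 0 fun _ _ _ _ h => h.complex_iff

theorem hasAntilinearEnd_quaternion_iff : HasAntilinearEnd G χ ℍ[ℝ] ↔ sharpIndicator G χ = -1 :=
  hasAntilinearEnd_iff hG hχ ℍ[ℝ] (-1) fun _ _ _ _ h => h.quaternion_iff

end

/-! ### Numbers of solutions of equations as sums over irreducible characters -/

section

variable {H : Type u} [Group H] [Fintype H] {X : Type*} [Fintype X]

/-- The values of `w` are permuted by conjugation, so `∑ ρ(w x)` commutes with `ρ` and is a scalar.
-/
theorem sum_irrChars_mul {χ : H → ℂ} (hχ : χ ∈ irrChars H) (w : X → H)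
    (hw : ∀ h : H, ∃ e : X ≃ X, ∀ x, w (e x) = h * w x * h⁻¹) (h : H) :
    ∑ x, χ (h * w x) = (∑ x, χ (w x)) / χ 1 * χ h := by
  obtain ⟨V, _, _, _, ρ, hρ, rfl⟩ := hχ
  have h1 := finrank_smul_eq_trace_smul ρ hρ (∑ x, ρ (w x)) fun h => by
    obtain ⟨e, he⟩ := hw h
    refine LinearMap.congr_fun (?_ : (∑ x, ρ (w x)) * ρ h = ρ h * ∑ x, ρ (w x))
    rw [Finset.mul_sum, Finset.sum_mul, ← Equiv.sum_comp e]
    refine Finset.sum_congr rfl fun x _ => ?_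
    rw [he, ← map_mul, ← map_mul, inv_mul_cancel_right]
  have h2 := congrArg (fun T => LinearMap.trace ℂ V (ρ h * T)) h1
  simp only [map_sum, mul_smul_comm, Finset.mul_sum, ← map_mul, map_smul] at h2
  rw [char_one]
  exact h2

omit [Fintype H] in
theorem sum_irrChars_mul_prod {χ : H → ℂ} (w : X → H) (c : ℂ)
    (hc : ∀ h, ∑ x, χ (h * w x) = c * χ h) (m : ℕ) (h : H) :
    ∑ p : Fin m → X, χ (h * (List.ofFn fun i => w (p i)).prod) = c ^ m * χ h := by
  induction m generalizing h with
  | zero => simp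
  | succ m ih =>
    rw [← (Fin.consEquiv fun _ => X).sum_comp, Fintype.sum_prod_type]
    simp only [Fin.consEquiv_apply, List.ofFn_succ, Fin.cons_zero, Fin.cons_succ, List.prod_cons,
      ← mul_assoc, ih]
    rw [← Finset.mul_sum, hc, pow_succ, mul_assoc]

/-- Each factor of the product contributes the scalar `c χ`, and the regular character detects the
products that equal `1`. -/
theorem card_prod_eq_one (w : X → H) (c : (H → ℂ) → ℂ)
    (hc : ∀ χ ∈ irrChars H, ∀ h, ∑ x, χ (h * w x) = c χ * χ h) (m : ℕ) :
    (Nat.card {p : Fin m → X // (List.ofFn fun i => w (p i)).prod = 1} : ℂ) =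
      (Nat.card H : ℂ)⁻¹ * ∑ χ ∈ irr H, χ 1 ^ 2 * c χ ^ m := by
  classical
  have h1 : ∀ χ ∈ irr H, χ 1 ^ 2 * c χ ^ m =
      ∑ p : Fin m → X, χ 1 * χ (List.ofFn fun i => w (p i)).prod := fun χ hχ => by
    have := sum_irrChars_mul_prod w (c χ) (hc χ (mem_irr.1 hχ)) m 1
    simp only [one_mul] at this
    rw [← Finset.mul_sum, this]
    ring
  rw [Finset.sum_congr rfl h1, Finset.sum_comm]
  simp only [sum_irr_apply_one_mul]
  rw [Finset.sum_ite, Finset.sum_const_zero, add_zero, Finset.sum_const, nsmul_eq_mul,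
    mul_comm, mul_assoc, mul_inv_cancel₀ (natCard_ne_zero H), mul_one, Nat.card_eq_fintype_card,
    Fintype.card_subtype]

theorem sum_irrChars_mul_sq {χ : H → ℂ} (hχ : χ ∈ irrChars H) (h : H) :
    ∑ y, χ (h * y ^ 2) =
      Nat.card H * (twistedIndicator (MulEquiv.refl H) 1 χ / χ 1) * χ h := by
  rw [sum_irrChars_mul hχ (fun y => y ^ 2)
    fun h => ⟨(MulAut.conj h).toEquiv, fun y => by simp [sq]⟩,
    twistedIndicator, ← mul_div_assoc, mul_inv_cancel_left₀ (natCard_ne_zero H)]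
  simp [sq]

theorem squareCount_eq (m : ℕ) : (squareCount H m : ℂ) = (Nat.card H : ℂ)⁻¹ *
    ∑ χ ∈ irr H, χ 1 ^ 2 *
      (Nat.card H * (twistedIndicator (MulEquiv.refl H) 1 χ / χ 1)) ^ m :=
  card_prod_eq_one (fun y : H => y ^ 2) _ (fun _ hχ => sum_irrChars_mul_sq hχ) m

end

section

variable {Γ : Type u} [Group Γ] [Finite Γ] {G : Subgroup Γ} (hG : G.index = 2)

include hG

theorem sum_irrChars_mul_sharp_sq [Fintype G] [Fintype {x : Γ // x ∉ G}] [G.Normal] {χ : G → ℂ}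
    (hχ : χ ∈ irrChars G) (h : G) :
    ∑ x : {x : Γ // x ∉ G}, χ (h * ⟨x.1 ^ 2, Subgroup.sq_mem_of_index_two hG x.1⟩) =
      Nat.card G * (sharpIndicator G χ / χ 1) * χ h := by
  rw [sum_irrChars_mul hχ (fun x : {x : Γ // x ∉ G} => (⟨x.1 ^ 2, _⟩ : G)) _, sharpIndicator,
    ← mul_div_assoc, mul_inv_cancel_left₀ (natCard_ne_zero G), finsum_eq_sum_of_fintype]
  · congr 2
    exact Finset.sum_congr rfl fun x _ => by rw [dif_pos]
  · intro h
    refine ⟨(MulAut.conj (h : Γ)).toEquiv.subtypeEquiv fun x => ?_, fun x => ?_⟩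
    · simp [Subgroup.mul_mem_iff_of_index_two hG]
    · ext
      simp [conj_pow]

theorem vCount_eq [G.Normal] (m : ℕ) : (vCount G m : ℂ) = (Nat.card G : ℂ)⁻¹ *
    ∑ χ ∈ irr G, χ 1 ^ 2 * (Nat.card G * (sharpIndicator G χ / χ 1)) ^ m := by
  classical
  have := Fintype.ofFinite Γ
  rw [← card_prod_eq_one (fun x : {x : Γ // x ∉ G} =>
    (⟨x.1 ^ 2, Subgroup.sq_mem_of_index_two hG x.1⟩ : G)) _
    (fun _ hχ => sum_irrChars_mul_sharp_sq hG hχ) m, vCount]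
  congr 1
  refine Nat.card_congr
    ⟨fun z => ⟨fun i => ⟨z.1 i, z.2.1 i⟩, ?_⟩, fun p => ⟨fun i => p.1 i, fun i => (p.1 i).2, ?_⟩,
      fun _ => rfl, fun _ => rfl⟩
  · apply Subtype.ext
    rw [← Subgroup.coe_subtype, map_list_prod, List.map_ofFn]
    exact z.2.2
  · have := congrArg G.subtype p.2
    rw [map_list_prod, List.map_ofFn] at this
    exact this

theorem wCount_eq [G.Normal] (n : ℕ) : (wCount G n : ℂ) = (Nat.card G : ℂ)⁻¹ *
    ∑ χ ∈ irr G, χ 1 ^ 2 * ((Nat.card G : ℂ) ^ 3 *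
      (indicator G χ ^ 2 * sharpIndicator G χ / χ 1 ^ 3)) ^ n := by
  classical
  have := Fintype.ofFinite Γ
  rw [← card_prod_eq_one (fun p : G × G × {x : Γ // x ∉ G} =>
    p.1 ^ 2 * p.2.1 ^ 2 * (⟨p.2.2.1 ^ 2, Subgroup.sq_mem_of_index_two hG p.2.2.1⟩ : G)) _ _ n,
    wCount]
  · congr 1
    refine Nat.card_congr
      ⟨fun z => ⟨fun i => ⟨⟨_, (z.2.1 i).1⟩, ⟨_, (z.2.1 i).2.1⟩, ⟨_, (z.2.1 i).2.2⟩⟩, ?_⟩,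
        fun p => ⟨fun i => ((p.1 i).1, (p.1 i).2.1, (p.1 i).2.2),
          fun i => ⟨(p.1 i).1.2, (p.1 i).2.1.2, (p.1 i).2.2.2⟩, ?_⟩,
        fun _ => rfl, fun _ => rfl⟩
    · apply Subtype.ext
      rw [← Subgroup.coe_subtype, map_list_prod, List.map_ofFn]
      exact z.2.2
    · have := congrArg G.subtype p.2
      rw [map_list_prod, List.map_ofFn] at this
      exact this
  · intro χ hχ h
    simp only [Fintype.sum_prod_type, ← mul_assoc, sum_irrChars_mul_sharp_sq hG hχ]
    simp only [← Finset.mul_sum, sum_irrChars_mul_sq hχ, indicator_eq]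
    ring

end

/-! ### Power sums -/

open MvPolynomial in
-- Newton's identities give the elementary symmetric functions in characteristic zero, hence the
-- monic polynomial whose roots are the negated values.
theorem map_univ_eq_of_sum_pow_eq {σ : Type*} [Fintype σ] (f g : σ → ℂ)
    (h : ∀ k, 1 ≤ k → k ≤ Fintype.card σ → ∑ i, f i ^ k = ∑ i, g i ^ k) :
    Finset.univ.val.map f = Finset.univ.val.map g := by
  have key : ∀ k, k ≤ Fintype.card σ →
      aeval f (esymm σ ℂ k) = aeval g (esymm σ ℂ k) := by
    intro k
    induction k using Nat.strong_induction_on with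
    | _ k ih =>
      intro hk
      rcases Nat.eq_zero_or_pos k with rfl | hk0
      · simp
      have hf := congrArg (aeval f) (mul_esymm_eq_sum σ ℂ k)
      have hg := congrArg (aeval g) (mul_esymm_eq_sum σ ℂ k)
      have hk' : (k : ℂ) ≠ 0 := by exact_mod_cast hk0.ne'
      apply mul_left_cancel₀ hk'
      rw [map_mul, map_natCast] at hf hg
      rw [hf, hg]
      simp only [map_mul, map_pow, map_neg, map_one, map_sum]
      congr 1
      refine Finset.sum_congr rfl fun a ha => ?_
      obtain ⟨ha1, ha2⟩ := Finset.mem_filter.1 ha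
      have ha3 := Finset.HasAntidiagonal.mem_antidiagonal.1 ha1
      rw [ih a.1 ha2 (by omega)]
      congr 1
      simp only [psum, map_sum, map_pow, aeval_X]
      exact h _ (by omega) (by omega)
  have hp : ((Finset.univ.val.map f).map fun a => Polynomial.X + Polynomial.C a).prod =
      ((Finset.univ.val.map g).map fun a => Polynomial.X + Polynomial.C a).prod := by
    rw [Multiset.prod_X_add_C_eq_sum_esymm, Multiset.prod_X_add_C_eq_sum_esymm]
    simp only [Multiset.card_map, ← aeval_esymm_eq_multiset_esymm σ ℂ]
    refine Finset.sum_congr rfl fun k hk => ?_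
    rw [key k]
    have := Finset.mem_range.1 hk
    simpa [Finset.card_univ] using Nat.lt_succ_iff.1 this
  have hr : ∀ s : Multiset ℂ,
      (s.map fun a => Polynomial.X + Polynomial.C a).prod.roots = s.map Neg.neg := by
    intro s
    rw [← Polynomial.roots_multiset_prod_X_sub_C (s.map Neg.neg), Multiset.map_map]
    simp
  have := congrArg Polynomial.roots hp
  rw [hr, hr] at this
  exact Multiset.map_injective neg_injective this

theorem card_filter_eq_of_sum_pow_eq {α β : Type*} {s : Finset α} {t : Finset β} (f : α → ℂ)
    (g : β → ℂ) (hst : s.card = t.card)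
    (h : ∀ k, 1 ≤ k → k ≤ s.card → ∑ i ∈ s, f i ^ k = ∑ i ∈ t, g i ^ k) (p : ℂ → Prop)
    [DecidablePred p] :
    (s.filter fun i => p (f i)).card = (t.filter fun i => p (g i)).card := by
  let e : s ≃ t := Finset.equivOfCardEq hst
  have h1 := map_univ_eq_of_sum_pow_eq (fun i : s => f i) (fun i : s => g (e i)) fun k hk hk' => by
    rw [Equiv.sum_comp e (fun i => g i ^ k), Finset.sum_coe_sort s (fun i => f i ^ k),
      Finset.sum_coe_sort t (fun i => g i ^ k)]
    exact h k hk (by simpa using hk')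
  have h2 := congrArg (Multiset.countP p) h1
  rw [Finset.card_filter, Finset.card_filter, ← Finset.sum_coe_sort s,
    ← Finset.sum_coe_sort t, ← Equiv.sum_comp e]
  rw [Multiset.countP_map, Multiset.countP_map, ← Finset.filter_val, ← Finset.filter_val,
    Finset.card_val, Finset.card_val, Finset.card_filter, Finset.card_filter] at h2
  exact h2

/-- A polynomial without constant term that takes the value `d⁻²` at `d⁻³` and `0` at `-d⁻³`. -/
theorem exists_coeff_sum_eq (N : ℕ) : ∃ a : ℕ → ℂ, ∀ d : ℕ, 0 < d → d ≤ N → ∀ ε : ℂ,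
    (ε = 1 ∨ ε = 0 ∨ ε = -1) →
      ∑ n ∈ Finset.Icc 1 (2 * N), a n * ((d : ℂ) ^ 2 * (ε / (d : ℂ) ^ 3) ^ n) =
        if ε = 1 then 1 else 0 := by
  -- The nodes are indexed by `-N, …, N`, negative indices standing for `-d⁻³`. Since `0⁻¹ = 0`, the
  -- index `0` gives the node `0` with value `0`, which removes the constant term. The `2N + 1`
  -- nodes bound the degree by `2N`.
  let v : ℤ → ℂ := fun d => ((d : ℂ) ^ 3)⁻¹
  let r : ℤ → ℂ := fun d => if 0 < d then ((d : ℂ) ^ 2)⁻¹ else 0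
  have hv : Function.Injective v := by
    intro a b hab
    have h1 : (a : ℂ) ^ 3 = (b : ℂ) ^ 3 := inv_injective hab
    have h2 : a ^ 3 = b ^ 3 := by exact_mod_cast h1
    exact (Odd.strictMono_pow (by decide : Odd 3)).injective h2
  let s : Finset ℤ := Finset.Icc (-N) N
  let P := Lagrange.interpolate s v r
  have hev : ∀ d ∈ s, P.eval (v d) = r d := fun d hd =>
    Lagrange.eval_interpolate_at_node r hv.injOn hd
  have hP0 : P.coeff 0 = 0 := by
    have := hev 0 (by simp [s])
    simpa [v, r, Polynomial.coeff_zero_eq_eval_zero] using this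
  have hdeg : P.natDegree < 2 * N + 1 := by
    have h1 : s.card - 1 = 2 * N := by simp [s]; omega
    have h2 := Polynomial.natDegree_le_of_degree_le
      (Lagrange.degree_interpolate_le (s := s) (v := v) r hv.injOn)
    exact Nat.lt_succ_of_le (h2.trans_eq h1)
  have hsum : ∀ x, P.eval x = ∑ n ∈ Finset.Icc 1 (2 * N), P.coeff n * x ^ n := by
    intro x
    rw [Polynomial.eval_eq_sum_range' hdeg, Finset.sum_range_succ', hP0, zero_mul, add_zero,
      Finset.range_eq_Ico, Finset.sum_Ico_add' (fun n => P.coeff n * x ^ n) 0 (2 * N) 1]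
    rfl
  refine ⟨P.coeff, fun d hd hdN ε hε => ?_⟩
  have hd' : (d : ℂ) ≠ 0 := by exact_mod_cast hd.ne'
  have h1 : ∑ n ∈ Finset.Icc 1 (2 * N), P.coeff n * ((d : ℂ) ^ 2 * (ε / (d : ℂ) ^ 3) ^ n) =
      (d : ℂ) ^ 2 * P.eval (ε / (d : ℂ) ^ 3) := by
    rw [hsum, Finset.mul_sum]
    exact Finset.sum_congr rfl fun n _ => by ring
  rw [h1]
  rcases hε with rfl | rfl | rfl
  · have := hev d (by simp [s]; omega)
    simp only [v, r, Int.cast_natCast] at this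
    rw [one_div, this, if_pos (by exact_mod_cast hd), if_pos rfl, mul_inv_cancel₀ (by positivity)]
  · rw [zero_div, ← Polynomial.coeff_zero_eq_eval_zero, hP0]
    simp
  · have := hev (-d) (by simp [s]; omega)
    simp only [v, r, Int.cast_neg, Int.cast_natCast] at this
    rw [if_neg (by omega)] at this
    rw [Odd.neg_pow (by decide), inv_neg, ← one_div, ← neg_div] at this
    rw [this]
    norm_num

/-! ### Restriction of characters to a subgroup of index two -/

section

variable {Γ : Type u} [Group Γ] {G : Subgroup Γ} [G.Normal]

theorem twistChar_of_mem [Finite G] {χ : G → ℂ} (hχ : χ ∈ irrChars G) {g : Γ} (hg : g ∈ G) :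
    twistChar G g χ = χ := by
  funext z
  exact irrChars_conj hχ z ⟨g, hg⟩

theorem twistChar_mul [Finite G] {χ : G → ℂ} (hχ : χ ∈ irrChars G) {g : Γ} (hg : g ∈ G) (x : Γ) :
    twistChar G (g * x) χ = twistChar G x χ := by
  funext z
  rw [twistChar, map_mul]
  exact irrChars_conj hχ _ ⟨g, hg⟩

theorem twistChar_eq [Finite G] (hG : G.index = 2) {x y : Γ} (hx : x ∉ G) (hy : y ∉ G) {χ : G → ℂ}
    (hχ : χ ∈ irrChars G) : twistChar G y χ = twistChar G x χ := by
  rw [← twistChar_mul hχ (mul_inv_mem_of_index_two hG hx hy) x, inv_mul_cancel_right]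

theorem twistChar_twistChar [Finite G] (hG : G.index = 2) (x : Γ) {χ : G → ℂ}
    (hχ : χ ∈ irrChars G) : twistChar G x (twistChar G x χ) = χ := by
  funext z
  rw [twistChar, twistChar, conjNormal_conjNormal hG]
  exact irrChars_conj hχ _ _

theorem twistChar_mem [Finite G] {χ : G → ℂ} (hχ : χ ∈ irrChars G) (x : Γ) :
    twistChar G x χ ∈ irrChars G := by
  have := Fintype.ofFinite G
  exact irrChars_comp_mulEquiv hχ (MulAut.conjNormal x)

theorem twistedIndicator_twistChar [Fintype G] (x : Γ) (φ : G ≃* G) {s : G}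
    (hφ : ∀ z, MulAut.conjNormal x (φ z) = φ (MulAut.conjNormal x z))
    (hs : MulAut.conjNormal x s = s) (χ : G → ℂ) :
    twistedIndicator φ s (twistChar G x χ) = twistedIndicator φ s χ := by
  rw [twistedIndicator, twistedIndicator]
  conv_rhs => rw [← Equiv.sum_comp (MulAut.conjNormal x : G ≃* G).toEquiv]
  simp [twistChar, hφ, hs]

theorem indicator_twistChar [Fintype G] (x : Γ) (χ : G → ℂ) :
    indicator G (twistChar G x χ) = indicator G χ := by
  rw [indicator_eq, indicator_eq]
  exact twistedIndicator_twistChar x (MulEquiv.refl G) (fun _ => rfl) (map_one _) χ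

theorem sharpIndicator_twistChar [Fintype G] (hG : G.index = 2) {x : Γ} (hx : x ∉ G) (χ : G → ℂ) :
    sharpIndicator G (twistChar G x χ) = sharpIndicator G χ := by
  rw [sharpIndicator_eq hG hx, sharpIndicator_eq hG hx]
  exact twistedIndicator_twistChar x _ (fun _ => rfl) (conjNormal_sqElem hG x) χ

/-- The bijection from a subgroup of index two to its complement. -/
def equivCompl (hG : G.index = 2) {x : Γ} (hx : x ∉ G) : G ≃ {y : Γ // y ∉ G} where
  toFun g := ⟨g * x, by rw [Subgroup.mul_mem_iff_of_index_two hG]; simp [hx]⟩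
  invFun y := ⟨y * x⁻¹, mul_inv_mem_of_index_two hG hx y.2⟩
  left_inv g := by simp
  right_inv y := by simp

omit [G.Normal] in
theorem sum_eq_of_index_two [Fintype Γ] [Fintype G] (hG : G.index = 2) {x : Γ} (hx : x ∉ G)
    (f : Γ → ℂ) : ∑ γ, f γ = ∑ g : G, f g + ∑ g : G, f (g * x) := by
  classical
  rw [← Fintype.sum_subtype_add_sum_subtype (fun γ => γ ∈ G) f,
    ← Equiv.sum_comp (equivCompl hG hx)]
  congr!

/-- The multiplicity of a character of a subgroup in the restriction of a character. -/
def mult [Fintype G] (ψ : Γ → ℂ) (χ : G → ℂ) : ℂ := charInner (fun g : G => ψ g) χ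

omit [G.Normal] in
theorem mult_nat [Fintype G] {ψ : Γ → ℂ} (hψ : ψ ∈ irrChars Γ) :
    (∀ χ ∈ irr G, ∃ n : ℕ, mult ψ χ = n) ∧ ∀ g : G, ψ g = ∑ χ ∈ irr G, mult ψ χ * χ g := by
  obtain ⟨V, _, _, _, ρ, -, rfl⟩ := hψ
  obtain ⟨h1, h2⟩ := character_eq_sum (ρ.comp G.subtype)
  refine ⟨h1, fun g => ?_⟩
  have := congrFun h2 g
  rw [Finset.sum_apply] at this
  exact this

theorem mult_twistChar [Fintype G] {ψ : Γ → ℂ} (hψ : ψ ∈ irrChars Γ) (χ : G → ℂ) (x : Γ) :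
    mult ψ (twistChar G x χ) = mult ψ χ := by
  rw [mult, mult, charInner, charInner]
  conv_rhs => rw [← Equiv.sum_comp (MulAut.conjNormal x : G ≃* G).toEquiv]
  congr 1
  refine Finset.sum_congr rfl fun g _ => ?_
  simp [twistChar, irrChars_conj hψ]

variable [Fintype Γ] [Fintype G] (hG : G.index = 2) {x : Γ} (hx : x ∉ G)

include hG hx

open Classical in
-- This is Mackey's formula for the induced character restricted to `G`. Column orthogonality in `Γ`
-- leaves the sum of `⟨η^c, χ⟩` over `c` in `Γ`, divided by `|G|`; it is constant on each of the two
-- cosets.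
theorem sum_mult_mul_mult {χ η : G → ℂ} (hχ : χ ∈ irrChars G) (hη : η ∈ irrChars G) :
    ∑ ψ ∈ irr Γ, mult ψ χ * mult ψ η =
      (if η = χ then 1 else 0) + if twistChar G x η = χ then 1 else 0 := by
  have hc := natCard_ne_zero G
  have h1 : ∀ ψ : Γ → ℂ, mult ψ χ * mult ψ η = (Nat.card G : ℂ)⁻¹ * ((Nat.card G : ℂ)⁻¹ *
      ∑ g : G, ∑ h : G, χ g⁻¹ * η h * (ψ g * ψ (h : Γ)⁻¹)) := by
    intro ψ
    rw [mult, mult, charInner_comm _ η, charInner, charInner, mul_mul_mul_comm,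
      Finset.sum_mul_sum, mul_assoc]
    congr 2
    refine Finset.sum_congr rfl fun g _ => Finset.sum_congr rfl fun h _ => ?_
    push_cast
    ring
  have h2 : ∀ g h : G, ∑ ψ ∈ irr Γ, χ g⁻¹ * η h * (ψ g * ψ (h : Γ)⁻¹) =
      ∑ c : Γ, if MulAut.conjNormal c g = h then χ g⁻¹ * η h else 0 := by
    intro g h
    rw [← Finset.mul_sum, sum_irr_mul_inv, Fintype.card_subtype, Finset.card_filter]
    push_cast
    rw [Finset.mul_sum]
    refine Finset.sum_congr rfl fun c _ => ?_
    simp [Subtype.ext_iff, MulAut.conjNormal_apply]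
  have h3 : ∑ ψ ∈ irr Γ, ∑ g : G, ∑ h : G, χ g⁻¹ * η h * (ψ g * ψ (h : Γ)⁻¹) =
      ∑ c : Γ, Nat.card G * charInner (twistChar G c η) χ := by
    rw [Finset.sum_comm, Finset.sum_congr rfl fun g _ => Finset.sum_comm]
    simp only [h2]
    rw [Finset.sum_congr rfl fun g _ => Finset.sum_comm, Finset.sum_comm]
    refine Finset.sum_congr rfl fun c _ => ?_
    rw [charInner, mul_inv_cancel_left₀ hc]
    refine Finset.sum_congr rfl fun g _ => ?_
    rw [Finset.sum_ite_eq]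
    simp [twistChar, mul_comm]
  rw [Finset.sum_congr rfl fun ψ _ => h1 ψ, ← Finset.mul_sum, ← Finset.mul_sum, h3,
    ← Finset.mul_sum, inv_mul_cancel_left₀ hc, sum_eq_of_index_two hG hx,
    Finset.sum_congr rfl fun g _ => congrArg (charInner · χ) (twistChar_of_mem hη g.2),
    Finset.sum_congr (f := fun g : G => charInner (twistChar G (g * x) η) χ) rfl
      fun g _ => congrArg (charInner · χ) (twistChar_mul hη g.2 x),
    charInner_irrChars hη hχ, charInner_irrChars (twistChar_mem hη x) hχ]
  simp only [Finset.sum_const, Finset.card_univ, ← Nat.card_eq_fintype_card, nsmul_eq_mul,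
    ← mul_add, inv_mul_cancel_left₀ hc]

/-- The squares of elements of `G` contribute `F` and those of `G x` contribute `F♯`; the factor is
the index of `G`. -/
theorem two_mul_twistedIndicator {ψ : Γ → ℂ} (hψ : ψ ∈ irrChars Γ) :
    2 * twistedIndicator (MulEquiv.refl Γ) 1 ψ =
      ∑ χ ∈ irr G, mult ψ χ * (indicator G χ + sharpIndicator G χ) := by
  have hc := natCard_ne_zero G
  have h1 : (Nat.card Γ : ℂ) = Nat.card G * 2 := by
    rw [← G.card_mul_index, hG]; push_cast; rfl
  have h2 := (mult_nat (G := G) hψ).2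
  rw [twistedIndicator, h1, sum_eq_of_index_two hG hx, mul_inv, mul_left_comm, mul_assoc,
    inv_mul_cancel_left₀ two_ne_zero]
  have h3 : ∀ g : G, ψ (g * MulEquiv.refl Γ g * 1) = ∑ χ ∈ irr G, mult ψ χ * χ (g * g * 1) :=
    fun g => (h2 (g * g * 1)).symm ▸ by simp
  have h4 : ∀ g : G, ψ (g * x * MulEquiv.refl Γ (g * x) * 1) =
      ∑ χ ∈ irr G, mult ψ χ * χ (g * MulAut.conjNormal x g * sqElem hG x) := by
    intro g
    rw [← h2]
    congr 1
    simp [sqElem, pow_two, mul_assoc]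
  simp only [h3, h4, mul_add, Finset.sum_add_distrib]
  rw [Finset.sum_comm, Finset.sum_comm (s := Finset.univ), Finset.mul_sum, Finset.mul_sum]
  congr 1
  · refine Finset.sum_congr rfl fun χ _ => ?_
    rw [indicator_eq, twistedIndicator, ← Finset.mul_sum]
    simp; ring
  · refine Finset.sum_congr rfl fun χ _ => ?_
    rw [sharpIndicator_eq hG hx, twistedIndicator, ← Finset.mul_sum]
    ring

end

/-! ### Clifford theory in index two, and the indicators of `Γ` -/

section

variable {Γ : Type u} [Group Γ] {G : Subgroup Γ} [G.Normal] [Fintype Γ] [Fintype G]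
  (hG : G.index = 2) {x : Γ} (hx : x ∉ G)

include hG hx

open Classical in
-- The squares of the multiplicities of `χ`, summed over all `ψ`, give at most `2`, so no
-- multiplicity exceeds `1`. For `η` other than `χ` and `χ^x` the sum of products vanishes, hence
-- each of its nonnegative terms.
theorem mult_trichotomy {ψ : Γ → ℂ} (hψ : ψ ∈ irrChars Γ) {χ : G → ℂ} (hχ : χ ∈ irrChars G) :
    mult ψ χ = 0 ∨ mult ψ χ = 1 ∧ ∀ η ∈ irrChars G, η ≠ χ → η ≠ twistChar G x χ → mult ψ η = 0 := by
  have hn : ∀ ψ ∈ irr Γ, ∀ η ∈ irr G, ∃ n : ℕ, mult ψ η = n :=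
    fun ψ hψ => (mult_nat (mem_irr.1 hψ)).1
  choose! n hn using hn
  have hsum : ∀ η ∈ irrChars G, ∑ ψ ∈ irr Γ, n ψ χ * n ψ η =
      (if η = χ then 1 else 0) + if twistChar G x η = χ then 1 else 0 := by
    intro η hη
    have h1 := sum_mult_mul_mult hG hx hχ hη
    rw [Finset.sum_congr rfl fun ψ hψ => by rw [hn ψ hψ χ (mem_irr.2 hχ), hn ψ hψ η (mem_irr.2 hη)]]
      at h1
    exact_mod_cast h1
  have hle : ∀ η ∈ irrChars G, n ψ χ * n ψ η ≤ ∑ ψ ∈ irr Γ, n ψ χ * n ψ η := fun η _ =>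
    Finset.single_le_sum (f := fun ψ => n ψ χ * n ψ η) (fun _ _ => Nat.zero_le _) (mem_irr.2 hψ)
  rw [hn ψ (mem_irr.2 hψ) χ (mem_irr.2 hχ)]
  rcases Nat.eq_zero_or_pos (n ψ χ) with h0 | h0
  · left; rw [h0, Nat.cast_zero]
  right
  constructor
  · have h1 := (hle χ hχ).trans_eq (hsum χ hχ)
    rw [if_pos rfl] at h1
    have h2 : n ψ χ * n ψ χ ≤ 2 := h1.trans (by split_ifs <;> norm_num)
    have h3 : n ψ χ = 1 := by nlinarith
    rw [h3, Nat.cast_one]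
  · intro η hη h1 h2
    have h3 := (hle η hη).trans_eq (hsum η hη)
    rw [if_neg h1, if_neg] at h3
    · have : n ψ η = 0 := by
        rcases Nat.mul_eq_zero.1 (Nat.le_zero.1 h3) with h | h
        · omega
        · exact h
      rw [hn ψ (mem_irr.2 hψ) η (mem_irr.2 hη), this, Nat.cast_zero]
    · rintro rfl
      exact h2 (twistChar_twistChar hG x hη).symm

omit [G.Normal] [Fintype Γ] hG hx in
theorem exists_mult_ne_zero {ψ : Γ → ℂ} (hψ : ψ ∈ irrChars Γ) :
    ∃ χ ∈ irrChars G, mult ψ χ ≠ 0 := by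
  by_contra! h
  obtain ⟨d, hd, hd1⟩ := irrChars_apply_one hψ
  have := (mult_nat (G := G) hψ).2 1
  rw [Finset.sum_eq_zero fun χ hχ => by rw [h χ (mem_irr.1 hχ), zero_mul]] at this
  rw [OneMemClass.coe_one, hd1] at this
  exact hd.ne' (by exact_mod_cast this)

open Classical in
/-- A sum over the constituents of the restriction of an irreducible character. -/
theorem sum_mult_mul {ψ : Γ → ℂ} (hψ : ψ ∈ irrChars Γ) {χ : G → ℂ} (hχ : χ ∈ irrChars G)
    (h0 : mult ψ χ ≠ 0) (f : (G → ℂ) → ℂ) (hf : f (twistChar G x χ) = f χ) :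
    (if twistChar G x χ = χ then 2 else 1) * ∑ η ∈ irr G, mult ψ η * f η = 2 * f χ := by
  obtain ⟨h1, h2⟩ := (mult_trichotomy hG hx hψ hχ).resolve_left h0
  have hs : ∑ η ∈ irr G, mult ψ η * f η =
      ∑ η ∈ ({χ, twistChar G x χ} : Finset (G → ℂ)), mult ψ η * f η := by
    symm
    refine Finset.sum_subset (fun η hη => ?_) fun η hη hη' => ?_
    · rcases Finset.mem_insert.1 hη with rfl | hη
      · exact mem_irr.2 hχ
      · rw [Finset.mem_singleton.1 hη]
        exact mem_irr.2 (twistChar_mem hχ x)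
    · rw [Finset.mem_insert, Finset.mem_singleton, not_or] at hη'
      rw [h2 η (mem_irr.1 hη) hη'.1 hη'.2, zero_mul]
  rw [hs]
  split_ifs with h
  · rw [h, Finset.pair_eq_singleton, Finset.sum_singleton, h1, one_mul]
  · rw [Finset.sum_pair (Ne.symm h), mult_twistChar hψ, h1, hf]
    ring

open Classical in
-- Double counting of the pairs of `ψ` and a constituent `χ` of its restriction. A fixed `χ` is the
-- restriction of two characters with indicator `(F + F♯) / 2`; a pair `χ ≠ χ^x` comes from a single
-- one with indicator `F + F♯`.
theorem sum_irr_hat (f : ℂ → ℂ) :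
    2 * ∑ ψ ∈ irr Γ, f (twistedIndicator (MulEquiv.refl Γ) 1 ψ) =
      ∑ χ ∈ irr G, if twistChar G x χ = χ
        then 4 * f ((indicator G χ + sharpIndicator G χ) / 2)
        else f (indicator G χ + sharpIndicator G χ) := by
  -- With these weights the constituents of every `ψ` have total weight `2`, and the indicator of
  -- `ψ` is `(F + F♯) / b`.
  let b : (G → ℂ) → ℂ := fun χ => if twistChar G x χ = χ then 2 else 1
  have hb0 : ∀ χ, b χ ≠ 0 := fun χ => by
    simp only [b]; split_ifs <;> norm_num
  have hb : ∀ χ ∈ irrChars G, b (twistChar G x χ) = b χ := fun χ hχ => by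
    simp only [b, twistChar_twistChar hG x hχ, eq_comm (a := χ)]
  have h1 : ∀ ψ ∈ irr Γ, ∑ χ ∈ irr G, mult ψ χ * (mult ψ χ * b χ) = 2 := by
    intro ψ hψ
    obtain ⟨χ, hχ, h0⟩ := exists_mult_ne_zero (G := G) (mem_irr.1 hψ)
    have := sum_mult_mul hG hx (mem_irr.1 hψ) hχ h0 (fun χ => mult ψ χ * b χ)
      (by rw [mult_twistChar (mem_irr.1 hψ), hb χ hχ])
    rw [((mult_trichotomy hG hx (mem_irr.1 hψ) hχ).resolve_left h0).1, one_mul, mul_comm 2] at this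
    exact mul_left_cancel₀ (hb0 χ) this
  have h2 : ∀ ψ ∈ irr Γ, ∀ χ ∈ irr G, mult ψ χ ≠ 0 →
      twistedIndicator (MulEquiv.refl Γ) 1 ψ = (indicator G χ + sharpIndicator G χ) / b χ := by
    intro ψ hψ χ hχ h0
    have := sum_mult_mul hG hx (mem_irr.1 hψ) (mem_irr.1 hχ) h0
      (fun χ => indicator G χ + sharpIndicator G χ)
      (by rw [indicator_twistChar, sharpIndicator_twistChar hG hx])
    rw [← two_mul_twistedIndicator hG hx (mem_irr.1 hψ), mul_left_comm] at this
    rw [eq_div_iff (hb0 χ), mul_comm]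
    exact mul_left_cancel₀ two_ne_zero this
  have h3 : ∀ ψ ∈ irr Γ, 2 * f (twistedIndicator (MulEquiv.refl Γ) 1 ψ) =
      ∑ χ ∈ irr G, mult ψ χ * mult ψ χ *
        (b χ * f ((indicator G χ + sharpIndicator G χ) / b χ)) := by
    intro ψ hψ
    rw [← h1 ψ hψ, Finset.sum_mul]
    refine Finset.sum_congr rfl fun χ hχ => ?_
    by_cases h0 : mult ψ χ = 0
    · simp [h0]
    · rw [h2 ψ hψ χ hχ h0]
      ring
  rw [Finset.mul_sum, Finset.sum_congr rfl h3, Finset.sum_comm]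
  refine Finset.sum_congr rfl fun χ hχ => ?_
  rw [← Finset.sum_mul, sum_mult_mul_mult hG hx (mem_irr.1 hχ) (mem_irr.1 hχ), if_pos rfl]
  simp only [b]
  split_ifs
  · ring
  · simp

end

/-! ### The ten linear forms -/

theorem linearIndependent_tenForms : LinearIndependent ℚ tenForms := by
  rw [Fintype.linearIndependent_iff]
  intro c hc
  have key : ∀ v : DysonType → ℚ, ∑ i, c i * tenForms i v = 0 := fun v => by
    simpa using LinearMap.congr_fun hc v
  -- A relation between the forms is evaluated at the ten unit vectors.
  have h1 := key fun | .I => 1 | _ => 0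
  have h2 := key fun | .II => 1 | _ => 0
  have h3 := key fun | .III => 1 | _ => 0
  have h4 := key fun | .IV => 1 | _ => 0
  have h5 := key fun | .V => 1 | _ => 0
  have h6 := key fun | .VI => 1 | _ => 0
  have h7 := key fun | .VII => 1 | _ => 0
  have h8 := key fun | .VIII => 1 | _ => 0
  have h9 := key fun | .IX => 1 | _ => 0
  have h10 := key fun | .X => 1 | _ => 0
  simp [Fin.sum_univ_succ, tenForms, unknown] at h1 h2 h3 h4 h5 h6 h7 h8 h9 h10
  intro i
  fin_cases i <;> simp only [Fin.reduceFinMk, Fin.zero_eta, Fin.mk_one] <;> linarith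

/-! ### Types and indicators -/

instance : Fintype DysonType where
  elems := ⟨{.I, .II, .III, .IV, .V, .VI, .VII, .VIII, .IX, .X}, by simp⟩
  complete t := by cases t <;> simp

instance : Fintype ClassType where
  elems := ⟨{.one, .twoA, .twoB, .twoC, .four}, by simp⟩
  complete t := by cases t <;> simp

theorem sum_dysonType (f : DysonType → ℕ) : ∑ t, f t = f .I + f .II + f .III + f .IV + f .V +
    f .VI + f .VII + f .VIII + f .IX + f .X := by
  change Multiset.sum (Multiset.map f {.I, .II, .III, .IV, .V, .VI, .VII, .VIII, .IX, .X}) = _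
  simp [add_assoc]

theorem sum_classType (f : ClassType → ℕ) :
    ∑ t, f t = f .one + f .twoA + f .twoB + f .twoC + f .four := by
  change Multiset.sum (Multiset.map f {.one, .twoA, .twoB, .twoC, .four}) = _
  simp [add_assoc]

open Classical in
theorem sum_weight_eq {α τ : Type*} [Fintype τ] (s : Finset α) (T : α → τ) (g : τ → ℕ) :
    ∑ a ∈ s, g (T a) = ∑ t, g t * (s.filter fun a => T a = t).card := by
  rw [← Finset.sum_fiberwise s T]
  refine Finset.sum_congr rfl fun t _ => ?_
  rw [Finset.sum_congr rfl fun a ha => by rw [(Finset.mem_filter.1 ha).2], Finset.sum_const,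
    smul_eq_mul, mul_comm]

/-- The value of `F` on characters of a given type. -/
def typeF : DysonType → ℂ
  | .I | .II | .III => 1
  | .IV | .V | .VI | .VII => 0
  | .VIII | .IX | .X => -1

/-- The value of `F♯` on characters of a given type. -/
def typeS : DysonType → ℂ
  | .I | .V | .IX => 1
  | .III | .IV | .VII | .X => 0
  | .II | .VI | .VIII => -1

/-- Whether characters of a given type are fixed by conjugation with elements outside the group. -/
def TypeFixed : DysonType → Prop
  | .I | .II | .IV | .VIII | .IX => True
  | _ => False

section

variable {Γ : Type u} [Group Γ] {G : Subgroup Γ} [G.Normal] [Fintype G]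

omit [G.Normal] in
theorem indicator_trichotomy {χ : G → ℂ} (hχ : χ ∈ irrChars G) :
    ((indicator G χ = 1 ∨ indicator G χ = -1) ∧ (fun g => χ g⁻¹) = χ) ∨
      (indicator G χ = 0 ∧ (fun g => χ g⁻¹) ≠ χ) := by
  have hinv := irrChars_inv hχ
  obtain ⟨V, _, _, _, ρ, hρ, rfl⟩ := hχ
  rw [indicator_eq]
  rcases twistedIndicator_trichotomy ρ hρ (MulEquiv.refl G) (s := 1) (by simp) (by simp) with
    ⟨ε, hε, hF, hr, -⟩ | ⟨hF, hr, -⟩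
  · exact Or.inl ⟨hF ▸ hε, funext fun g => by rw [hinv, ← hr]; rfl⟩
  · refine Or.inr ⟨hF, fun h => hr fun g => ?_⟩
    rw [← hinv, congrFun h g]; rfl

theorem sharpIndicator_trichotomy (hG : G.index = 2) {x : Γ} (hx : x ∉ G) {χ : G → ℂ}
    (hχ : χ ∈ irrChars G) :
    ((sharpIndicator G χ = 1 ∨ sharpIndicator G χ = -1) ∧ twistChar G x χ = fun g => χ g⁻¹) ∨
      (sharpIndicator G χ = 0 ∧ twistChar G x χ ≠ fun g => χ g⁻¹) := by
  have hinv := irrChars_inv hχ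
  obtain ⟨V, _, _, _, ρ, hρ, rfl⟩ := hχ
  rw [sharpIndicator_eq hG hx]
  rcases twistedIndicator_trichotomy ρ hρ (MulAut.conjNormal x) (conjNormal_conjNormal hG x)
    (conjNormal_sqElem hG x) with ⟨ε, hε, hF, hr, -⟩ | ⟨hF, hr, -⟩
  · exact Or.inl ⟨hF ▸ hε, funext fun g => by rw [hinv, ← hr]; rfl⟩
  · refine Or.inr ⟨hF, fun h => hr fun g => ?_⟩
    rw [← hinv, ← congrFun h g]; rfl

theorem charOrbit_eq (hG : G.index = 2) {x : Γ} (hx : x ∉ G) {χ : G → ℂ} (hχ : χ ∈ irrChars G) :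
    charOrbit G χ = {χ, fun g => χ g⁻¹, twistChar G x χ, fun g => twistChar G x χ g⁻¹} := by
  have h1 : (fun g => conj (χ g)) = fun g => χ g⁻¹ := funext fun g => (irrChars_inv hχ g).symm
  have h2 : (fun g => conj (twistChar G x χ g)) = fun g => twistChar G x χ g⁻¹ :=
    funext fun g => (irrChars_inv (twistChar_mem hχ x) g).symm
  ext η
  simp only [charOrbit, h1, Set.mem_union, Set.mem_insert_iff, Set.mem_singleton_iff,
    Set.mem_ofPred_eq, or_assoc]
  refine or_congr_right (or_congr_right ⟨?_, ?_⟩)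
  · rintro ⟨y, hy, h⟩
    rwa [twistChar_eq hG hx hy hχ, h2] at h
  · exact fun h => ⟨x, hx, by rwa [h2]⟩

/-- If neither conjugation nor its composite with the twist fixes `χ`, only the twist can. This
separates types IV and VII. -/
theorem ncard_charOrbit (hG : G.index = 2) {x : Γ} (hx : x ∉ G) {χ : G → ℂ} (hχ : χ ∈ irrChars G)
    (h1 : (fun g => χ g⁻¹) ≠ χ) (h2 : twistChar G x χ ≠ fun g => χ g⁻¹) :
    (twistChar G x χ = χ → (charOrbit G χ).ncard = 2) ∧
      (twistChar G x χ ≠ χ → (charOrbit G χ).ncard = 4) := by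
  rw [charOrbit_eq hG hx hχ]
  constructor
  · intro h
    rw [h, Set.insert_comm, Set.insert_comm χ, Set.insert_eq_of_mem (a := χ) (by simp),
      Set.insert_eq_of_mem (by simp), Set.ncard_pair h1.symm]
  · intro h
    rw [Set.ncard_insert_of_notMem, Set.ncard_insert_of_notMem, Set.ncard_pair]
    · intro h3
      refine h1 (funext fun g => ?_)
      have := congrFun h3 ((MulAut.conjNormal x).symm g)
      simp only [twistChar, map_inv, MulEquiv.apply_symm_apply] at this
      exact this.symm
    · simp only [Set.mem_insert_iff, Set.mem_singleton_iff, not_or]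
      exact ⟨h2.symm, fun h3 => h (funext fun g => by simpa using (congrFun h3 g⁻¹).symm)⟩
    · simp only [Set.mem_insert_iff, Set.mem_singleton_iff, not_or]
      exact ⟨h1.symm, Ne.symm h, fun h3 => h2 (funext fun g => by
        simpa using (congrFun h3 g⁻¹).symm)⟩

theorem charHasType_iff [Finite Γ] (hG : G.index = 2) {χ : G → ℂ} (hχ : χ ∈ irrChars G)
    (t : DysonType) : CharHasType G χ t ↔ indicator G χ = typeF t ∧ sharpIndicator G χ = typeS t ∧
      (t = .IV → (charOrbit G χ).ncard = 2) ∧ (t = .VII → (charOrbit G χ).ncard = 4) := by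
  cases t <;> simp [CharHasType, typeF, typeS, hasRealEnd_real_iff hχ, hasRealEnd_complex_iff hχ,
    hasRealEnd_quaternion_iff hχ, ← indicator_eq, hasAntilinearEnd_real_iff hG hχ,
    hasAntilinearEnd_complex_iff hG hχ, hasAntilinearEnd_quaternion_iff hG hχ]

/-- The nine value pairs `(F, F♯)` are treated one by one. A nonzero `F` means invariance under
inversion, a nonzero `F♯` invariance under inversion composed with the twist. So whether the twist
fixes `χ` is forced unless both indicators vanish. -/
theorem exists_type [Finite Γ] (hG : G.index = 2) {x : Γ} (hx : x ∉ G) {χ : G → ℂ}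
    (hχ : χ ∈ irrChars G) :
    ∃ t, (∀ t', CharHasType G χ t' ↔ t = t') ∧ indicator G χ = typeF t ∧
      sharpIndicator G χ = typeS t ∧ (twistChar G x χ = χ ↔ TypeFixed t) ∧
      ((fun g => χ g⁻¹) = χ ↔ typeF t ≠ 0) ∧
      ((fun g => χ (MulAut.conjNormal x g)⁻¹) = χ ↔ typeS t ≠ 0) := by
  have hC := charHasType_iff hG hχ
  have hS : (fun g => χ (MulAut.conjNormal x g)⁻¹) = χ ↔ twistChar G x χ = fun g => χ g⁻¹ := by
    constructor
    · exact fun h => funext fun g => by simpa [twistChar] using congrFun h g⁻¹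
    · exact fun h => funext fun g => by simpa [twistChar] using congrFun h g⁻¹
  have hO := ncard_charOrbit hG hx hχ
  have h1 : (1 : ℂ) ≠ -1 := by norm_num
  rw [hS]
  simp only [hC]
  rcases indicator_trichotomy hχ with ⟨hF | hF, hr⟩ | ⟨hF, hr⟩ <;>
  rcases sharpIndicator_trichotomy hG hx hχ with ⟨hS | hS, hs⟩ | ⟨hS, hs⟩ <;>
  rw [hF, hS]
  · exact ⟨.I, fun t => by cases t <;> simp [typeF, typeS, h1], by
      simp [typeF, typeS, TypeFixed, hs, hr]⟩
  · exact ⟨.II, fun t => by cases t <;> simp [typeF, typeS, h1, h1.symm], by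
      simp [typeF, typeS, TypeFixed, hs, hr]⟩
  · exact ⟨.III, fun t => by cases t <;> simp [typeF, typeS, h1], by
      rw [hr] at hs
      simp [typeF, typeS, TypeFixed, hs, hr]⟩
  · exact ⟨.IX, fun t => by cases t <;> simp [typeF, typeS, h1, h1.symm], by
      simp [typeF, typeS, TypeFixed, hs, hr]⟩
  · exact ⟨.VIII, fun t => by cases t <;> simp [typeF, typeS, h1.symm], by
      simp [typeF, typeS, TypeFixed, hs, hr]⟩
  · exact ⟨.X, fun t => by cases t <;> simp [typeF, typeS, h1.symm], by
      rw [hr] at hs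
      simp [typeF, typeS, TypeFixed, hs, hr]⟩
  · exact ⟨.V, fun t => by cases t <;> simp [typeF, typeS, h1], by
      simp [typeF, typeS, TypeFixed, hs, hr]⟩
  · exact ⟨.VI, fun t => by cases t <;> simp [typeF, typeS, h1.symm], by
      simp [typeF, typeS, TypeFixed, hs, hr]⟩
  · by_cases hb : twistChar G x χ = χ
    · exact ⟨.IV, fun t => by
        cases t <;> simp [typeF, typeS, (hO hr hs).1 hb], by
        simp [typeF, typeS, TypeFixed, hr.symm, hr, hb]⟩
    · exact ⟨.VII, fun t => by
        cases t <;> simp [typeF, typeS, (hO hr hs).2 hb], by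
        simp [typeF, typeS, TypeFixed, hs, hr, hb]⟩

end

/-! ### Types of conjugacy classes -/

section

variable {Γ : Type u} [Group Γ] {G : Subgroup Γ} [G.Normal]

theorem invClass_mk {H : Type u} [Group H] (h : H) :
    invClass (ConjClasses.mk h) = ConjClasses.mk h⁻¹ := rfl

theorem twistClass_mk (x : Γ) (g : G) :
    twistClass G x (ConjClasses.mk g) = ConjClasses.mk (MulAut.conjNormal x g) := rfl

theorem invClass_invClass {H : Type u} [Group H] (K : ConjClasses H) :
    invClass (invClass K) = K := by
  obtain ⟨a, rfl⟩ := ConjClasses.mk_surjective K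
  simp [invClass_mk]

theorem twistClass_invClass (x : Γ) (K : ConjClasses G) :
    twistClass G x (invClass K) = invClass (twistClass G x K) := by
  obtain ⟨a, rfl⟩ := ConjClasses.mk_surjective K
  simp [invClass_mk, twistClass_mk]

theorem twistClass_mul (g : G) (x : Γ) (K : ConjClasses G) :
    twistClass G (g * x) K = twistClass G x K := by
  obtain ⟨a, rfl⟩ := ConjClasses.mk_surjective K
  rw [twistClass_mk, twistClass_mk, map_mul]
  exact ConjClasses.mk_eq_mk_iff_isConj.2 (isConj_comm.1 (isConj_iff.2 ⟨g, rfl⟩))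

theorem twistClass_eq (hG : G.index = 2) {x y : Γ} (hx : x ∉ G) (hy : y ∉ G) (K : ConjClasses G) :
    twistClass G y K = twistClass G x K := by
  rw [← twistClass_mul ⟨_, mul_inv_mem_of_index_two hG hx hy⟩ x, inv_mul_cancel_right]

theorem twistClass_twistClass (hG : G.index = 2) (x : Γ) (K : ConjClasses G) :
    twistClass G x (twistClass G x K) = K := by
  obtain ⟨a, rfl⟩ := ConjClasses.mk_surjective K
  rw [twistClass_mk, twistClass_mk, conjNormal_conjNormal hG]
  exact ConjClasses.mk_eq_mk_iff_isConj.2 (isConj_comm.1 (isConj_iff.2 ⟨_, rfl⟩))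

theorem classOrbit_eq (hG : G.index = 2) {x : Γ} (hx : x ∉ G) (K : ConjClasses G) :
    classOrbit G K = {K, invClass K, twistClass G x K, invClass (twistClass G x K)} := by
  ext L
  simp only [classOrbit, Set.mem_union, Set.mem_insert_iff, Set.mem_singleton_iff,
    Set.mem_ofPred_eq, or_assoc]
  refine or_congr_right (or_congr_right ⟨?_, fun h => ⟨x, hx, by rwa [twistClass_invClass]⟩⟩)
  rintro ⟨y, hy, h⟩
  rwa [twistClass_eq hG hx hy, twistClass_eq hG hx hy, twistClass_invClass] at h

theorem exists_classType (hG : G.index = 2) {x : Γ} (hx : x ∉ G) (K : ConjClasses G) :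
    ∃ s, (∀ s', ClassHasType G K s' ↔ s = s') ∧ (invClass K = K ↔ s = .one ∨ s = .twoA) ∧
      (twistClass G x K = K ↔ s = .one ∨ s = .twoB) ∧
      (twistClass G x (invClass K) = K ↔ s = .one ∨ s = .twoC) := by
  have hO := classOrbit_eq hG hx K
  have hi : ∀ L : ConjClasses G, invClass L = K ↔ L = invClass K := fun L =>
    ⟨fun h => by rw [← h, invClass_invClass], fun h => by rw [h, invClass_invClass]⟩
  have hB : (∀ y ∉ G, twistClass G y K = K) ↔ twistClass G x K = K :=
    ⟨fun h => h x hx, fun h y hy => by rw [twistClass_eq hG hx hy, h]⟩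
  have hC : (∀ y ∉ G, twistClass G y (invClass K) = K) ↔ twistClass G x K = invClass K := by
    rw [← hi, ← twistClass_invClass]
    exact ⟨fun h => h x hx, fun h y hy => by rw [twistClass_eq hG hx hy, h]⟩
  rw [twistClass_invClass, hi (twistClass G x K)]
  by_cases h1 : invClass K = K
  · by_cases h2 : twistClass G x K = K
    · have hcard : (classOrbit G K).ncard = 1 := by
        rw [hO, h2, h1]; simp
      exact ⟨.one, fun s => by cases s <;> simp [ClassHasType, hcard], by simp [h1, h2]⟩
    · have hcard : (classOrbit G K).ncard = 2 := by
        have h3 : invClass (twistClass G x K) = twistClass G x K := by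
          rw [← twistClass_invClass, h1]
        rw [hO, h1, h3]
        simp [Set.ncard_pair (Ne.symm h2)]
      exact ⟨.twoA, fun s => by cases s <;> simp [ClassHasType, hcard, hB, h1, h2],
        by simp [h1, h2]⟩
  · have h1' : K ≠ invClass K := Ne.symm h1
    by_cases h2 : twistClass G x K = K
    · have hcard : (classOrbit G K).ncard = 2 := by
        rw [hO, h2, Set.insert_comm, Set.insert_comm K, Set.insert_eq_of_mem (a := K) (by simp),
          Set.insert_eq_of_mem (by simp), Set.ncard_pair h1']
      exact ⟨.twoB, fun s => by cases s <;> simp [ClassHasType, hcard, hB, hC, h1, h1', h2],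
        by simp [h1, h1', h2]⟩
    · by_cases h3 : twistClass G x K = invClass K
      · have hcard : (classOrbit G K).ncard = 2 := by
          rw [hO, h3, invClass_invClass, Set.insert_eq_of_mem (by simp),
            Set.insert_eq_of_mem (by simp), Set.ncard_pair h1]
        exact ⟨.twoC, fun s => by cases s <;> simp [ClassHasType, hcard, hB, hC, h1, h3],
          by simp [h1, h3]⟩
      · have hcard : (classOrbit G K).ncard = 4 := by
          have h4 : invClass (twistClass G x K) ≠ K := fun h => h3 ((hi _).1 h)
          rw [hO, Set.ncard_insert_of_notMem, Set.ncard_insert_of_notMem, Set.ncard_pair]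
          · intro h
            have := congrArg (twistClass G x) h
            rw [← twistClass_invClass, twistClass_twistClass hG, twistClass_twistClass hG] at this
            exact h1 this.symm
          · simp only [Set.mem_insert_iff, Set.mem_singleton_iff, not_or]
            refine ⟨Ne.symm h3, fun h => h2 ?_⟩
            rw [← invClass_invClass (twistClass G x K), ← h, invClass_invClass]
          · simp only [Set.mem_insert_iff, Set.mem_singleton_iff, not_or]
            exact ⟨h1', Ne.symm h2, h4.symm⟩
        exact ⟨.four, fun s => by cases s <;> simp [ClassHasType, hcard], by simp [h1, h2, h3]⟩

open Classical in
-- The type of a class records its stabilizer in the Klein four-group, so each involution fixes the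
-- classes of type `1` and of one of the types `2a`, `2b`, `2c`.
theorem sum_classWeight [Finite G] (hG : G.index = 2) {x : Γ} (hx : x ∉ G) :
    Nat.card (ConjClasses G) = numClasses G .one + numClasses G .twoA + numClasses G .twoB +
        numClasses G .twoC + numClasses G .four ∧
      {K : ConjClasses G | invClass K = K}.ncard = numClasses G .one + numClasses G .twoA ∧
      {K : ConjClasses G | twistClass G x K = K}.ncard = numClasses G .one + numClasses G .twoB ∧
      {K : ConjClasses G | twistClass G x (invClass K) = K}.ncard =
        numClasses G .one + numClasses G .twoC := by
  have := Fintype.ofFinite (ConjClasses G)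
  choose T h1 h2 h3 h4 using exists_classType hG hx
  have hN : ∀ s, numClasses G s = (Finset.univ.filter fun K => T K = s).card := fun s => by
    rw [numClasses, Set.ncard_eq_toFinset_card']
    simp [h1]
  have hw := fun g => (sum_weight_eq Finset.univ T g).trans (sum_classType _)
  simp only [← hN] at hw
  refine ⟨?_, ?_, ?_, ?_⟩
  · have := hw fun _ => 1
    simpa [Nat.card_eq_fintype_card] using this
  · have := hw fun s => if s = .one ∨ s = .twoA then 1 else 0
    simpa [← h2, ← Finset.card_filter, Set.ncard_eq_toFinset_card'] using this
  · have := hw fun s => if s = .one ∨ s = .twoB then 1 else 0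
    simpa [← h3, ← Finset.card_filter, Set.ncard_eq_toFinset_card'] using this
  · have := hw fun s => if s = .one ∨ s = .twoC then 1 else 0
    simpa [← h4, ← Finset.card_filter, Set.ncard_eq_toFinset_card'] using this

end

theorem isPositive_div_iff {c : ℂ} (hc : c = 1 ∨ c = -1 ∨ c = 0) {d : ℕ} (hd : 0 < d) :
    IsPositive (c / d) ↔ c = 1 := by
  have hd' : (0 : ℝ) < d := by exact_mod_cast hd
  constructor
  · rintro ⟨r, hr, h⟩
    have h1 : c = ((r * d : ℝ) : ℂ) := by
      rw [div_eq_iff (by exact_mod_cast hd.ne')] at h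
      rw [h]; push_cast; rfl
    have h2 : 0 < r * d := by positivity
    rcases hc with rfl | rfl | rfl
    · rfl
    · have : (-1 : ℝ) = r * d := by exact_mod_cast h1
      linarith
    · have : (0 : ℝ) = r * d := by exact_mod_cast h1
      linarith
  · rintro rfl
    exact ⟨1 / d, by positivity, by push_cast; rfl⟩

/-! ### Comparison of multisets of indicators -/

section

variable {H H' : Type u} [Group H] [Fintype H] [Group H'] [Fintype H']

theorem twistedIndicator_refl_mem {χ : H → ℂ} (hχ : χ ∈ irrChars H) :
    twistedIndicator (MulEquiv.refl H) 1 χ = 1 ∨ twistedIndicator (MulEquiv.refl H) 1 χ = -1 ∨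
      twistedIndicator (MulEquiv.refl H) 1 χ = 0 := by
  obtain ⟨V, _, _, _, ρ, hρ, rfl⟩ := hχ
  rcases twistedIndicator_trichotomy ρ hρ (MulEquiv.refl H) (s := 1) (by simp) (by simp) with
    ⟨ε, hε, hF, -⟩ | ⟨hF, -⟩
  · rw [hF]; tauto
  · exact Or.inr (Or.inr hF)

/-- As `c` takes only the values `0, ±1`, `c² c^k = c^k` for `k ≥ 1`. Thus two of the `k + 2`
factors cancel the weight `χ(1)²` and leave a power sum; this is why counts start at `m = 3`. -/
theorem sum_sq_mul_pow (c : (H → ℂ) → ℂ) (hc : ∀ χ ∈ irrChars H, c χ = 1 ∨ c χ = -1 ∨ c χ = 0)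
    (n : ℂ) {k : ℕ} (hk : 1 ≤ k) : ∑ χ ∈ irr H, χ 1 ^ 2 * (n * (c χ / χ 1)) ^ (k + 2) =
      n ^ (k + 2) * ∑ χ ∈ irr H, (c χ / χ 1) ^ k := by
  rw [Finset.mul_sum]
  refine Finset.sum_congr rfl fun χ hχ => ?_
  obtain ⟨d, hd, hd1⟩ := irrChars_apply_one (mem_irr.1 hχ)
  have h0 : χ 1 ≠ 0 := by rw [hd1]; exact_mod_cast hd.ne'
  have h1 : χ 1 ^ 2 * (n * (c χ / χ 1)) ^ (k + 2) = n ^ (k + 2) * (c χ ^ 2 * (c χ / χ 1) ^ k) := by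
    rw [mul_pow, pow_add (c χ / χ 1), div_pow (c χ) _ 2]
    field_simp
  rw [h1]
  rcases hc χ (mem_irr.1 hχ) with h | h | h
  · simp [h]
  · simp [h]
  · simp [h]
    omega

theorem card_filter_eq_of_sum_eq (c : (H → ℂ) → ℂ) (c' : (H' → ℂ) → ℂ)
    (hc : ∀ χ ∈ irrChars H, c χ = 1 ∨ c χ = -1 ∨ c χ = 0)
    (hc' : ∀ χ ∈ irrChars H', c' χ = 1 ∨ c' χ = -1 ∨ c' χ = 0)
    (hcard : Nat.card H = Nat.card H')
    (hcl : Nat.card (ConjClasses H) = Nat.card (ConjClasses H'))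
    (h : ∀ m, 3 ≤ m → m ≤ Nat.card (ConjClasses H) + 3 →
      (Nat.card H : ℂ)⁻¹ * ∑ χ ∈ irr H, χ 1 ^ 2 * (Nat.card H * (c χ / χ 1)) ^ m =
        (Nat.card H' : ℂ)⁻¹ * ∑ χ ∈ irr H', χ 1 ^ 2 * (Nat.card H' * (c' χ / χ 1)) ^ m)
    (p : ℂ → Prop) [DecidablePred p] :
    ((irr H).filter fun χ => p (c χ / χ 1)).card =
      ((irr H').filter fun χ => p (c' χ / χ 1)).card := by
  refine card_filter_eq_of_sum_pow_eq (fun χ : H → ℂ => c χ / χ 1) (fun χ : H' → ℂ => c' χ / χ 1)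
    (by rw [card_irr, card_irr, hcl]) (fun k hk hk' => ?_) p
  have h1 := h (k + 2) (by omega) (by rw [card_irr] at hk'; omega)
  rw [← hcard, sum_sq_mul_pow c hc _ hk, sum_sq_mul_pow c' hc' _ hk] at h1
  have h0 := natCard_ne_zero H
  exact mul_left_cancel₀ (pow_ne_zero _ h0) (mul_left_cancel₀ (inv_ne_zero h0) h1)

omit [Fintype H] in
theorem irrChars_apply_one_le [Finite H] {χ : H → ℂ} (hχ : χ ∈ irrChars H) {d : ℕ}
    (hd : χ 1 = d) : d ≤ Nat.card H := by
  have := Fintype.ofFinite H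
  have hn : ∀ χ ∈ irr H, ∃ d : ℕ, χ 1 = d := fun χ hχ => by
    obtain ⟨d, -, h⟩ := irrChars_apply_one (mem_irr.1 hχ)
    exact ⟨d, h⟩
  choose! n hn using hn
  have h1 := sum_irr_apply_one_mul (1 : H)
  rw [if_pos rfl, Finset.sum_congr rfl fun χ hχ => by rw [hn χ hχ]] at h1
  have h2 : ∑ χ ∈ irr H, n χ * n χ = Nat.card H := by exact_mod_cast h1
  have h3 : n χ * n χ ≤ _ := Finset.single_le_sum (f := fun χ => n χ * n χ)
    (fun _ _ => Nat.zero_le _) (mem_irr.2 hχ)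
  have h4 : n χ = d := by
    have := hn χ (mem_irr.2 hχ)
    rw [hd] at this
    exact_mod_cast this.symm
  rw [h2, h4] at h3
  nlinarith

open Classical in
-- With a cube in the denominator the weight `χ(1)²` does not cancel. Degrees are at most `N`, so a
-- fixed linear combination of the first `2N` sums counts the `χ` with `c χ = 1`.
theorem card_filter_cube_eq {N : ℕ} (c : (H → ℂ) → ℂ) (c' : (H' → ℂ) → ℂ)
    (hc : ∀ χ ∈ irrChars H, c χ = 1 ∨ c χ = -1 ∨ c χ = 0)
    (hc' : ∀ χ ∈ irrChars H', c' χ = 1 ∨ c' χ = -1 ∨ c' χ = 0)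
    (hN : Nat.card H = N) (hN' : Nat.card H' = N)
    (h : ∀ n, 1 ≤ n → n ≤ 2 * N →
      ∑ χ ∈ irr H, χ 1 ^ 2 * (c χ / χ 1 ^ 3) ^ n = ∑ χ ∈ irr H', χ 1 ^ 2 * (c' χ / χ 1 ^ 3) ^ n) :
    ((irr H).filter fun χ => c χ = 1).card = ((irr H').filter fun χ => c' χ = 1).card := by
  obtain ⟨a, ha⟩ := exists_coeff_sum_eq N
  have key : ∀ {L : Type u} [Group L] [Fintype L] (c : (L → ℂ) → ℂ),
      (∀ χ ∈ irrChars L, c χ = 1 ∨ c χ = -1 ∨ c χ = 0) → Nat.card L = N →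
      (((irr L).filter fun χ => c χ = 1).card : ℂ) =
        ∑ n ∈ Finset.Icc 1 (2 * N), a n * ∑ χ ∈ irr L, χ 1 ^ 2 * (c χ / χ 1 ^ 3) ^ n := by
    intro L _ _ c hc hL
    simp only [Finset.mul_sum]
    rw [Finset.sum_comm, Finset.card_filter, Nat.cast_sum]
    refine Finset.sum_congr rfl fun χ hχ => ?_
    obtain ⟨d, hd, hd1⟩ := irrChars_apply_one (mem_irr.1 hχ)
    have := ha d hd (hL ▸ irrChars_apply_one_le (mem_irr.1 hχ) hd1) (c χ)
      (by have := hc χ (mem_irr.1 hχ); tauto)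
    rw [hd1, this]
    push_cast
    rfl
  have h1 := (key c hc hN).trans ((Finset.sum_congr rfl fun n hn => ?_).trans (key c' hc' hN').symm)
  · exact_mod_cast h1
  · rw [h n (Finset.mem_Icc.1 hn).1 (Finset.mem_Icc.1 hn).2]

end

/-! ### Numbers of characters of each type -/

section

variable {Γ : Type u} [Group Γ] [Fintype Γ] {G : Subgroup Γ} [G.Normal] [Fintype G]

omit [Fintype Γ] [Fintype G] in
theorem mem_irrChars_of_charHasType {χ : G → ℂ} {t : DysonType} (h : CharHasType G χ t) :
    χ ∈ irrChars G := by
  have key : ∀ (A : Type) [Semiring A] [Algebra ℝ A], HasRealEnd χ A → χ ∈ irrChars G := by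
    rintro A _ _ ⟨V, _, _, _, ρ, U, _, _, σ, hρ, hχ, -⟩
    exact ⟨V, _, _, ‹_›, ρ, hρ, hχ⟩
  cases t <;> exact key _ h.1

theorem exists_type_weight (hG : G.index = 2) {x : Γ} (hx : x ∉ G) :
    ∃ T : (G → ℂ) → DysonType, (∀ χ ∈ irr G, indicator G χ = typeF (T χ) ∧
      sharpIndicator G χ = typeS (T χ) ∧ (twistChar G x χ = χ ↔ TypeFixed (T χ)) ∧
      ((fun g => χ g⁻¹) = χ ↔ typeF (T χ) ≠ 0) ∧
      ((fun g => χ (MulAut.conjNormal x g)⁻¹) = χ ↔ typeS (T χ) ≠ 0)) ∧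
      ∀ g : DysonType → ℕ, ∑ χ ∈ irr G, g (T χ) = ∑ t, g t * numChars G t := by
  classical
  have : Nonempty DysonType := ⟨.I⟩
  have h : ∀ χ ∈ irrChars G, _ := fun χ hχ => exists_type hG hx hχ
  choose! T h1 h2 using h
  refine ⟨T, fun χ hχ => h2 χ (mem_irr.1 hχ), fun g => ?_⟩
  rw [sum_weight_eq]
  refine Finset.sum_congr rfl fun t _ => ?_
  congr 1
  rw [numChars, ← Set.ncard_coe_finset]
  congr 1
  ext χ
  simp only [Finset.coe_filter, mem_irr, Set.mem_ofPred_eq]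
  exact ⟨fun ⟨hχ, ht⟩ => (h1 χ hχ t).2 ht, fun ht => by
    have hχ := mem_irrChars_of_charHasType ht
    exact ⟨hχ, (h1 χ hχ t).1 ht⟩⟩

open Classical in
/-- The linear equations for the numbers of characters of each type. -/
theorem numChars_equations (hG : G.index = 2) {x : Γ} (hx : x ∉ G) (N : DysonType → ℕ)
    (hN : N = numChars G) :
    (N .I + N .II + N .III + N .IV + N .V + N .VI + N .VII + N .VIII + N .IX + N .X =
      Nat.card (ConjClasses G)) ∧
    (N .I + N .II + N .III + N .VIII + N .IX + N .X = numClasses G .one + numClasses G .twoA) ∧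
    (N .I + N .II + N .IV + N .VIII + N .IX = numClasses G .one + numClasses G .twoB) ∧
    (N .I + N .II + N .V + N .VI + N .VIII + N .IX = numClasses G .one + numClasses G .twoC) ∧
    (N .I + N .II + N .III = ((irr G).filter fun χ => indicator G χ = 1).card) ∧
    (N .I + N .V + N .IX = ((irr G).filter fun χ => sharpIndicator G χ = 1).card) ∧
    (N .I + N .IX =
      ((irr G).filter fun χ => indicator G χ ^ 2 * sharpIndicator G χ = 1).card) ∧
    (N .II + N .VIII =
      ((irr G).filter fun χ => -(indicator G χ ^ 2 * sharpIndicator G χ) = 1).card) ∧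
    (4 * N .I + N .III + N .V =
      2 * ((irr Γ).filter fun ψ => twistedIndicator (MulEquiv.refl Γ) 1 ψ = 1).card) ∧
    (4 * N .I + N .III + N .V + N .VI + 4 * N .VIII + N .X =
      2 * ((irr Γ).filter fun ψ => twistedIndicator (MulEquiv.refl Γ) 1 ψ ≠ 0).card) := by
  obtain ⟨T, hT, hw⟩ := exists_type_weight hG hx
  simp only [sum_dysonType, ← hN] at hw
  obtain ⟨-, hcA, hcB, hcC⟩ := sum_classWeight hG hx
  rw [← hcA, ← hcB, ← hcC,
    ← card_fixed_irr_eq (fun g => g⁻¹) (fun χ hχ => irrChars_comp_inv hχ) invClass fun _ => rfl,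
    ← card_fixed_irr_eq (fun g => MulAut.conjNormal x g) (fun χ hχ => twistChar_mem hχ x)
      (twistClass G x) fun _ => rfl,
    ← card_fixed_irr_eq (fun g => (MulAut.conjNormal x g)⁻¹)
      (fun χ hχ => twistChar_mem (irrChars_comp_inv hχ) x)
      (fun K => twistClass G x (invClass K)) fun _ => by
        rw [twistClass_invClass]; rfl]
  have hcount : ∀ (P : (G → ℂ) → Prop) [DecidablePred P] (Q : DysonType → Prop),
      (∀ χ ∈ irr G, P χ ↔ Q (T χ)) →
        ((irr G).filter P).card = ∑ t, (if Q t then 1 else 0) * N t := by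
    intro P _ Q h
    rw [Finset.card_filter, sum_dysonType, ← hw fun t => if Q t then 1 else 0]
    exact Finset.sum_congr rfl fun χ hχ => by simp only [h χ hχ]
  have h1 : (1 : ℂ) ≠ -1 := by norm_num
  -- The weights `4` and `1` are those of `sum_irr_hat`, for characters that the twist fixes and
  -- moves.
  have hhat : ∀ (P : ℂ → Prop) [DecidablePred P] (g : DysonType → ℕ), (∀ t, (g t : ℂ) =
      if TypeFixed t then 4 * (if P ((typeF t + typeS t) / 2) then 1 else 0)
        else if P (typeF t + typeS t) then 1 else 0) →
      2 * ((irr Γ).filter fun ψ => P (twistedIndicator (MulEquiv.refl Γ) 1 ψ)).card =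
        ∑ t, g t * N t := by
    intro P _ g hg
    have := sum_irr_hat hG hx fun z => if P z then 1 else 0
    rw [Finset.card_filter, sum_dysonType, ← hw]
    have h2 := this.trans (Finset.sum_congr rfl fun χ hχ => (?_ : _ = (g (T χ) : ℂ)))
    · exact_mod_cast h2
    · rw [hg, (hT χ hχ).1, (hT χ hχ).2.1]
      by_cases hb : TypeFixed (T χ)
      · rw [if_pos hb, if_pos ((hT χ hχ).2.2.1.2 hb)]
      · rw [if_neg hb, if_neg (fun h => hb ((hT χ hχ).2.2.1.1 h))]
  refine ⟨?_, ?_, ?_, ?_, ?_, ?_, ?_, ?_, ?_, ?_⟩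
  · have := hw fun _ => 1
    simpa [card_irr] using this.symm
  · refine Eq.trans ?_ (hcount _ (fun t => typeF t ≠ 0) fun χ hχ => (hT χ hχ).2.2.2.1).symm
    simp [typeF, sum_dysonType]
  · refine Eq.trans ?_ (hcount _ TypeFixed fun χ hχ => (hT χ hχ).2.2.1).symm
    simp [TypeFixed, sum_dysonType]
  · refine Eq.trans ?_ (hcount _ (fun t => typeS t ≠ 0) fun χ hχ => (hT χ hχ).2.2.2.2).symm
    simp [typeS, sum_dysonType]
  · refine Eq.trans ?_ (hcount _ (fun t => typeF t = 1) fun χ hχ => by rw [(hT χ hχ).1]).symm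
    simp [typeF, sum_dysonType, h1.symm]
  · refine Eq.trans ?_ (hcount _ (fun t => typeS t = 1) fun χ hχ => by rw [(hT χ hχ).2.1]).symm
    simp [typeS, sum_dysonType, h1.symm]
  · refine Eq.trans ?_ (hcount _ (fun t => typeF t ^ 2 * typeS t = 1) fun χ hχ => by
      rw [(hT χ hχ).1, (hT χ hχ).2.1]).symm
    simp [typeF, typeS, sum_dysonType, h1.symm]
  · refine Eq.trans ?_ (hcount _ (fun t => -(typeF t ^ 2 * typeS t) = 1) fun χ hχ => by
      rw [(hT χ hχ).1, (hT χ hχ).2.1]).symm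
    simp [typeF, typeS, sum_dysonType, h1.symm]
  -- Indicator `1` occurs above type I, as `(1 + 1) / 2` with weight `4`, and above III and V, as `1
  -- + 0` and `0 + 1` with weight `1`.
  · let g : DysonType → ℕ
      | .I => 4
      | .III | .V => 1
      | _ => 0
    refine Eq.trans ?_ (hhat (fun z => z = 1) g fun t => by
      cases t <;> norm_num [TypeFixed, typeF, typeS, g]).symm
    simp [g, sum_dysonType]
  -- Nonzero indicators occur in addition above VIII, as `(-1 - 1) / 2`, and above VI and X. For II
  -- and IX the two indicators cancel.
  · let g : DysonType → ℕ
      | .I | .VIII => 4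
      | .III | .V | .VI | .X => 1
      | _ => 0
    refine Eq.trans ?_ (hhat (fun z => z ≠ 0) g fun t => by
      cases t <;> norm_num [TypeFixed, typeF, typeS, g]).symm
    simp [g, sum_dysonType]

end

/-! ### The numbers `S_v` and `S_w`: positivity means indicator one -/

section

variable {Γ : Type u} [Group Γ] {G : Subgroup Γ} [G.Normal]

omit [G.Normal] in
theorem indicator_mem [Finite G] {χ : G → ℂ} (hχ : χ ∈ irrChars G) :
    indicator G χ = 1 ∨ indicator G χ = -1 ∨ indicator G χ = 0 := by
  have := Fintype.ofFinite G
  rw [indicator_eq]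
  exact twistedIndicator_refl_mem hχ

theorem sharpIndicator_mem [Finite G] (hG : G.index = 2) {χ : G → ℂ} (hχ : χ ∈ irrChars G) :
    sharpIndicator G χ = 1 ∨ sharpIndicator G χ = -1 ∨ sharpIndicator G χ = 0 := by
  have := Fintype.ofFinite G
  obtain ⟨x, hx⟩ := exists_notMem_of_index_two hG
  rcases sharpIndicator_trichotomy hG hx hχ with ⟨h | h, -⟩ | ⟨h, -⟩ <;> simp [h]

theorem indicator_sq_mul_mem [Finite G] (hG : G.index = 2) {χ : G → ℂ} (hχ : χ ∈ irrChars G) :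
    indicator G χ ^ 2 * sharpIndicator G χ = 1 ∨ indicator G χ ^ 2 * sharpIndicator G χ = -1 ∨
      indicator G χ ^ 2 * sharpIndicator G χ = 0 := by
  rcases indicator_mem hχ with h | h | h <;> rcases sharpIndicator_mem hG hχ with h' | h' | h' <;>
    simp [h, h']

omit [G.Normal] in
open Classical in
theorem ncard_isPositive [Finite G] (c : (G → ℂ) → ℂ)
    (hc : ∀ χ ∈ irrChars G, c χ = 1 ∨ c χ = -1 ∨ c χ = 0) :
    {χ ∈ irrChars G | IsPositive (c χ / χ 1)}.ncard = ((irr G).filter fun χ => c χ = 1).card := by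
  rw [← Set.ncard_coe_finset]
  congr 1
  ext χ
  simp only [Finset.coe_filter, mem_irr, Set.mem_ofPred_eq]
  refine and_congr_right fun hχ => ?_
  obtain ⟨d, hd, hd1⟩ := irrChars_apply_one hχ
  rw [hd1, isPositive_div_iff (hc χ hχ) hd]

open Classical in
theorem card_filter_isPositive {H : Type u} [Group H] [Finite H] (c : (H → ℂ) → ℂ)
    (hc : ∀ χ ∈ irrChars H, c χ = 1 ∨ c χ = -1 ∨ c χ = 0) :
    ((irr H).filter fun χ => IsPositive (c χ / χ 1)).card =
      ((irr H).filter fun χ => c χ = 1).card := by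
  congr 1
  refine Finset.filter_congr fun χ hχ => ?_
  obtain ⟨d, hd, hd1⟩ := irrChars_apply_one (mem_irr.1 hχ)
  rw [hd1, isPositive_div_iff (hc χ (mem_irr.1 hχ)) hd]

open Classical in
theorem card_filter_div_ne_zero {H : Type u} [Group H] [Finite H] (c : (H → ℂ) → ℂ) :
    ((irr H).filter fun χ => c χ / χ 1 ≠ 0).card = ((irr H).filter fun χ => c χ ≠ 0).card := by
  congr 1
  refine Finset.filter_congr fun χ hχ => ?_
  obtain ⟨d, hd, hd1⟩ := irrChars_apply_one (mem_irr.1 hχ)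
  have : (d : ℂ) ≠ 0 := by exact_mod_cast hd.ne'
  rw [hd1]
  simp [this]

theorem numChars_eq_Sv_Sw [Finite Γ] (hG : G.index = 2) :
    numChars G .I + numChars G .V + numChars G .IX = Sv G ∧
      numChars G .I + numChars G .IX = Sw G := by
  classical
  have := Fintype.ofFinite Γ
  obtain ⟨x, hx⟩ := exists_notMem_of_index_two hG
  obtain ⟨-, -, -, -, -, h1, h2, -⟩ := numChars_equations hG hx _ rfl
  rw [Sv, Sw, ncard_isPositive _ fun χ hχ => sharpIndicator_mem hG hχ,
    ncard_isPositive (fun χ => indicator G χ ^ 2 * sharpIndicator G χ)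
      fun χ hχ => indicator_sq_mul_mem hG hχ]
  constructor
  · convert h1
  · convert h2

end

/-! ### The group-theoretic data determine the numbers of all types -/

section

variable {Γ Γ' : Type u} [Group Γ] [Finite Γ] [Group Γ'] [Finite Γ'] {G : Subgroup Γ} [G.Normal]
  {G' : Subgroup Γ'} [G'.Normal] (hG : G.index = 2) (hG' : G'.index = 2) {k : ℕ}
  (h : SameGroupData k G G')

include hG hG' h

theorem sum_eq_of_sameGroupData (hk : 2 * Nat.card G ≤ k) {n : ℕ} (hn : 1 ≤ n)
    (hn' : n ≤ 2 * Nat.card G) :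
    ∑ χ ∈ irr G, χ 1 ^ 2 * (indicator G χ ^ 2 * sharpIndicator G χ / χ 1 ^ 3) ^ n =
      ∑ χ ∈ irr G', χ 1 ^ 2 * (indicator G' χ ^ 2 * sharpIndicator G' χ / χ 1 ^ 3) ^ n := by
  have h0 := natCard_ne_zero G
  have h1 : (wCount G n : ℂ) = wCount G' n := by rw [h.w_eq n hn (hn'.trans hk)]
  rw [wCount_eq hG, wCount_eq hG', ← h.card_eq] at h1
  have h2 := mul_left_cancel₀ (inv_ne_zero h0) h1
  simp only [mul_pow _ _ n, mul_left_comm _ (((Nat.card G : ℂ) ^ 3) ^ n), ← Finset.mul_sum] at h2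
  exact mul_left_cancel₀ (pow_ne_zero _ (pow_ne_zero _ h0)) h2

theorem card_conjClasses_eq_of_sameGroupData :
    Nat.card (ConjClasses G) = Nat.card (ConjClasses G') := by
  obtain ⟨x, hx⟩ := exists_notMem_of_index_two hG
  obtain ⟨x', hx'⟩ := exists_notMem_of_index_two hG'
  rw [(sum_classWeight hG hx).1, (sum_classWeight hG' hx').1]
  simp only [h.numClasses_eq]

open Classical in
theorem card_indicator_eq_of_sameGroupData :
    ((irr G).filter fun χ => indicator G χ = 1).card =
      ((irr G').filter fun χ => indicator G' χ = 1).card := by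
  have := Fintype.ofFinite Γ
  have := Fintype.ofFinite Γ'
  have hF := card_filter_eq_of_sum_eq (indicator G) (indicator G') (fun χ hχ => indicator_mem hχ)
    (fun χ hχ => indicator_mem hχ) h.card_eq (card_conjClasses_eq_of_sameGroupData hG hG' h)
    (fun m hm hm' => by
      have := congrArg (Nat.cast (R := ℂ)) (h.square_eq m hm hm')
      rw [squareCount_eq, squareCount_eq] at this
      simpa only [indicator_eq] using this) IsPositive
  rwa [card_filter_isPositive _ fun χ hχ => indicator_mem hχ,
    card_filter_isPositive _ fun χ hχ => indicator_mem hχ] at hF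

open Classical in
theorem card_sharpIndicator_eq_of_sameGroupData :
    ((irr G).filter fun χ => sharpIndicator G χ = 1).card =
      ((irr G').filter fun χ => sharpIndicator G' χ = 1).card := by
  have := Fintype.ofFinite Γ
  have := Fintype.ofFinite Γ'
  have hS := card_filter_eq_of_sum_eq (sharpIndicator G) (sharpIndicator G')
    (fun χ hχ => sharpIndicator_mem hG hχ) (fun χ hχ => sharpIndicator_mem hG' hχ) h.card_eq
    (card_conjClasses_eq_of_sameGroupData hG hG' h) (fun m hm hm' => by
      have := congrArg (Nat.cast (R := ℂ)) (h.v_eq m hm hm')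
      rwa [vCount_eq hG, vCount_eq hG'] at this) IsPositive
  rwa [card_filter_isPositive _ fun χ hχ => sharpIndicator_mem hG hχ,
    card_filter_isPositive _ fun χ hχ => sharpIndicator_mem hG' hχ] at hS

open Classical in
-- The solution counts in `Γ` determine the whole multiset of `F / ψ(1)`, from which both its
-- positive and its nonzero elements can be counted.
theorem card_hat_eq_of_sameGroupData [Fintype Γ] [Fintype Γ'] :
    ((irr Γ).filter fun ψ => twistedIndicator (MulEquiv.refl Γ) 1 ψ = 1).card =
        ((irr Γ').filter fun ψ => twistedIndicator (MulEquiv.refl Γ') 1 ψ = 1).card ∧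
      ((irr Γ).filter fun ψ => twistedIndicator (MulEquiv.refl Γ) 1 ψ ≠ 0).card =
        ((irr Γ').filter fun ψ => twistedIndicator (MulEquiv.refl Γ') 1 ψ ≠ 0).card := by
  have hcard : Nat.card Γ = Nat.card Γ' := by
    rw [← G.card_mul_index, ← G'.card_mul_index, hG, hG', h.card_eq]
  have hΓ := card_filter_eq_of_sum_eq (twistedIndicator (MulEquiv.refl Γ) 1)
    (twistedIndicator (MulEquiv.refl Γ') 1) (fun χ hχ => twistedIndicator_refl_mem hχ)
    (fun χ hχ => twistedIndicator_refl_mem hχ) hcard h.card_classes_eq (fun m hm hm' => by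
      have := congrArg (Nat.cast (R := ℂ)) (h.square_hat_eq m hm hm')
      rwa [squareCount_eq, squareCount_eq] at this)
  have hA := hΓ IsPositive
  have hB := hΓ fun z => z ≠ 0
  rw [card_filter_isPositive _ fun χ hχ => twistedIndicator_refl_mem hχ,
    card_filter_isPositive _ fun χ hχ => twistedIndicator_refl_mem hχ] at hA
  rw [card_filter_div_ne_zero, card_filter_div_ne_zero] at hB
  exact ⟨hA, hB⟩

open Classical in
-- The value `-1` is reduced to the value `1` by negating `F² F♯`, which multiplies the `n`-th sum
-- by `(-1)^n`.
theorem card_indicator_sq_mul_eq_of_sameGroupData (hk : 2 * Nat.card G ≤ k) :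
    ((irr G).filter fun χ => indicator G χ ^ 2 * sharpIndicator G χ = 1).card =
        ((irr G').filter fun χ => indicator G' χ ^ 2 * sharpIndicator G' χ = 1).card ∧
      ((irr G).filter fun χ => -(indicator G χ ^ 2 * sharpIndicator G χ) = 1).card =
        ((irr G').filter fun χ => -(indicator G' χ ^ 2 * sharpIndicator G' χ) = 1).card := by
  have := Fintype.ofFinite Γ
  have := Fintype.ofFinite Γ'
  have hw := fun n hn hn' => sum_eq_of_sameGroupData hG hG' h hk (n := n) hn hn'
  have hneg : ∀ z : ℂ, z = 1 ∨ z = -1 ∨ z = 0 → -z = 1 ∨ -z = -1 ∨ -z = 0 := by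
    rintro z (rfl | rfl | rfl) <;> simp
  have hpow : ∀ (a b : ℂ) (n : ℕ), b ^ 2 * (-a / b ^ 3) ^ n =
      (-1) ^ n * (b ^ 2 * (a / b ^ 3) ^ n) := fun a b n => by
    rw [neg_div, neg_pow, mul_left_comm]
  refine ⟨card_filter_cube_eq (N := Nat.card G)
    (fun χ : G → ℂ => indicator G χ ^ 2 * sharpIndicator G χ)
    (fun χ : G' → ℂ => indicator G' χ ^ 2 * sharpIndicator G' χ)
    (fun χ hχ => indicator_sq_mul_mem hG hχ) (fun χ hχ => indicator_sq_mul_mem hG' hχ)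
    rfl h.card_eq.symm hw, card_filter_cube_eq (N := Nat.card G)
    (fun χ : G → ℂ => -(indicator G χ ^ 2 * sharpIndicator G χ))
    (fun χ : G' → ℂ => -(indicator G' χ ^ 2 * sharpIndicator G' χ))
    (fun χ hχ => hneg _ (indicator_sq_mul_mem hG hχ))
    (fun χ hχ => hneg _ (indicator_sq_mul_mem hG' hχ)) rfl h.card_eq.symm fun n hn hn' => ?_⟩
  simp only [hpow, ← Finset.mul_sum, hw n hn hn']

theorem numChars_eq_of_sameGroupData (hk : 2 * Nat.card G ≤ k) (t : DysonType) :
    numChars G t = numChars G' t := by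
  have := Fintype.ofFinite Γ
  have := Fintype.ofFinite Γ'
  have := Fintype.ofFinite G
  have := Fintype.ofFinite G'
  obtain ⟨x, hx⟩ := exists_notMem_of_index_two hG
  obtain ⟨x', hx'⟩ := exists_notMem_of_index_two hG'
  generalize hN : numChars G = N
  generalize hN' : numChars G' = N'
  obtain ⟨hA, hB⟩ := card_hat_eq_of_sameGroupData hG hG' h
  obtain ⟨hW, hW'⟩ := card_indicator_sq_mul_eq_of_sameGroupData hG hG' h hk
  have e := numChars_equations hG hx N hN.symm
  simp only [h.numClasses_eq] at e
  rw [card_conjClasses_eq_of_sameGroupData hG hG' h, card_indicator_eq_of_sameGroupData hG hG' h,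
    card_sharpIndicator_eq_of_sameGroupData hG hG' h, hA, hB, hW, hW'] at e
  obtain ⟨a1, a2, a3, a4, a5, a6, a7, a8, a9, a10⟩ := e
  obtain ⟨b1, b2, b3, b4, b5, b6, b7, b8, b9, b10⟩ := numChars_equations hG' hx' N' hN'.symm
  rw [← b1] at a1
  rw [← b2] at a2
  rw [← b3] at a3
  rw [← b4] at a4
  rw [← b5] at a5
  rw [← b6] at a6
  rw [← b7] at a7
  rw [← b8] at a8
  rw [← b9] at a9
  rw [← b10] at a10
  have hV : N .V = N' .V := by linarith only [a6, a7]
  have hIV : N .IV = N' .IV := by linarith only [a3, a7, a8]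
  have hVI : N .VI = N' .VI := by linarith only [a4, a7, a8, hV]
  have hVII : N .VII = N' .VII := by linarith only [a1, a2, hIV, hV, hVI]
  -- Earlier equations express IX, II and VIII through I with slopes `-1`, `3` and `-3`. Once V and
  -- VI are known, the remaining equations give `3 VIII - IX`, whose slope `-8` is nonzero, so I is
  -- determined.
  have hI : N .I = N' .I := by linarith only [a2, a5, a7, a8, a9, a10, hV, hVI]
  have hIX : N .IX = N' .IX := by linarith only [a7, hI]
  have hIII : N .III = N' .III := by linarith only [a9, hI, hV]
  have hII : N .II = N' .II := by linarith only [a5, hI, hIII]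
  have hVIII : N .VIII = N' .VIII := by linarith only [a8, hII]
  have hX : N .X = N' .X := by linarith only [a2, hI, hII, hIII, hVIII, hIX]
  cases t <;> assumption

end

end DysonTypes

end

theorem mainTheorem4 :
    (∀ (Γ : Type u) [Group Γ] [Finite Γ] (G : Subgroup Γ) [G.Normal], G.index = 2 →
      numChars G .I + numChars G .V + numChars G .IX = Sv G ∧
      numChars G .I + numChars G .IX = Sw G) ∧
    LinearIndependent ℚ tenForms ∧
    (∀ N : ℕ, ∃ k : ℕ, ∀ (Γ Γ' : Type u) [Group Γ] [Finite Γ] [Group Γ'] [Finite Γ']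
      (G : Subgroup Γ) [G.Normal] (G' : Subgroup Γ') [G'.Normal],
      G.index = 2 → G'.index = 2 → Nat.card G = N → SameGroupData k G G' →
      ∀ t, numChars G t = numChars G' t) := by
  -- `2 * N` bounds the degree of the interpolating polynomial, hence the number of mixed equations
  -- needed.
  refine ⟨fun Γ _ _ G _ hG => DysonTypes.numChars_eq_Sv_Sw hG,
    DysonTypes.linearIndependent_tenForms, fun N => ⟨2 * N, ?_⟩⟩
  intro Γ Γ' _ _ _ _ G _ G' _ hG hG' hN h t
  exact DysonTypes.numChars_eq_of_sameGroupData hG hG' h (by rw [hN]) t
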